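/- For an integer $\nu>1$ let $\mathcal H_\nu$ be the Hilbert space of analytic functions $f$ on the open unit disc $\mathbb D$ with $$\|f\|_\nu^2=\int_{\mathbb D}|f(z)|^2\,d\iota_\nu(z)<\infty,\qquad d\iota_\nu(z)=(\nu-1)(1-|z|^2)^{\nu}\frac{dz}{\pi(1-|z|^2)^2}.$$ Let $\mu,\nu>1$ be integers and $k\ge 0$ an integer. Let $P_k\colon \mathcal H_\mu\otimes\mathcal H_\nu\to\mathcal H_{\mu+\nu+2k}$ (Hilbert space tensor product, $f\otimes g$ being the function $f(z)g(w)$) be the projection onto the component $\mathcal H_{\mu+\nu+2k}$ of $\mathcal H_\mu\otimes\mathcal H_\nu\cong\bigoplus_{k\ge0}\mathcal H_{\mu+\nu+2k}$, that is, the bounded operator $$P_k(F)(\zeta)=C_{\mu,\nu,k}\sum_{j=0}^k(-1)^j\binom kj\frac{1}{(\mu)_j(\nu)_{k-j}}\,\partial_z^j\partial_w^{k-j}F(z,w)\Big|_{z=w=\zeta},$$ $$C_{\mu,\nu,k}^{-2}=\|(z-w)^k\|^2_{\mathcal H_\mu\otimes\mathcal H_\nu}=k!\sum_{j=0}^k\binom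 kj\frac{1}{(\mu)_j(\nu)_{k-j}},$$ where $(a)_j=a(a+1)\cdots(a+j-1)$. For $A\in B(\mathcal H_\mu)$ put $\mathcal T^\nu_{\mu,k}(A)=P_k(A\otimes I)P_k^*\in B(\mathcal H_{\mu+\nu+2k})$. Then: 1. $\mathcal T^\nu_{\mu,k}$ is unital: $\mathcal T^\nu_{\mu,k}(I)=I$. 2. $\mathcal T^\nu_{\mu,k}$ is weak-$*$ continuous, where $B(\mathcal H)$ carries the weak-$*$ topology as the dual of the trace class operators under $(A,\rho)\mapsto\mathrm{Tr}(A\rho)$. 3. $\mathcal T^\nu_{\mu,k}$ sends compact operators to compact operators. 4. As an operator $B(\mathcal H_\mu)\to B(\mathcal H_{\mu+\nu+2k})$ it has norm $\|\mathcal T^\nu_{\mu,k}\|=1$. 5. For every real $p$ with $1\le p<\infty$ it maps the Schatten class $S^p(\mathcal H_\mu)$ to $S^p(\mathcal H_{\mu+\nu+2k})$, with $$\|\mathcal T^\nu_{\mu,k}\|_{p\to p}\le\Big(2\,\frac{\mu+\nu+2k-1}{\mu-1}\Big)^{1/p}.$$ -/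

import Mathlib

open MeasureTheory Metric
open scoped ENNReal TensorProduct Topology InnerProductSpace

noncomputable section

namespace BergmanChannel

/-! ## The weighted Bergman spaces on the unit disc -/

/-- The measure `dι_ν(z) = (ν - 1) (1 - |z|²)^ν dz / (π (1 - |z|²)²)` on the open unit disc,
as a measure on `ℂ` that is carried by the disc. -/
def diskMeasure (ν : ℕ) : Measure ℂ :=
  (volume.restrict (ball (0 : ℂ) 1)).withDensity fun z =>
    ENNReal.ofReal (((ν : ℝ) - 1) * (1 - ‖z‖ ^ 2) ^ ν / (Real.pi * (1 - ‖z‖ ^ 2) ^ 2))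

/-- The subspace of `L²(dι_ν)` of the classes of the analytic functions on the disc. -/
def bergmanSubmodule (ν : ℕ) : Submodule ℂ (Lp ℂ 2 (diskMeasure ν)) where
  carrier := {f | ∃ F : ℂ → ℂ, DifferentiableOn ℂ F (ball 0 1) ∧ f =ᵐ[diskMeasure ν] F}
  add_mem' := by
    rintro f g ⟨F, hF, hfF⟩ ⟨G, hG, hgG⟩
    exact ⟨F + G, hF.add hG, (Lp.coeFn_add f g).trans (hfF.add hgG)⟩
  zero_mem' := ⟨0, differentiableOn_const 0, Lp.coeFn_zero ℂ 2 (diskMeasure ν)⟩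
  smul_mem' := by
    rintro c f ⟨F, hF, hfF⟩
    exact ⟨c • F, hF.const_smul c, (Lp.coeFn_smul c f).trans (hfF.const_smul c)⟩

/-- The Hilbert space `H_ν` of the analytic functions on the disc that are square integrable for
`dι_ν`, with the norm of `L²(dι_ν)`. -/
def Bergman (ν : ℕ) : Type := bergmanSubmodule ν

namespace Bergman

variable {ν : ℕ}

instance : NormedAddCommGroup (Bergman ν) :=
  inferInstanceAs (NormedAddCommGroup (bergmanSubmodule ν))

instance : InnerProductSpace ℂ (Bergman ν) :=
  inferInstanceAs (InnerProductSpace ℂ (bergmanSubmodule ν))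

/-- The inclusion of `H_ν` in `L²(dι_ν)`. -/
def toLp : Bergman ν →ₗᵢ[ℂ] Lp ℂ 2 (diskMeasure ν) := (bergmanSubmodule ν).subtypeₗᵢ

theorem toLp_mem (f : Bergman ν) : toLp f ∈ bergmanSubmodule ν := Subtype.property f

end Bergman

/-- The analytic function on the disc that an element of `H_ν` is. For `ν > 1` its values on the
disc are determined by the class; its values off the disc mean nothing. -/
def holo {ν : ℕ} (f : Bergman ν) : ℂ → ℂ := f.toLp_mem.choose

theorem differentiableOn_holo {ν : ℕ} (f : Bergman ν) :
    DifferentiableOn ℂ (holo f) (ball 0 1) := f.toLp_mem.choose_spec.1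

theorem coeFn_ae_eq_holo {ν : ℕ} (f : Bergman ν) :
    Bergman.toLp f =ᵐ[diskMeasure ν] holo f := f.toLp_mem.choose_spec.2

/-! ### Completeness of `H_ν` -/

theorem two_pi_mul_enorm_le {F : ℂ → ℂ} {w : ℂ} {δ r : ℝ} (hr : r ∈ Set.Ioo 0 δ)
    (hF : DifferentiableOn ℂ F (ball w δ)) :
    ENNReal.ofReal (2 * Real.pi) * ‖F w‖ₑ ≤
      ∫⁻ θ in Set.Ioo (-Real.pi) Real.pi, ‖F (w + Complex.polarCoord.symm (r, θ))‖ₑ := by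
  have h1 : Real.circleAverage F w r = F w := by
    apply DiffContOnCl.circleAverage
    rw [abs_of_pos hr.1]
    apply DifferentiableOn.diffContOnCl
    exact hF.mono (closure_ball_subset_closedBall.trans (closedBall_subset_ball hr.2))
  have h2 : ∫ θ in (-Real.pi)..Real.pi, F (circleMap w r θ) = (2 * Real.pi : ℝ) • F w := by
    rw [← h1, Real.circleAverage_def, smul_inv_smul₀ (by positivity)]
    have := ((periodic_circleMap w r).comp F).intervalIntegral_add_eq (-Real.pi) 0
    simp only [Function.comp_def, zero_add] at this
    rw [← this]
    congr 1
    ring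
  have h3 : ENNReal.ofReal (2 * Real.pi) * ‖F w‖ₑ = ‖(2 * Real.pi : ℝ) • F w‖ₑ := by
    rw [enorm_smul, Real.enorm_eq_ofReal (by positivity)]
  rw [h3, ← h2, intervalIntegral.integral_of_le (by linarith [Real.pi_pos]),
    integral_Ioc_eq_integral_Ioo]
  refine (enorm_integral_le_lintegral_enorm _).trans_eq ?_
  simp [circleMap, Complex.exp_mul_I]

theorem enorm_center_le {F : ℂ → ℂ} {w : ℂ} {δ : ℝ} (hδ : 0 < δ)
    (hF : DifferentiableOn ℂ F (ball w δ)) :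
    ENNReal.ofReal (δ ^ 2 / 4) * ‖F w‖ₑ ≤ ∫⁻ z in ball w δ, ‖F z‖ₑ := by
  classical
  set g : ℂ → ℝ≥0∞ := (ball w δ).piecewise (fun z => ‖F z‖ₑ) 0 with hg
  have hgm : Measurable g :=
    hF.continuousOn.enorm.measurable_piecewise continuousOn_const measurableSet_ball
  have h0 : ∫⁻ z in ball w δ, ‖F z‖ₑ = ∫⁻ z, g (w + z) := by
    rw [lintegral_add_left_eq_self g w, ← lintegral_indicator measurableSet_ball, hg,
      Set.piecewise_eq_indicator]
  rw [h0, ← Complex.lintegral_comp_polarCoord_symm, Complex.polarCoord.eq_1]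
  change _ ≤ ∫⁻ p in Set.Ioi (0 : ℝ) ×ˢ Set.Ioo (-Real.pi) Real.pi,
    ENNReal.ofReal p.1 • g (w + Complex.polarCoord.symm p)
  have hm : Measurable fun p : ℝ × ℝ => ENNReal.ofReal p.1 • g (w + Complex.polarCoord.symm p) := by
    simp only [Complex.polarCoord_symm_apply, smul_eq_mul]
    exact (by fun_prop : Measurable fun p : ℝ × ℝ => ENNReal.ofReal p.1).mul
      (hgm.comp (by fun_prop))
  rw [Measure.volume_eq_prod, ← Measure.prod_restrict, lintegral_prod _ hm.aemeasurable]
  calc ENNReal.ofReal (δ ^ 2 / 4) * ‖F w‖ₑ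
      ≤ ∫⁻ r in Set.Ioo (δ / 2) δ, ENNReal.ofReal (δ / 2) * ‖F w‖ₑ := by
        rw [setLIntegral_const, Real.volume_Ioo, mul_right_comm,
          ← ENNReal.ofReal_mul (by positivity)]
        gcongr
        exact le_of_eq (by ring)
    _ ≤ ∫⁻ r in Set.Ioo (δ / 2) δ, ∫⁻ θ in Set.Ioo (-Real.pi) Real.pi,
          ENNReal.ofReal r • g (w + Complex.polarCoord.symm (r, θ)) := by
        refine setLIntegral_mono' measurableSet_Ioo fun r hr => ?_
        have hr0 : 0 < r := lt_trans (by positivity) hr.1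
        have hgr : ∀ θ : ℝ, g (w + Complex.polarCoord.symm (r, θ)) =
            ‖F (w + Complex.polarCoord.symm (r, θ))‖ₑ := by
          intro θ
          refine Set.piecewise_eq_of_mem _ _ _ ?_
          rw [mem_ball, dist_eq_norm, add_sub_cancel_left, Complex.norm_polarCoord_symm]
          simpa [abs_of_pos hr0] using hr.2
        simp only [hgr, smul_eq_mul]
        rw [lintegral_const_mul' _ _ ENNReal.ofReal_ne_top]
        gcongr
        · exact hr.1.le
        · refine le_trans ?_ (two_pi_mul_enorm_le ⟨hr0, hr.2⟩ hF)
          refine le_mul_of_one_le_left' ?_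
          rw [ENNReal.one_le_ofReal]
          linarith [Real.pi_gt_three]
    _ ≤ _ := lintegral_mono_set fun r hr => lt_trans (by positivity) hr.1

theorem le_diskDensity {ν : ℕ} (hν : 1 < ν) {r : ℝ} (hr : r < 1) {z : ℂ} (hz : ‖z‖ ≤ r) :
    ((ν : ℝ) - 1) * (1 - r ^ 2) ^ ν / Real.pi ≤
      ((ν : ℝ) - 1) * (1 - ‖z‖ ^ 2) ^ ν / (Real.pi * (1 - ‖z‖ ^ 2) ^ 2) := by
  have h1 : (1 : ℝ) < ν := by exact_mod_cast hν
  have h0 := norm_nonneg z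
  have h2 : ‖z‖ ^ 2 ≤ r ^ 2 := by gcongr
  have h3 : r ^ 2 < 1 := by nlinarith
  have h4 : (1 - ‖z‖ ^ 2) ^ 2 ≤ 1 := pow_le_one₀ (by linarith) (by nlinarith)
  have h5 : 0 < 1 - ‖z‖ ^ 2 := by linarith
  have hpi := Real.pi_pos
  refine div_le_div₀ ?_ ?_ (by positivity) ?_
  · exact mul_nonneg (by linarith) (by positivity)
  · refine mul_le_mul_of_nonneg_left ?_ (by linarith)
    exact pow_le_pow_left₀ (by linarith) (by linarith) ν
  · nlinarith

/-- Point evaluations are locally uniformly bounded in the norm of `L²(dι_ν)`. -/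
theorem exists_norm_le {ν : ℕ} (hν : 1 < ν) {z₀ : ℂ} (hz₀ : z₀ ∈ ball (0 : ℂ) 1) :
    ∃ δ > 0, ball z₀ δ ⊆ ball 0 1 ∧ ∃ C : ℝ, 0 ≤ C ∧ ∀ (f : Lp ℂ 2 (diskMeasure ν)) (F : ℂ → ℂ),
      DifferentiableOn ℂ F (ball 0 1) → f =ᵐ[diskMeasure ν] F → ∀ w ∈ ball z₀ δ,
        ‖F w‖ ≤ C * ‖f‖ := by
  rw [mem_ball_zero_iff] at hz₀
  set δ : ℝ := (1 - ‖z₀‖) / 3 with hδ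
  have hδ0 : 0 < δ := by simp only [hδ]; linarith
  set r : ℝ := ‖z₀‖ + 2 * δ with hr
  have hr1 : r < 1 := by simp only [hr, hδ]; linarith
  have hr0 : 0 ≤ r := by positivity
  have hsub : ∀ w ∈ ball z₀ δ, ball w δ ⊆ ball (0 : ℂ) r := fun w hw =>
    ball_subset_ball' (by
      have h1 := mem_ball.1 hw
      have h2 := dist_triangle w z₀ 0
      rw [dist_zero_right] at h2 ⊢
      rw [dist_zero_right] at h2
      simp only [hr]; linarith)
  have hsub1 : ball (0 : ℂ) r ⊆ ball 0 1 := ball_subset_ball hr1.le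
  set c : ℝ := ((ν : ℝ) - 1) * (1 - r ^ 2) ^ ν / Real.pi with hc
  have hc0 : 0 < c := by
    have h1 : (1 : ℝ) < ν := by exact_mod_cast hν
    have : r ^ 2 < 1 := by nlinarith
    have h5 : 0 < 1 - r ^ 2 := by linarith
    have : 0 < (ν : ℝ) - 1 := by linarith
    have := Real.pi_pos
    positivity
  have hle : ∀ w ∈ ball z₀ δ,
      ENNReal.ofReal c • volume.restrict (ball w δ) ≤ diskMeasure ν := by
    intro w hw
    rw [← withDensity_const]
    refine Measure.le_iff.2 fun s hs => ?_
    rw [withDensity_apply _ hs, diskMeasure, withDensity_apply _ hs,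
      Measure.restrict_restrict hs, Measure.restrict_restrict hs]
    calc ∫⁻ z in s ∩ ball w δ, ENNReal.ofReal c
        ≤ ∫⁻ z in s ∩ ball w δ, ENNReal.ofReal
            (((ν : ℝ) - 1) * (1 - ‖z‖ ^ 2) ^ ν / (Real.pi * (1 - ‖z‖ ^ 2) ^ 2)) :=
          setLIntegral_mono' (hs.inter measurableSet_ball) fun z hz =>
            ENNReal.ofReal_le_ofReal (le_diskDensity hν hr1
              (mem_ball_zero_iff.1 (hsub w hw hz.2)).le)
      _ ≤ _ := lintegral_mono_set
          (Set.inter_subset_inter_right _ ((hsub w hw).trans hsub1))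
  have hc' : ENNReal.ofReal c ≠ 0 := by simpa using hc0
  set K : ℝ≥0∞ := (ENNReal.ofReal (δ ^ 2 / 4))⁻¹ *
    ((ENNReal.ofReal c ^ (1 / (2 : ℝ≥0∞)).toReal)⁻¹ *
      volume (ball (0 : ℂ) 1) ^ (1 / (1 : ℝ≥0∞).toReal - 1 / (2 : ℝ≥0∞).toReal)) with hK
  have hKtop : K ≠ ∞ := by
    refine ENNReal.mul_ne_top ?_ (ENNReal.mul_ne_top ?_ ?_)
    · rw [ENNReal.inv_ne_top]
      have : 0 < δ ^ 2 / 4 := by positivity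
      simpa using this
    · rw [ENNReal.inv_ne_top]
      exact (ENNReal.rpow_pos (pos_iff_ne_zero.2 hc') ENNReal.ofReal_ne_top).ne'
    · exact ENNReal.rpow_ne_top_of_nonneg (by norm_num) measure_ball_lt_top.ne
  refine ⟨δ, hδ0, fun w hw => hsub1 (hsub w hw (mem_ball_self hδ0)), K.toReal,
    ENNReal.toReal_nonneg, fun f F hF hfF w hw => ?_⟩
  have hFw : DifferentiableOn ℂ F (ball w δ) := hF.mono ((hsub w hw).trans hsub1)
  have hm : AEStronglyMeasurable F (volume.restrict (ball w δ)) :=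
    hFw.continuousOn.aestronglyMeasurable measurableSet_ball
  have h1 := enorm_center_le hδ0 hFw
  rw [← eLpNorm_one_eq_lintegral_enorm] at h1
  have h2 := eLpNorm_le_eLpNorm_mul_rpow_measure_univ (p := 1) (q := 2) (by norm_num) hm
  have h3 : ENNReal.ofReal c ^ (1 / (2 : ℝ≥0∞)).toReal *
      eLpNorm F 2 (volume.restrict (ball w δ)) ≤ eLpNorm F 2 (diskMeasure ν) := by
    rw [← smul_eq_mul, ← eLpNorm_smul_measure_of_ne_zero hc']
    exact eLpNorm_mono_measure _ (hle w hw)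
  have h4 : ‖F w‖ₑ ≤ K * ‖f‖ₑ := by
    have hf : ‖f‖ₑ = eLpNorm F 2 (diskMeasure ν) := by
      rw [Lp.enorm_def, eLpNorm_congr_ae hfF]
    have hd : ENNReal.ofReal (δ ^ 2 / 4) ≠ 0 := by
      have : 0 < δ ^ 2 / 4 := by positivity
      simpa using this
    have hce : ENNReal.ofReal c ^ (1 / (2 : ℝ≥0∞)).toReal ≠ 0 :=
      (ENNReal.rpow_pos (pos_iff_ne_zero.2 hc') ENNReal.ofReal_ne_top).ne'
    have hce' : ENNReal.ofReal c ^ (1 / (2 : ℝ≥0∞)).toReal ≠ ∞ :=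
      ENNReal.rpow_ne_top_of_nonneg ENNReal.toReal_nonneg ENNReal.ofReal_ne_top
    rw [hf, hK, mul_assoc, ← ENNReal.mul_le_iff_le_inv hd ENNReal.ofReal_ne_top]
    refine h1.trans (h2.trans ?_)
    rw [mul_right_comm]
    refine mul_le_mul' ?_ ?_
    · rwa [← ENNReal.mul_le_iff_le_inv hce hce']
    · refine ENNReal.rpow_le_rpow ?_ (by norm_num)
      rw [Measure.restrict_apply_univ]
      exact measure_mono ((hsub w hw).trans hsub1)
  have h5 := ENNReal.toReal_mono (ENNReal.mul_ne_top hKtop enorm_ne_top) h4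
  simpa using h5

theorem diskMeasure_eq_zero {ν : ℕ} (hν : ν ≤ 1) : diskMeasure ν = 0 := by
  have h : ∀ z : ℂ, ENNReal.ofReal
      (((ν : ℝ) - 1) * (1 - ‖z‖ ^ 2) ^ ν / (Real.pi * (1 - ‖z‖ ^ 2) ^ 2)) = 0 := by
    intro z
    rw [ENNReal.ofReal_eq_zero]
    have := Real.pi_pos
    interval_cases ν
    · refine div_nonpos_of_nonpos_of_nonneg (by norm_num) (by positivity)
    · simp
  simp [diskMeasure, h]

theorem isClosed_bergman (ν : ℕ) :
    IsClosed (bergmanSubmodule ν : Set (Lp ℂ 2 (diskMeasure ν))) := by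
  rcases le_or_gt ν 1 with hν | hν
  · have h : (bergmanSubmodule ν : Set (Lp ℂ 2 (diskMeasure ν))) = Set.univ := by
      refine Set.eq_univ_of_forall fun f => ⟨0, differentiableOn_const 0, ?_⟩
      simp [diskMeasure_eq_zero hν, Filter.EventuallyEq]
    rw [h]
    exact isClosed_univ
  refine IsSeqClosed.isClosed fun u f hu huf => ?_
  choose F hF huF using hu
  have hcau := huf.cauchySeq
  have hloc : ∀ z₀ ∈ ball (0 : ℂ) 1, ∃ δ > 0, UniformCauchySeqOn F Filter.atTop (ball z₀ δ) := by
    intro z₀ hz₀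
    obtain ⟨δ, hδ, -, C, hC, hle⟩ := exists_norm_le hν hz₀
    refine ⟨δ, hδ, Metric.uniformCauchySeqOn_iff.2 fun ε hε => ?_⟩
    obtain ⟨N, hN⟩ := Metric.cauchySeq_iff.1 hcau (ε / (C + 1)) (by positivity)
    refine ⟨N, fun m hm n hn w hw => ?_⟩
    have h1 := hle (u m - u n) (F m - F n) ((hF m).sub (hF n))
      ((Lp.coeFn_sub _ _).trans ((huF m).sub (huF n))) w hw
    have h2 := hN m hm n hn
    rw [dist_eq_norm] at h2 ⊢
    rw [lt_div_iff₀ (by positivity)] at h2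
    have h3 := norm_nonneg (u m - u n)
    simp only [Pi.sub_apply] at h1
    nlinarith
  have hpt : ∀ z ∈ ball (0 : ℂ) 1, ∃ y, Filter.Tendsto (fun n => F n z) Filter.atTop (𝓝 y) := by
    intro z hz
    obtain ⟨δ, hδ, h⟩ := hloc z hz
    exact cauchySeq_tendsto_of_complete (h.cauchySeq (mem_ball_self hδ))
  choose! G hG using hpt
  have hunif : TendstoLocallyUniformlyOn F G Filter.atTop (ball 0 1) := by
    intro u hu z hz
    obtain ⟨δ, hδ, h⟩ := hloc z hz
    exact ⟨ball z δ ∩ ball 0 1,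
      Filter.inter_mem (mem_nhdsWithin_of_mem_nhds (ball_mem_nhds z hδ)) self_mem_nhdsWithin,
      (h.mono Set.inter_subset_left).tendstoUniformlyOn_of_tendsto (fun x hx => hG x hx.2) u hu⟩
  have hGd := hunif.differentiableOn (Filter.Eventually.of_forall hF) isOpen_ball
  obtain ⟨ns, hns, hae⟩ := (tendstoInMeasure_of_tendsto_Lp huf).exists_seq_tendsto_ae
  refine ⟨G, hGd, ?_⟩
  have hball : ∀ᵐ z ∂diskMeasure ν, z ∈ ball (0 : ℂ) 1 :=
    (withDensity_absolutelyContinuous _ _).ae_le (ae_restrict_mem measurableSet_ball)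
  filter_upwards [hae, hball, ae_all_iff.2 huF] with z hz hzb hzF
  refine tendsto_nhds_unique hz ?_
  simp only [hzF]
  exact (hG z hzb).comp hns.tendsto_atTop

instance (ν : ℕ) : CompleteSpace (Bergman ν) :=
  have : CompleteSpace (bergmanSubmodule ν) := (isClosed_bergman ν).completeSpace_coe
  inferInstanceAs (CompleteSpace (bergmanSubmodule ν))

/-! ## Hilbert space tensor products -/

section Tensor

variable {E F : Type*} [NormedAddCommGroup E] [InnerProductSpace ℂ E]
  [NormedAddCommGroup F] [InnerProductSpace ℂ F]

variable (E F) in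
/-- The Hilbert space tensor product: the completion of the algebraic tensor product for the inner
product with `⟪x ⊗ y, x' ⊗ y'⟫ = ⟪x, x'⟫ ⟪y, y'⟫`. -/
def HilbertTensor : Type _ := UniformSpace.Completion (E ⊗[ℂ] F)

namespace HilbertTensor

instance : NormedAddCommGroup (HilbertTensor E F) :=
  inferInstanceAs (NormedAddCommGroup (UniformSpace.Completion (E ⊗[ℂ] F)))

instance : InnerProductSpace ℂ (HilbertTensor E F) :=
  inferInstanceAs (InnerProductSpace ℂ (UniformSpace.Completion (E ⊗[ℂ] F)))

instance : CompleteSpace (HilbertTensor E F) :=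
  inferInstanceAs (CompleteSpace (UniformSpace.Completion (E ⊗[ℂ] F)))

variable (E F) in
/-- The inclusion of the algebraic tensor product. -/
def incl : E ⊗[ℂ] F →ₗᵢ[ℂ] HilbertTensor E F :=
  (UniformSpace.Completion.toComplₗᵢ : E ⊗[ℂ] F →ₗᵢ[ℂ] UniformSpace.Completion (E ⊗[ℂ] F))

theorem denseRange_incl : DenseRange (incl E F) :=
  UniformSpace.Completion.denseRange_coe (α := E ⊗[ℂ] F)

end HilbertTensor

/-- The elementary tensor `x ⊗ y`. -/
def tmul (x : E) (y : F) : HilbertTensor E F := HilbertTensor.incl E F (x ⊗ₜ[ℂ] y)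

theorem inner_tmul_tmul (x x' : E) (y y' : F) :
    ⟪tmul x y, tmul x' y'⟫_ℂ = ⟪x, x'⟫_ℂ * ⟪y, y'⟫_ℂ := by
  rw [tmul, tmul, LinearIsometry.inner_map_map, TensorProduct.inner_tmul]

/-- Bounded operators that agree on the elementary tensors are equal. -/
theorem HilbertTensor.clm_ext {G : Type*} [NormedAddCommGroup G] [NormedSpace ℂ G]
    {S T : HilbertTensor E F →L[ℂ] G} (h : ∀ x y, S (tmul x y) = T (tmul x y)) : S = T := by
  refine ContinuousLinearMap.coeFn_injective (denseRange_incl.equalizer S.continuous T.continuous ?_)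
  have : S.toLinearMap ∘ₗ (incl E F).toLinearMap = T.toLinearMap ∘ₗ (incl E F).toLinearMap :=
    TensorProduct.ext' h
  exact funext fun x => LinearMap.congr_fun this x

theorem norm_sq_sum_tmul {ι : Type*} [Fintype ι] (e : ι → E) {f : ι → F}
    (hf : Orthonormal ℂ f) : ‖∑ i, e i ⊗ₜ[ℂ] f i‖ ^ 2 = ∑ i, ‖e i‖ ^ 2 := by
  classical
  rw [← @inner_self_eq_norm_sq ℂ]
  simp only [sum_inner, inner_sum, TensorProduct.inner_tmul, orthonormal_iff_ite.mp hf]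
  simp [← Complex.ofReal_pow]

theorem norm_rTensor_le (A : E →L[ℂ] E) (x : E ⊗[ℂ] F) :
    ‖(A : E →ₗ[ℂ] E).rTensor F x‖ ≤ ‖A‖ * ‖x‖ := by
  classical
  obtain ⟨F', hF', hx⟩ :=
    TensorProduct.exists_finite_submodule_right_of_setFinite {x} (Set.finite_singleton x)
  obtain ⟨y, rfl⟩ := Set.singleton_subset_iff.mp hx
  let b := stdOrthonormalBasis ℂ F'
  obtain ⟨c, rfl⟩ := TensorProduct.eq_repr_basis_right b.toBasis y
  have hb : Orthonormal ℂ fun i => (b i : F) := b.orthonormal.comp_linearIsometry F'.subtypeₗᵢ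
  rw [Finsupp.sum_fintype _ _ (by simp)]
  simp only [map_sum, LinearMap.lTensor_tmul, LinearMap.rTensor_tmul, Submodule.subtype_apply,
    OrthonormalBasis.coe_toBasis, ContinuousLinearMap.coe_coe]
  refine le_of_sq_le_sq ?_ (by positivity)
  rw [mul_pow, norm_sq_sum_tmul _ hb, norm_sq_sum_tmul _ hb, Finset.mul_sum]
  gcongr with i
  rw [← mul_pow]
  gcongr
  exact A.le_opNorm _



variable (F) in
/-- The bounded operator `A ⊗ I`: the extension of `x ⊗ y ↦ A x ⊗ y` by linearity and
continuity. -/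
def tensorId (A : E →L[ℂ] E) : HilbertTensor E F →L[ℂ] HilbertTensor E F :=
  (((HilbertTensor.incl E F).toLinearMap ∘ₗ (A : E →ₗ[ℂ] E).rTensor F)).extendOfNorm
    (HilbertTensor.incl E F).toLinearMap

theorem norm_incl_rTensor_le (A : E →L[ℂ] E) (x : E ⊗[ℂ] F) :
    ‖((HilbertTensor.incl E F).toLinearMap ∘ₗ (A : E →ₗ[ℂ] E).rTensor F) x‖ ≤
      ‖A‖ * ‖(HilbertTensor.incl E F).toLinearMap x‖ := by
  simpa using norm_rTensor_le A x

theorem tensorId_tmul (A : E →L[ℂ] E) (x : E) (y : F) :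
    tensorId F A (tmul x y) = tmul (A x) y :=
  LinearMap.extendOfNorm_eq HilbertTensor.denseRange_incl ⟨_, norm_incl_rTensor_le A⟩ _

theorem norm_tensorId_le (A : E →L[ℂ] E) : ‖tensorId F A‖ ≤ ‖A‖ :=
  LinearMap.opNorm_extendOfNorm_le HilbertTensor.denseRange_incl (norm_nonneg _)
    (norm_incl_rTensor_le A)

theorem tmul_add_left (x x' : E) (y : F) : tmul (x + x') y = tmul x y + tmul x' y := by
  simp [tmul, TensorProduct.add_tmul]

theorem tmul_smul_left (c : ℂ) (x : E) (y : F) : tmul (c • x) y = c • tmul x y := by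
  rw [tmul, ← TensorProduct.smul_tmul', map_smul, tmul]

variable (E F) in
/-- The linear map `A ↦ A ⊗ I` from the bounded operators on `E` to those on `E ⊗ F`. -/
def ampliation : (E →L[ℂ] E) →L[ℂ] (HilbertTensor E F →L[ℂ] HilbertTensor E F) :=
  LinearMap.mkContinuous
    { toFun := tensorId F
      map_add' := fun A B => HilbertTensor.clm_ext fun x y => by
        simp [tensorId_tmul, tmul_add_left]
      map_smul' := fun c A => HilbertTensor.clm_ext fun x y => by
        simp [tensorId_tmul, tmul_smul_left] } 1
    fun A => (norm_tensorId_le A).trans_eq (one_mul _).symm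

end Tensor

/-! ## Trace, Schatten classes and the weak-* topology -/

section Operators

variable (E : Type*) [NormedAddCommGroup E] [InnerProductSpace ℂ E] [CompleteSpace E]

/-- The index set of the Hilbert basis `basis E`. -/
def basisIndex : Set E := (exists_hilbertBasis ℂ E).choose

/-- An orthonormal basis of `E`, in which traces are computed. -/
def basis : HilbertBasis (basisIndex E) ℂ E := (exists_hilbertBasis ℂ E).choose_spec.choose

variable {E}

/-- The map `S ↦ P S P*`. -/
def conjMap {G : Type*} [NormedAddCommGroup G] [InnerProductSpace ℂ G] [CompleteSpace G]
    (P : E →L[ℂ] G) : (E →L[ℂ] E) →L[ℂ] (G →L[ℂ] G) :=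
  ContinuousLinearMap.compL ℂ G E G P ∘L
    (ContinuousLinearMap.compL ℂ G E E).flip P.adjoint

/-- The trace of a positive operator, a number in `[0, ∞]`. -/
def posTrace (A : E →L[ℂ] E) : ℝ≥0∞ :=
  ∑' i, ENNReal.ofReal (⟪basis E i, A (basis E i)⟫_ℂ).re

/-- The trace of a trace class operator. -/
def trace (A : E →L[ℂ] E) : ℂ := ∑' i, ⟪basis E i, A (basis E i)⟫_ℂ

/-- Membership in the Schatten class `S^p`, `0 < p < ∞`: the trace of `|A|^p` is finite, where
`|A| = (A* A)^{1/2}`. -/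
def MemSchatten (p : ℝ) (A : E →L[ℂ] E) : Prop := posTrace (CFC.abs A ^ p) < ∞

/-- The Schatten norm `‖A‖_p = (Tr |A|^p)^{1/p}` of an operator in `S^p`. -/
def schattenNorm (p : ℝ) (A : E →L[ℂ] E) : ℝ := (posTrace (CFC.abs A ^ p)).toReal ^ (1 / p)

variable (E) in
/-- The weak-* topology of `B(E)` as the dual of the trace class operators `S^1`: the coarsest
topology that makes `A ↦ Tr (A ρ)` continuous for all `ρ` in `S^1`. -/
abbrev weakStarTopology : TopologicalSpace (E →L[ℂ] E) :=
  ⨅ ρ : {ρ : E →L[ℂ] E // MemSchatten 1 ρ},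
    TopologicalSpace.induced (fun A : E →L[ℂ] E => trace (A ∘L ρ.1)) inferInstance

end Operators

/-! ## The channels -/

/-- The square of the norm of `(z - w)^k` in `H_μ ⊗ H_ν`, which is `C_{μ,ν,k}⁻²`. -/
def normSqDiffPow (μ ν k : ℕ) : ℝ :=
  k.factorial * ∑ j ∈ Finset.range (k + 1),
    (k.choose j : ℝ) / (μ.ascFactorial j * ν.ascFactorial (k - j))

/-- The constant `C_{μ,ν,k} = ‖(z - w)^k‖⁻¹`, which makes `P_k P_k*` the identity. -/
def projConst (μ ν k : ℕ) : ℝ := (Real.sqrt (normSqDiffPow μ ν k))⁻¹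

/-- `P : H_μ ⊗ H_ν → H_{μ+ν+2k}` is given by
`P F (ζ) = C ∑_{j ≤ k} (-1)^j (k choose j) ((μ)_j (ν)_{k-j})⁻¹ ∂_z^j ∂_w^{k-j} F (z, w)` at
`z = w = ζ`, where `f ⊗ g` is the function `f(z) g(w)`. -/
def IsComponentProj (μ ν k : ℕ)
    (P : HilbertTensor (Bergman μ) (Bergman ν) →L[ℂ] Bergman (μ + ν + 2 * k)) : Prop :=
  ∀ (f : Bergman μ) (g : Bergman ν), ∀ ζ ∈ ball (0 : ℂ) 1,
    holo (P (tmul f g)) ζ = (projConst μ ν k : ℂ) * ∑ j ∈ Finset.range (k + 1),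
      (-1) ^ j * (k.choose j : ℂ) / ((μ.ascFactorial j : ℂ) * (ν.ascFactorial (k - j) : ℂ)) *
        (iteratedDeriv j (holo f) ζ * iteratedDeriv (k - j) (holo g) ζ)

theorem eq_of_holo_eqOn {ν : ℕ} {f g : Bergman ν} (h : ∀ z ∈ ball (0 : ℂ) 1, holo f z = holo g z) :
    f = g := by
  have hball : ∀ᵐ z ∂diskMeasure ν, z ∈ ball (0 : ℂ) 1 :=
    (withDensity_absolutelyContinuous _ _).ae_le (ae_restrict_mem measurableSet_ball)
  refine Bergman.toLp.injective (Lp.ext ?_)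
  filter_upwards [hball, coeFn_ae_eq_holo f, coeFn_ae_eq_holo g] with z hz hf hg
  rw [hf, hg, h z hz]

theorem IsComponentProj.unique {μ ν k : ℕ}
    {P Q : HilbertTensor (Bergman μ) (Bergman ν) →L[ℂ] Bergman (μ + ν + 2 * k)}
    (hP : IsComponentProj μ ν k P) (hQ : IsComponentProj μ ν k Q) : P = Q :=
  HilbertTensor.clm_ext fun f g => eq_of_holo_eqOn fun z hz => by rw [hP f g z hz, hQ f g z hz]

open Classical in
/-- The projection `P_k` of `H_μ ⊗ H_ν` onto its component `H_{μ+ν+2k}`: the bounded operator that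
is given by the formula of `IsComponentProj`. (It is unique by `IsComponentProj.unique`; were there
none, the value would be `0`, and `A ↦ P_k (A ⊗ I) P_k*` would not be unital.) -/
def componentProj (μ ν k : ℕ) :
    HilbertTensor (Bergman μ) (Bergman ν) →L[ℂ] Bergman (μ + ν + 2 * k) :=
  if h : ∃ P, IsComponentProj μ ν k P then h.choose else 0

/-- The channel `T A = P_k (A ⊗ I) P_k*` from `B(H_μ)` to `B(H_{μ+ν+2k})`. -/
def channel (μ ν k : ℕ) : (Bergman μ →L[ℂ] Bergman μ) →L[ℂ]
    (Bergman (μ + ν + 2 * k) →L[ℂ] Bergman (μ + ν + 2 * k)) :=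
  conjMap (componentProj μ ν k) ∘L ampliation (Bergman μ) (Bergman ν)

theorem channel_apply (μ ν k : ℕ) (A : Bergman μ →L[ℂ] Bergman μ) :
    channel μ ν k A =
      componentProj μ ν k ∘L tensorId (Bergman ν) A ∘L (componentProj μ ν k).adjoint := rfl

end BergmanChannel

end

noncomputable section

namespace BergmanChannel

/-! ## Sums of squares over Hilbert bases -/

section Parseval

variable {ι κ E G : Type*} [NormedAddCommGroup E] [InnerProductSpace ℂ E]
  [NormedAddCommGroup G] [InnerProductSpace ℂ G]

/-! Let `e_n` be the normalized monomials of the second factor `H_ν`, write `P` for the projection,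
and put `V_n x = P (x ⊗ e_n)`. Expanding the second factor in this basis gives `T(A) = ∑ V_n A V_n*`
in the weak sense (`isKrausFamily_conjMap`). All five claims then follow from two facts: (i) `∑ V_n
V_n* = P P* = I`; (ii) `∑ V_n* V_n ≤ c I` with `c = (μ+ν+2k-1)/(μ-1)`.

Fact (i) makes `T` unital and contractive. It also makes the predual map `R ↦ ∑ V_n* R V_n` preserve
absolutely convergent sums of rank one operators, which gives weak-* continuity. With (ii), `T` maps
Hilbert–Schmidt operators to Hilbert–Schmidt operators, hence by norm limits compact operators to
compact operators. For `S^p`, write each singular value of `T(A)` through singular vectors. It is at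
most a combination of the singular values of `A`, with nonnegative weights whose row sums are at
most 1 by (i) and whose column sums are at most `c` by (ii). Jensen's inequality then gives
`‖T(A)‖_p ≤ c^{1/p} ‖A‖_p` (`IsKrausFamily.posTrace_abs_rpow_le`), so the factor 2 in the claim is
slack.

The two facts are statements about numbers. The bidifferential operator sends `z^a w^n` to `D(a,n)
ζ^(a+n-k)` with `D` = `diffValue`, and `D` satisfies one recursion from the lowering operators and
one from the raising operators of the `sl₂` actions. Fact (i) says that the normalized squares of
`D` sum to 1 along each antidiagonal `a + n = m + k`. This goes by induction on `m`, since lowering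
and raising are adjoint to each other (`sum_antidiagonal_diffValue_sq`). Hence `P*` can be built as
an isometry, and its adjoint satisfies the defining formula (`isComponentProj_proj`).

Fact (ii) bounds the sum over `n` for fixed `a`. The same recursions turn the difference of the
columns `a` and `a+1` into a telescoping sum whose boundary term is eventually nonnegative
(`columnTerm_sub`), so the bound passes from `a` to `a+1`. The column `a = 0` is a Gauss
hypergeometric series at 1 (`sum_factorial_ascFactorial_le`). -/

theorem enorm_inner_comm (x y : E) : ‖⟪x, y⟫_ℂ‖ₑ = ‖⟪y, x⟫_ℂ‖ₑ := by
  rw [← ofReal_norm, norm_inner_symm, ofReal_norm]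

theorem hasSum_norm_inner_sq (b : HilbertBasis ι ℂ E) (x : E) :
    HasSum (fun i => ‖⟪b i, x⟫_ℂ‖ ^ 2) (‖x‖ ^ 2) := by
  have h := b.hasSum_inner_mul_inner x x
  rw [← Complex.hasSum_ofReal]
  convert! h using 1
  · ext i
    rw [← inner_conj_symm x (b i), Complex.conj_mul']
    simp
  · rw [inner_self_eq_norm_sq_to_K]
    simp

theorem tsum_enorm_inner_sq (b : HilbertBasis ι ℂ E) (x : E) :
    ∑' i, ‖⟪b i, x⟫_ℂ‖ₑ ^ 2 = ‖x‖ₑ ^ 2 := by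
  have h := hasSum_norm_inner_sq b x
  have h2 := ENNReal.ofReal_tsum_of_nonneg (fun i => by positivity) h.summable
  rw [h.tsum_eq] at h2
  simpa [ENNReal.ofReal_pow] using h2.symm

theorem tsum_enorm_inner_sq_le {v : ι → E} (hv : Orthonormal ℂ v) (x : E) :
    ∑' i, ‖⟪v i, x⟫_ℂ‖ₑ ^ 2 ≤ ‖x‖ₑ ^ 2 := by
  have h2 := ENNReal.ofReal_tsum_of_nonneg (fun i => by positivity)
    (Orthonormal.inner_products_summable x hv)
  have h3 := ENNReal.ofReal_le_ofReal (Orthonormal.tsum_inner_products_le x hv)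
  rw [h2] at h3
  simpa [ENNReal.ofReal_pow] using h3

theorem mul_le_half_add_sq (a b : ℝ≥0∞) : a * b ≤ 2⁻¹ * (a ^ 2 + b ^ 2) := by
  refine (ENNReal.young_inequality a b Real.HolderConjugate.two_two).trans_eq ?_
  simp [div_eq_mul_inv, mul_comm, mul_add]

theorem mul_le_add_sq (a b : ℝ≥0∞) : a * b ≤ a ^ 2 + b ^ 2 :=
  (mul_le_half_add_sq a b).trans
    (mul_le_of_le_one_left' (ENNReal.inv_le_one.2 one_le_two))

theorem tsum_mul_sq_le (f g : ι → ℝ≥0∞) :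
    (∑' i, f i * g i) ^ 2 ≤ (∑' i, f i ^ 2) * ∑' i, g i ^ 2 := by
  have h : ∀ s : Finset ι, ∑ i ∈ s, f i * g i ≤
      (∑' i, f i ^ 2) ^ (1 / 2 : ℝ) * (∑' i, g i ^ 2) ^ (1 / 2 : ℝ) := by
    intro s
    refine (ENNReal.inner_le_Lp_mul_Lq s f g Real.HolderConjugate.two_two).trans ?_
    gcongr
    · simpa using ENNReal.sum_le_tsum (f := fun i => f i ^ 2) s
    · simpa using ENNReal.sum_le_tsum (f := fun i => g i ^ 2) s
  have h2 : ∑' i, f i * g i ≤ (∑' i, f i ^ 2) ^ (1 / 2 : ℝ) * (∑' i, g i ^ 2) ^ (1 / 2 : ℝ) := by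
    rw [ENNReal.tsum_eq_iSup_sum]
    exact iSup_le h
  calc (∑' i, f i * g i) ^ 2
      ≤ ((∑' i, f i ^ 2) ^ (1 / 2 : ℝ) * (∑' i, g i ^ 2) ^ (1 / 2 : ℝ)) ^ 2 := by gcongr
    _ = _ := by
      rw [mul_pow, ← ENNReal.rpow_natCast, ← ENNReal.rpow_natCast, ← ENNReal.rpow_mul,
        ← ENNReal.rpow_mul]
      norm_num

/-- Jensen's inequality for weights of total mass at most one. -/
theorem tsum_mul_rpow_le {p : ℝ} (hp : 1 ≤ p) (w f : ι → ℝ≥0∞) (hw : ∑' i, w i ≤ 1) :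
    (∑' i, w i * f i) ^ p ≤ ∑' i, w i * f i ^ p := by
  have hp0 : 0 < p := by linarith
  have h : ∀ s : Finset ι, ∑ i ∈ s, w i * f i ≤ (∑' i, w i * f i ^ p) ^ p⁻¹ := by
    intro s
    refine (ENNReal.inner_le_weight_mul_Lp_of_nonneg s hp w f).trans ?_
    calc _ ≤ (1 : ℝ≥0∞) * (∑ i ∈ s, w i * f i ^ p) ^ p⁻¹ := by
          gcongr
          refine ENNReal.rpow_le_one ((ENNReal.sum_le_tsum s).trans hw) ?_
          have := inv_le_one_of_one_le₀ hp
          linarith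
      _ ≤ _ := by
          rw [one_mul]
          gcongr
          exact ENNReal.sum_le_tsum s
  have h2 : ∑' i, w i * f i ≤ (∑' i, w i * f i ^ p) ^ p⁻¹ := by
    rw [ENNReal.tsum_eq_iSup_sum]
    exact iSup_le h
  calc _ ≤ ((∑' i, w i * f i ^ p) ^ p⁻¹) ^ p := by gcongr
    _ = _ := by rw [← ENNReal.rpow_mul, inv_mul_cancel₀ hp0.ne', ENNReal.rpow_one]

/-- The operator norm is at most the Hilbert–Schmidt norm: expand `x` and apply Cauchy–Schwarz. -/
theorem enorm_apply_sq_le (b : HilbertBasis ι ℂ E) (T : E →L[ℂ] G) (x : E) :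
    ‖T x‖ₑ ^ 2 ≤ (∑' i, ‖T (b i)‖ₑ ^ 2) * ‖x‖ₑ ^ 2 := by
  have h : ‖T x‖ₑ ≤ ∑' i, ‖T (b i)‖ₑ * ‖⟪b i, x⟫_ℂ‖ₑ := by
    have h1 := (b.hasSum_repr x).mapL T
    rw [← h1.tsum_eq]
    refine enorm_tsum_le_tsum_enorm.trans_eq ?_
    simp [enorm_smul, b.repr_apply_apply, mul_comm]
  calc ‖T x‖ₑ ^ 2 ≤ (∑' i, ‖T (b i)‖ₑ * ‖⟪b i, x⟫_ℂ‖ₑ) ^ 2 := by gcongr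
    _ ≤ _ := (tsum_mul_sq_le _ _).trans_eq (by rw [tsum_enorm_inner_sq])

variable [CompleteSpace E] [CompleteSpace G]

/-- Both sides are the double sum of `|⟪b' j, T (b i)⟫|²`. Hence the Hilbert–Schmidt norm depends
neither on the basis nor on passing to the adjoint. -/
theorem tsum_enorm_apply_sq (b : HilbertBasis ι ℂ E) (b' : HilbertBasis κ ℂ G) (T : E →L[ℂ] G) :
    ∑' i, ‖T (b i)‖ₑ ^ 2 = ∑' j, ‖T.adjoint (b' j)‖ₑ ^ 2 := by
  simp_rw [← tsum_enorm_inner_sq b', ← tsum_enorm_inner_sq b (T.adjoint _)]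
  rw [ENNReal.tsum_comm]
  simp_rw [ContinuousLinearMap.adjoint_inner_right, enorm_inner_comm (T _)]

/-- Frees the trace from the basis chosen in its definition: with `X = Y* Y` it is the squared
Hilbert–Schmidt norm of `Y`. -/
theorem posTrace_eq_tsum (b : HilbertBasis ι ℂ E) {X : E →L[ℂ] E} (hX : 0 ≤ X) :
    posTrace X = ∑' i, ENNReal.ofReal (⟪b i, X (b i)⟫_ℂ).re := by
  obtain ⟨Y, rfl⟩ := CStarAlgebra.nonneg_iff_eq_star_mul_self.1 hX
  have h : ∀ x : E, ENNReal.ofReal (⟪x, (star Y * Y) x⟫_ℂ).re = ‖Y x‖ₑ ^ 2 := by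
    intro x
    rw [ContinuousLinearMap.star_eq_adjoint, ContinuousLinearMap.mul_def,
      ContinuousLinearMap.comp_apply, ContinuousLinearMap.adjoint_inner_right, inner_self_eq_norm_sq_to_K]
    rw [← ofReal_norm, ← ENNReal.ofReal_pow (norm_nonneg _)]
    congr 1
    norm_cast
  simp only [posTrace, h]
  rw [tsum_enorm_apply_sq (basis E) (basis E), tsum_enorm_apply_sq b (basis E)]

end Parseval

/-! ## Compactness -/

section Compact

variable {ι E G : Type*} [NormedAddCommGroup E] [InnerProductSpace ℂ E]
  [NormedAddCommGroup G] [InnerProductSpace ℂ G]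

theorem isCompactOperator_rankOne (x : G) (y : E) :
    IsCompactOperator (InnerProductSpace.rankOne ℂ x y) := by
  have h : IsCompactOperator ((ContinuousLinearMap.toSpanSingleton ℂ x) ∘L (innerSL ℂ y)) :=
    (isCompactOperator_of_locallyCompactSpace_rng
      (ContinuousLinearMap.toSpanSingleton ℂ x)).comp_clm (innerSL ℂ y)
  exact h

theorem isCompactOperator_sum_rankOne (s : Finset ι) (x : ι → G) (y : ι → E) :
    IsCompactOperator (∑ i ∈ s, InnerProductSpace.rankOne ℂ (x i) (y i) : E →L[ℂ] G) :=
  (compactOperator (RingHom.id ℂ) E G).sum_mem fun i _ => isCompactOperator_rankOne (x i) (y i)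

theorem sum_rankOne_apply_basis [DecidableEq ι] (b : HilbertBasis ι ℂ E) (T : E →L[ℂ] G)
    (s : Finset ι) (i : ι) :
    (∑ j ∈ s, InnerProductSpace.rankOne ℂ (T (b j)) (b j)) (b i) = if i ∈ s then T (b i) else 0 := by
  simp [orthonormal_iff_ite.1 b.orthonormal]

variable [CompleteSpace G]

/-- A Hilbert–Schmidt operator is compact. -/
theorem isCompactOperator_of_tsum_enorm_sq_ne_top (b : HilbertBasis ι ℂ E) (T : E →L[ℂ] G)
    (hT : ∑' i, ‖T (b i)‖ₑ ^ 2 ≠ ∞) : IsCompactOperator T := by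
  classical
  -- The finite rank truncations converge in norm, because the squared Hilbert–Schmidt norm of the
  -- remainder is a tail of the convergent sum.
  have hlim : Filter.Tendsto
      (fun s : Finset ι => ∑ j ∈ s, InnerProductSpace.rankOne ℂ (T (b j)) (b j))
      Filter.atTop (𝓝 T) := by
    rw [tendsto_iff_edist_tendsto_0]
    have h0 := ENNReal.tendsto_tsum_compl_atTop_zero hT
    have h1 : Filter.Tendsto (fun s : Finset ι =>
        (∑' i : {i // i ∉ s}, ‖T (b i)‖ₑ ^ 2) ^ (1 / 2 : ℝ)) Filter.atTop (𝓝 0) := by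
      simpa using h0.ennrpow_const (1 / 2 : ℝ)
    refine tendsto_of_tendsto_of_tendsto_of_le_of_le tendsto_const_nhds h1 (fun _ => zero_le)
      fun s => ?_
    set K := ∑ j ∈ s, InnerProductSpace.rankOne ℂ (T (b j)) (b j) with hK
    rw [edist_comm, edist_eq_enorm_sub]
    refine ContinuousLinearMap.opENorm_le_bound _ fun x => ?_
    have h2 := enorm_apply_sq_le b (T - K) x
    have h3 : ∑' i, ‖(T - K) (b i)‖ₑ ^ 2 = ∑' i : {i // i ∉ s}, ‖T (b i)‖ₑ ^ 2 := by
      have := tsum_subtype {i | i ∉ s} fun i => ‖T (b i)‖ₑ ^ 2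
      refine Eq.trans ?_ this.symm
      refine tsum_congr fun i => ?_
      rw [sub_apply, hK, sum_rankOne_apply_basis]
      by_cases hi : i ∈ s <;> simp [hi]
    rw [h3] at h2
    have h4 := ENNReal.rpow_le_rpow h2 (by norm_num : (0 : ℝ) ≤ 1 / 2)
    rw [ENNReal.mul_rpow_of_nonneg _ _ (by norm_num), ← ENNReal.rpow_natCast,
      ← ENNReal.rpow_natCast, ← ENNReal.rpow_mul, ← ENNReal.rpow_mul] at h4
    simpa using h4
  exact isCompactOperator_of_tendsto hlim (.of_forall fun s => isCompactOperator_sum_rankOne s _ _)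

variable [CompleteSpace E]

/-- A compact operator is a limit of Hilbert–Schmidt operators. -/
theorem exists_enorm_sub_le_of_isCompactOperator (b : HilbertBasis ι ℂ E) {A : E →L[ℂ] G}
    (hA : IsCompactOperator A) {ε : ℝ} (hε : 0 < ε) :
    ∃ K : E →L[ℂ] G, ∑' i, ‖K (b i)‖ₑ ^ 2 ≠ ∞ ∧ ‖A - K‖ ≤ ε := by
  have htb : TotallyBounded (A '' closedBall 0 1) :=
    (hA.isCompact_closure_image_closedBall 1).totallyBounded.subset subset_closure
  obtain ⟨t, ht, hcov⟩ := Metric.totallyBounded_iff.1 htb ε hε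
  -- `W` is spanned by a finite `ε`-net of the image of the unit ball. The projection to `W` is the
  -- nearest point, so it moves `A x` by at most `ε`, and composing with it leaves finite rank.
  let W : Submodule ℂ G := Submodule.span ℂ t
  have : FiniteDimensional ℂ W := FiniteDimensional.span_of_finite ℂ ht
  refine ⟨W.starProjection ∘L A, ?_, ?_⟩
  · let w := stdOrthonormalBasis ℂ W
    have h1 : ∀ z : G, ‖W.starProjection z‖ₑ ^ 2 = ∑ j, ‖⟪(w j : G), z⟫_ℂ‖ₑ ^ 2 := by
      intro z
      have h2 := w.sum_sq_norm_inner_right (W.orthogonalProjectionOnto z)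
      have h3 := congrArg ENNReal.ofReal h2
      rw [ENNReal.ofReal_sum_of_nonneg (fun _ _ => by positivity)] at h3
      simp only [ENNReal.ofReal_pow (norm_nonneg _), ofReal_norm] at h3
      have h4 : ‖W.starProjection z‖ₑ = ‖W.orthogonalProjectionOnto z‖ₑ := by
        rw [← ofReal_norm, ← ofReal_norm, Submodule.starProjection_apply, Submodule.coe_norm]
      rw [h4, ← h3]
      refine Finset.sum_congr rfl fun j _ => ?_
      rw [Submodule.inner_orthogonalProjectionOnto_eq_of_mem_left]
    simp only [ContinuousLinearMap.comp_apply, h1]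
    rw [Summable.tsum_finsetSum fun _ _ => ENNReal.summable]
    refine ENNReal.sum_ne_top.2 fun j _ => ?_
    simp_rw [← ContinuousLinearMap.adjoint_inner_left, enorm_inner_comm _ (b _)]
    rw [tsum_enorm_inner_sq]
    exact ENNReal.pow_ne_top enorm_ne_top
  · refine ContinuousLinearMap.opNorm_le_of_unit_norm hε.le fun x hx => ?_
    obtain ⟨y, hy, hxy⟩ := Set.mem_iUnion₂.1 (hcov ⟨x, by simp [hx], rfl⟩)
    have h1 : ‖A x - W.starProjection (A x)‖ ≤ ‖A x - y‖ := by
      rw [Submodule.starProjection_minimal]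
      exact ciInf_le ⟨0, by rintro _ ⟨z, rfl⟩; positivity⟩ (⟨y, Submodule.subset_span hy⟩ : W)
    rw [mem_ball, dist_eq_norm] at hxy
    exact h1.trans hxy.le

end Compact

/-! ## Functional calculus on eigenvectors -/

section Spectral

universe u
variable {E : Type u} [NormedAddCommGroup E] [InnerProductSpace ℂ E] [CompleteSpace E]

/-- A nonzero eigenvector puts `t` in the spectrum. The claim then holds for constants and the
identity, survives sums and products, and is closed under uniform limits, so Stone–Weierstrass gives
it for all continuous functions. -/
theorem cfc_apply_eigenvector {X : E →L[ℂ] E} (hX : IsSelfAdjoint X) {t : ℝ} {x : E}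
    (hx : X x = (t : ℂ) • x) {f : ℝ → ℝ} (hf : ContinuousOn f (spectrum ℝ X)) :
    cfc f X x = (f t : ℂ) • x := by
  rcases eq_or_ne x 0 with rfl | hx0
  · simp
  have ht : t ∈ spectrum ℝ X := by
    intro h
    obtain ⟨u, hu⟩ := h
    have h1 : (u : E →L[ℂ] E) x = 0 := by
      rw [hu, sub_apply, hx, Algebra.algebraMap_eq_smul_one]
      simp
    have h2 : ((↑u⁻¹ : E →L[ℂ] E) * (u : E →L[ℂ] E)) x = x := by simp
    rw [ContinuousLinearMap.mul_def, ContinuousLinearMap.comp_apply, h1, map_zero] at h2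
    exact hx0 h2.symm
  rw [cfc_apply f X hX hf]
  rw [Complex.coe_smul]
  have hft : f t = (⟨(spectrum ℝ X).domRestrict f, hf.domRestrict⟩ : C(spectrum ℝ X, ℝ)) ⟨t, ht⟩ :=
    rfl
  rw [hft]
  generalize (⟨(spectrum ℝ X).domRestrict f, _⟩ : C(spectrum ℝ X, ℝ)) = g
  induction g using ContinuousMap.induction_on_of_compact with
  | const r =>
    have : ContinuousMap.const (spectrum ℝ X) r = algebraMap ℝ C(spectrum ℝ X, ℝ) r := rfl
    rw [this, AlgHomClass.commutes, Algebra.algebraMap_eq_smul_one]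
    simp
  | id => 
    rw [cfcHom_id, hx]
    simp
  | star_id => 
    rw [map_star, cfcHom_id, hX.star_eq, hx]
    simp
  | add f g hf hg => 
    rw [map_add, add_apply, hf, hg, ContinuousMap.add_apply, add_smul]
  | mul f g hf hg => 
    rw [map_mul, ContinuousLinearMap.mul_def, ContinuousLinearMap.comp_apply, hg, ContinuousLinearMap.map_smul_of_tower, hf, smul_smul, 
      ContinuousMap.mul_apply, mul_comm]
  | frequently f hf => 
    have hc : IsClosed {g : C(spectrum ℝ X, ℝ) | cfcHom hX g x = g ⟨t, ht⟩ • x} := by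
      have := cfcHom_continuous (R := ℝ) hX
      refine isClosed_eq ?_ ?_
      · exact ((ContinuousLinearMap.apply ℂ E x).continuous.comp this)
      · fun_prop
    exact hc.mem_of_frequently_of_tendsto hf Filter.tendsto_id

end Spectral

/-! ## Eigenbases and singular values -/

section Singular

universe u v
variable {E : Type u} [NormedAddCommGroup E] [InnerProductSpace ℂ E] [CompleteSpace E]
  {G : Type v} [NormedAddCommGroup G] [InnerProductSpace ℂ G] [CompleteSpace G]

/-- Hilbert bases of the eigenspaces, the possibly infinite dimensional kernel included, are put
together. They are total because the eigenspaces of a compact symmetric operator have trivial common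
orthogonal complement. Positivity makes the eigenvalues real and nonnegative. -/
theorem exists_eigenbasis {X : E →L[ℂ] E} (hX : 0 ≤ X) (hc : IsCompactOperator X) :
    ∃ (ι : Type u) (b : HilbertBasis ι ℂ E) (t : ι → ℝ), (∀ i, 0 ≤ t i) ∧
      ∀ i, X (b i) = (t i : ℂ) • b i := by
  have hpos := (ContinuousLinearMap.nonneg_iff_isPositive X).1 hX
  have hsym : (X : E →ₗ[ℂ] E).IsSymmetric := hpos.isSymmetric
  have hcl : ∀ l : ℂ, CompleteSpace (Module.End.eigenspace (X : Module.End ℂ E) l) := by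
    intro l
    refine IsClosed.completeSpace_coe (hs := ?_)
    have : (Module.End.eigenspace (X : Module.End ℂ E) l : Set E) = {x | X x = l • x} := by
      ext x
      simp
    rw [this]
    exact isClosed_eq X.continuous (continuous_const_smul l)
  let w := fun l : ℂ => basis (Module.End.eigenspace (X : Module.End ℂ E) l)
  have hw := hsym.orthogonalFamily_eigenspaces.orthonormal_sigma_orthonormal
    (fun l => (w l).orthonormal)
  set e : (Σ l : ℂ, basisIndex (Module.End.eigenspace (X : Module.End ℂ E) l)) → E :=
    fun a => (w a.1 a.2 : E) with he
  have hbot : (Submodule.span ℂ (Set.range e))ᗮ = ⊥ := by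
    rw [eq_bot_iff, ← ContinuousLinearMap.orthogonalComplement_iSup_eigenspaces_eq_bot hc hsym]
    intro y hy
    rw [← Submodule.iInf_orthogonal, Submodule.mem_iInf]
    intro l x hx
    have h1 := ((w l).hasSum_repr ⟨x, hx⟩).mapL
      (innerSL ℂ y ∘L (Module.End.eigenspace (X : Module.End ℂ E) l).subtypeL)
    have h2 : ∀ i, ⟪y, (w l i : E)⟫_ℂ = 0 := fun i =>
      Submodule.inner_left_of_mem_orthogonal (Submodule.subset_span (Set.mem_range_self (f := e) ⟨l, i⟩)) hy
    rw [← inner_conj_symm, map_eq_zero]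
    refine h1.unique ?_
    convert! hasSum_zero using 2 with i
    simp [h2]
  let b := HilbertBasis.mkOfOrthogonalEqBot hw hbot
  have hb : ∀ i, b i = e i := fun i => by simp [b, he]
  have hbX : ∀ i, X (b i) = i.1 • b i := fun i => by
    rw [hb]
    exact Module.End.mem_eigenspace_iff.1 (w i.1 i.2).2
  have ht : ∀ i, i.1 = ⟪b i, X (b i)⟫_ℂ := fun i => by
    rw [hbX, inner_smul_right, inner_self_eq_norm_sq_to_K, b.orthonormal.1]
    simp
  refine ⟨_, b, fun i => i.1.re, fun i => ?_, fun i => ?_⟩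
  · change 0 ≤ i.1.re
    rw [ht]
    exact hpos.re_inner_nonneg_right (b i)
  · have h0 := hpos.inner_nonneg_right (b i)
    rw [← ht, Complex.le_def] at h0
    rw [hbX]
    congr 1
    exact Complex.ext (by simp) (by simpa using h0.2.symm)

/-- `b` is an orthonormal basis of eigenvectors of `A* A`, and `s` are the singular values. -/
structure IsSingularBasis {ι : Type*} (A : E →L[ℂ] G) (b : HilbertBasis ι ℂ E) (s : ι → ℝ) :
    Prop where
  nonneg : ∀ i, 0 ≤ s i
  adjoint_apply : ∀ i, A.adjoint (A (b i)) = ((s i ^ 2 : ℝ) : ℂ) • b i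

/-- The left singular vectors; those for the singular value zero are zero. -/
def leftVector {ι : Type*} (A : E →L[ℂ] G) (b : HilbertBasis ι ℂ E) (s : ι → ℝ) (i : ι) : G :=
  (s i : ℂ)⁻¹ • A (b i)

namespace IsSingularBasis

variable {ι : Type*} {A : E →L[ℂ] G} {b : HilbertBasis ι ℂ E} {s : ι → ℝ}

theorem inner_apply_apply (h : IsSingularBasis A b s) (i : ι) (x : E) :
    ⟪A (b i), A x⟫_ℂ = ((s i ^ 2 : ℝ) : ℂ) * ⟪b i, x⟫_ℂ := by
  rw [← ContinuousLinearMap.adjoint_inner_left, h.adjoint_apply, inner_smul_left]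
  simp

theorem norm_apply (h : IsSingularBasis A b s) (i : ι) : ‖A (b i)‖ = s i := by
  have h1 := h.inner_apply_apply i (b i)
  rw [inner_self_eq_norm_sq_to_K, inner_self_eq_norm_sq_to_K, b.orthonormal.1] at h1
  have h2 : ‖A (b i)‖ ^ 2 = s i ^ 2 := by
    norm_num at h1
    exact_mod_cast h1
  exact (sq_eq_sq₀ (norm_nonneg _) (h.nonneg i)).1 h2

theorem apply_eq (h : IsSingularBasis A b s) (i : ι) :
    A (b i) = (s i : ℂ) • leftVector A b s i := by
  rcases eq_or_ne (s i) 0 with h0 | h0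
  · have := h.norm_apply i
    rw [h0, norm_eq_zero] at this
    simp [this, h0]
  · rw [leftVector, smul_inv_smul₀ (by exact_mod_cast h0)]

theorem leftVector_eq_zero {i : ι} (hi : s i = 0) : leftVector A b s i = 0 := by
  simp [leftVector, hi]

theorem orthonormal_leftVector (h : IsSingularBasis A b s) :
    Orthonormal ℂ fun i : {i // s i ≠ 0} => leftVector A b s i := by
  classical
  rw [orthonormal_iff_ite]
  rintro ⟨i, hi⟩ ⟨j, hj⟩
  have hi' : (s i : ℂ) ≠ 0 := by exact_mod_cast hi
  simp only [leftVector, inner_smul_left, inner_smul_right, h.inner_apply_apply,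
    orthonormal_iff_ite.1 b.orthonormal, Subtype.mk.injEq]
  split_ifs with hij
  · subst hij
    simp
    field_simp
  · simp

theorem norm_leftVector_le (h : IsSingularBasis A b s) (i : ι) : ‖leftVector A b s i‖ ≤ 1 := by
  by_cases hi : s i = 0
  · simp [leftVector_eq_zero hi]
  · exact (h.orthonormal_leftVector.1 ⟨i, hi⟩).le

theorem enorm_leftVector_sq_le (h : IsSingularBasis A b s) (i : ι) :
    ‖leftVector A b s i‖ₑ ^ 2 ≤ 1 := by
  refine pow_le_one₀ zero_le ?_
  rw [← ofReal_norm]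
  exact ENNReal.ofReal_le_one.2 (h.norm_leftVector_le i)

/-- Bessel's inequality; the zero vectors attached to zero singular values contribute nothing. -/
theorem tsum_enorm_inner_leftVector_sq_le (h : IsSingularBasis A b s) (y : G) :
    ∑' i, ‖⟪leftVector A b s i, y⟫_ℂ‖ₑ ^ 2 ≤ ‖y‖ₑ ^ 2 := by
  refine le_trans (le_of_eq ?_) (tsum_enorm_inner_sq_le h.orthonormal_leftVector y)
  refine (tsum_subtype_eq_of_support_subset (s := {i | s i ≠ 0}) fun i hi => ?_).symm
  intro h0
  simp [leftVector_eq_zero h0] at hi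

/-- Parseval for `⟪x, A* A x⟫` in a basis that diagonalizes `A* A`. -/
theorem enorm_apply_sq (h : IsSingularBasis A b s) (x : E) :
    ‖A x‖ₑ ^ 2 = ∑' i, ENNReal.ofReal (s i) ^ 2 * ‖⟪b i, x⟫_ℂ‖ₑ ^ 2 := by
  have h1 := b.hasSum_inner_mul_inner x (A.adjoint (A x))
  rw [ContinuousLinearMap.adjoint_inner_right, inner_self_eq_norm_sq_to_K] at h1
  have h2 : ∀ i, ⟪x, b i⟫_ℂ * ⟪b i, A.adjoint (A x)⟫_ℂ =
      ((s i ^ 2 * ‖⟪b i, x⟫_ℂ‖ ^ 2 : ℝ) : ℂ) := by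
    intro i
    rw [ContinuousLinearMap.adjoint_inner_right, h.inner_apply_apply, ← inner_conj_symm x,
      mul_left_comm, Complex.conj_mul']
    push_cast
    rfl
  simp only [h2] at h1
  have h4 : ((‖A x‖ : ℂ) ^ 2) = ((‖A x‖ ^ 2 : ℝ) : ℂ) := by push_cast; rfl
  erw [h4, Complex.hasSum_ofReal] at h1
  have h3 := ENNReal.ofReal_tsum_of_nonneg (fun i => by positivity) h1.summable
  rw [h1.tsum_eq] at h3
  simpa [ENNReal.ofReal_pow, ENNReal.ofReal_mul, h.nonneg] using h3

/-- `|A|^p = (A* A)^(p/2)`, and the functional calculus acts on eigenvectors by the value at the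
eigenvalue. -/
theorem abs_rpow_apply {A : E →L[ℂ] E} (h : IsSingularBasis A b s) {p : ℝ} (hp : 0 < p) (i : ι) :
    (CFC.abs A ^ p) (b i) = ((s i ^ p : ℝ) : ℂ) • b i := by
  have h0 : 0 ≤ star A * A := star_mul_self_nonneg A
  have h1 : CFC.abs A ^ p = cfc (fun x : ℝ => x ^ (1 / 2 * p)) (star A * A) := by
    rw [CFC.abs, CFC.sqrt_eq_rpow, CFC.rpow_rpow_of_exponent_nonneg _ _ _ (by norm_num) hp.le h0,
      CFC.rpow_eq_cfc_real h0]
  have h2 : (star A * A) (b i) = ((s i ^ 2 : ℝ) : ℂ) • b i := h.adjoint_apply i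
  rw [h1, cfc_apply_eigenvector (IsSelfAdjoint.of_nonneg h0) h2
    (Real.continuous_rpow_const (by positivity)).continuousOn]
  congr 2
  rw [← Real.rpow_natCast, ← Real.rpow_mul (h.nonneg i)]
  congr 1
  push_cast
  ring

theorem posTrace_abs_rpow {A : E →L[ℂ] E} (h : IsSingularBasis A b s) {p : ℝ} (hp : 0 < p) :
    posTrace (CFC.abs A ^ p) = ∑' i, ENNReal.ofReal (s i) ^ p := by
  rw [posTrace_eq_tsum b CFC.rpow_nonneg]
  refine tsum_congr fun i => ?_
  rw [h.abs_rpow_apply hp, inner_smul_right, inner_self_eq_norm_sq_to_K, b.orthonormal.1,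
    ENNReal.ofReal_rpow_of_nonneg (h.nonneg i) hp.le]
  simp

/-- Summability forces all but finitely many singular values below `ε / 2`, so truncating the
singular value decomposition there changes `A` by at most `ε / 2` in norm. -/
theorem isCompactOperator (h : IsSingularBasis A b s) {p : ℝ} (hp : 0 < p)
    (hs : ∑' i, ENNReal.ofReal (s i) ^ p ≠ ∞) : IsCompactOperator A := by
  classical
  have hlim : Filter.Tendsto
      (fun F : Finset ι => ∑ j ∈ F, InnerProductSpace.rankOne ℂ (A (b j)) (b j))
      Filter.atTop (𝓝 A) := by
    rw [Metric.tendsto_atTop]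
    intro ε hε
    have h1 := ENNReal.tendsto_cofinite_zero_of_tsum_ne_top hs
    have h2 : ∀ᶠ i in Filter.cofinite, s i ≤ ε / 2 := by
      have h3 : (0 : ℝ≥0∞) < ENNReal.ofReal (ε / 2) ^ p := 
        ENNReal.rpow_pos (by simpa using hε) ENNReal.ofReal_ne_top
      filter_upwards [h1.eventually (gt_mem_nhds h3)] with i hi
      rw [ENNReal.rpow_lt_rpow_iff hp] at hi
      exact ((ENNReal.ofReal_lt_ofReal_iff (by positivity)).1 hi).le
    refine ⟨(Filter.eventually_cofinite.1 h2).toFinset, fun F hF => ?_⟩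
    have hF' : ∀ i ∉ F, s i ≤ ε / 2 := by
      intro i hi
      by_contra hc
      exact hi (hF (by simpa using hc))
    set K := ∑ j ∈ F, InnerProductSpace.rankOne ℂ (A (b j)) (b j) with hK
    rw [dist_comm, dist_eq_norm]
    refine lt_of_le_of_lt ?_ (half_lt_self hε)
    refine ContinuousLinearMap.opNorm_le_bound _ (by positivity) fun x => ?_
    set y := x - ∑ j ∈ F, ⟪b j, x⟫_ℂ • b j with hy
    have h4 : (A - K) x = A y := by
      simp [hK, hy, map_sum]
    have h5 : ∀ i, ⟪b i, y⟫_ℂ = if i ∈ F then 0 else ⟪b i, x⟫_ℂ := by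
      intro i
      rw [hy, inner_sub_right, inner_sum]
      simp only [inner_smul_right, orthonormal_iff_ite.1 b.orthonormal]
      by_cases hi : i ∈ F <;> simp [hi]
    have h6 : ‖A y‖ₑ ^ 2 ≤ (ENNReal.ofReal (ε / 2) * ‖x‖ₑ) ^ 2 := by
      rw [h.enorm_apply_sq, mul_pow, ← tsum_enorm_inner_sq b x, ← ENNReal.tsum_mul_left]
      refine ENNReal.tsum_le_tsum fun i => ?_
      rw [h5]
      split_ifs with hi
      · simp
      · gcongr
        exact hF' i hi
    rw [h4]
    have h7 := (ENNReal.pow_le_pow_left_iff two_ne_zero).1 h6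
    rw [← ofReal_norm, ← ofReal_norm, ← ENNReal.ofReal_mul (by positivity)] at h7
    exact (ENNReal.ofReal_le_ofReal_iff (by positivity)).1 h7
  exact isCompactOperator_of_tendsto hlim (.of_forall fun F => isCompactOperator_sum_rankOne F _ _)

end IsSingularBasis

theorem exists_isSingularBasis_of_isCompactOperator {A : E →L[ℂ] G} (hA : IsCompactOperator A) :
    ∃ (ι : Type u) (b : HilbertBasis ι ℂ E) (s : ι → ℝ), IsSingularBasis A b s := by
  have h0 : 0 ≤ A.adjoint ∘L A :=
    (ContinuousLinearMap.nonneg_iff_isPositive _).2 (ContinuousLinearMap.isPositive_adjoint_comp_self A)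
  obtain ⟨ι, b, t, ht, hb⟩ := exists_eigenbasis h0 (hA.clm_comp A.adjoint)
  refine ⟨ι, b, fun i => √(t i), fun i => Real.sqrt_nonneg _, fun i => ?_⟩
  rw [Real.sq_sqrt (ht i)]
  exact hb i

/-- If `X = Y* Y`, then finite trace says that `Y` is Hilbert–Schmidt, hence compact. -/
theorem isCompactOperator_of_posTrace_ne_top {X : E →L[ℂ] E} (hX : 0 ≤ X)
    (h : posTrace X ≠ ∞) : IsCompactOperator X := by
  obtain ⟨Y, rfl⟩ := CStarAlgebra.nonneg_iff_eq_star_mul_self.1 hX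
  have h1 : IsCompactOperator Y := by
    refine isCompactOperator_of_tsum_enorm_sq_ne_top (basis E) Y ?_
    convert! h using 2
    rw [posTrace]
    refine tsum_congr fun i => ?_
    rw [ContinuousLinearMap.star_eq_adjoint, ContinuousLinearMap.mul_def,
      ContinuousLinearMap.comp_apply, ContinuousLinearMap.adjoint_inner_right,
      inner_self_eq_norm_sq_to_K, ← ofReal_norm, ← ENNReal.ofReal_pow (norm_nonneg _)]
    congr 1
    norm_cast
  exact h1.clm_comp (star Y)

/-- Compactness of `A` is not part of the definition of `S^p`. It is known first for `|A|^p`, whose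
eigenvectors are eigenvectors of `A* A = (|A|^p)^(2/p)`. -/
theorem MemSchatten.exists_isSingularBasis {p : ℝ} (hp : 0 < p) {A : E →L[ℂ] E}
    (hA : MemSchatten p A) :
    ∃ (ι : Type u) (b : HilbertBasis ι ℂ E) (s : ι → ℝ), IsSingularBasis A b s := by
  have h0 : 0 ≤ CFC.abs A ^ p := CFC.rpow_nonneg
  obtain ⟨ι, b, t, ht, hb⟩ := exists_eigenbasis h0
    (isCompactOperator_of_posTrace_ne_top h0 hA.ne)
  refine ⟨ι, b, fun i => t i ^ p⁻¹, fun i => Real.rpow_nonneg (ht i) _, fun i => ?_⟩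
  have h1 : star A * A = cfc (fun x : ℝ => x ^ (p⁻¹ * 2)) (CFC.abs A ^ p) := by
    rw [← CFC.rpow_eq_cfc_real h0, CFC.rpow_rpow_of_exponent_nonneg _ _ _ hp.le (by positivity),
      mul_inv_cancel_left₀ hp.ne', ← CFC.abs_mul_abs, ← sq, ← CFC.rpow_natCast _ _ (CFC.abs_nonneg A)]
    norm_num
  have h2 := cfc_apply_eigenvector (IsSelfAdjoint.of_nonneg h0) (hb i)
    (f := fun x : ℝ => x ^ (p⁻¹ * 2)) (Real.continuous_rpow_const (by positivity)).continuousOn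
  rw [← h1] at h2
  rw [← Real.rpow_natCast, ← Real.rpow_mul (ht i)]
  exact h2

end Singular

/-! ## Trace class operators as sums of rank one operators -/

section Nuclear

universe u
variable {E : Type u} [NormedAddCommGroup E] [InnerProductSpace ℂ E]
  {ι : Type*} {u v : ι → E}

/-- `R` is the sum of the rank one operators `x ↦ ⟪u l, x⟫ v l`, with square summable `u`, `v`. -/
structure IsNuclearSum (u v : ι → E) (R : E →L[ℂ] E) : Prop where
  left_ne_top : ∑' l, ‖u l‖ₑ ^ 2 ≠ ∞
  right_ne_top : ∑' l, ‖v l‖ₑ ^ 2 ≠ ∞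
  hasSum : ∀ x, HasSum (fun l => ⟪u l, x⟫_ℂ • v l) (R x)

/-- The estimate `ab ≤ a² + b²` with Parseval for `b` and Bessel for `g`. It serves both to
interchange sums in a trace and to bound the sum of singular values. -/
theorem tsum_tsum_enorm_inner_mul_le {κ : Type*} (b : HilbertBasis κ ℂ E) (g : κ → E)
    (hg : ∀ x, ∑' i, ‖⟪g i, x⟫_ℂ‖ₑ ^ 2 ≤ ‖x‖ₑ ^ 2) (u v : ι → E) :
    ∑' (i) (l), ‖⟪u l, b i⟫_ℂ‖ₑ * ‖⟪g i, v l⟫_ℂ‖ₑ ≤ ∑' l, ‖u l‖ₑ ^ 2 + ∑' l, ‖v l‖ₑ ^ 2 := by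
  rw [ENNReal.tsum_comm, ← ENNReal.tsum_add]
  refine ENNReal.tsum_le_tsum fun l => ?_
  refine (ENNReal.tsum_le_tsum fun i => mul_le_add_sq _ _).trans ?_
  rw [ENNReal.tsum_add]
  gcongr
  · simp_rw [enorm_inner_comm (u l)]
    rw [tsum_enorm_inner_sq]
  · exact hg _

variable [CompleteSpace E]

namespace IsNuclearSum

variable {R : E →L[ℂ] E}

/-- The double series over the basis and over `l` converges absolutely, so it may be summed over the
basis first, where Parseval collapses it. -/
theorem trace_comp (h : IsNuclearSum u v R) (A : E →L[ℂ] E) :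
    trace (A ∘L R) = ∑' l, ⟪u l, A (v l)⟫_ℂ := by
  have h1 : ∀ i, HasSum (fun l => ⟪u l, basis E i⟫_ℂ * ⟪basis E i, A (v l)⟫_ℂ)
      ⟪basis E i, (A ∘L R) (basis E i)⟫_ℂ := by
    intro i
    have := (h.hasSum (basis E i)).mapL (innerSL ℂ (basis E i) ∘L A)
    simpa [inner_smul_right] using this
  let f : basisIndex E → ι → ℂ := fun i l => ⟪u l, basis E i⟫_ℂ * ⟪basis E i, A (v l)⟫_ℂ
  have hs : Summable (Function.uncurry f) := by
    refine Summable.of_enorm ?_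
    have h2 : ∑' a, ‖Function.uncurry f a‖ₑ =
        ∑' (i) (l), ‖⟪u l, basis E i⟫_ℂ‖ₑ * ‖⟪basis E i, A (v l)⟫_ℂ‖ₑ := by
      rw [← ENNReal.tsum_prod]
      exact tsum_congr fun a => enorm_mul _ _
    rw [h2]
    refine ne_top_of_le_ne_top ?_ (tsum_tsum_enorm_inner_mul_le (basis E) (basis E)
      (fun x => (tsum_enorm_inner_sq _ x).le) u fun l => A (v l))
    refine ENNReal.add_ne_top.2 ⟨h.left_ne_top, ?_⟩
    refine ne_top_of_le_ne_top (ENNReal.mul_ne_top (ENNReal.pow_ne_top (enorm_ne_top (x := A)))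
      h.right_ne_top) (b := ‖A‖ₑ ^ 2 * ∑' l, ‖v l‖ₑ ^ 2) ?_
    rw [← ENNReal.tsum_mul_left]
    refine ENNReal.tsum_le_tsum fun l => ?_
    rw [← mul_pow]
    gcongr
    exact A.le_opENorm _
  calc trace (A ∘L R) = ∑' (i) (l), f i l := tsum_congr fun i => (h1 i).tsum_eq.symm
    _ = ∑' (l) (i), f i l := (Summable.tsum_comm hs).symm
    _ = ∑' l, ⟪u l, A (v l)⟫_ℂ :=
      tsum_congr fun l => (basis E).tsum_inner_mul_inner (u l) (A (v l))

/-- Each singular value is `⟪g_i, R b_i⟫` for singular vectors `g_i`, `b_i`; expanding `R` bounds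
their sum by the preceding double series. -/
theorem memSchatten_one (h : IsNuclearSum u v R) (hc : IsCompactOperator R) :
    MemSchatten 1 R := by
  obtain ⟨κ, b, s, hb⟩ := exists_isSingularBasis_of_isCompactOperator hc
  rw [MemSchatten, hb.posTrace_abs_rpow one_pos]
  refine lt_of_le_of_lt ?_ (ENNReal.add_lt_top.2 ⟨h.left_ne_top.lt_top, h.right_ne_top.lt_top⟩)
  refine le_trans ?_ (tsum_tsum_enorm_inner_mul_le b (leftVector R b s)
    hb.tsum_enorm_inner_leftVector_sq_le u v)
  refine ENNReal.tsum_le_tsum fun i => ?_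
  rw [ENNReal.rpow_one]
  by_cases hi : s i = 0
  · simp [hi]
  have h1 : (s i : ℂ) = ⟪leftVector R b s i, R (b i)⟫_ℂ := by
    have := hb.orthonormal_leftVector.1 ⟨i, hi⟩
    rw [hb.apply_eq, inner_smul_right, inner_self_eq_norm_sq_to_K, this]
    simp
  have h2 := (h.hasSum (b i)).mapL (innerSL ℂ (leftVector R b s i))
  calc ENNReal.ofReal (s i) = ‖(s i : ℂ)‖ₑ := by
        rw [← ofReal_norm, Complex.norm_real, Real.norm_of_nonneg (hb.nonneg i)]
    _ ≤ _ := by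
        rw [h1, ← innerSL_apply_apply, ← h2.tsum_eq]
        refine enorm_tsum_le_tsum_enorm.trans_eq ?_
        simp [enorm_mul]

end IsNuclearSum

theorem exists_isNuclearSum (hu : ∑' l, ‖u l‖ₑ ^ 2 ≠ ∞) (hv : ∑' l, ‖v l‖ₑ ^ 2 ≠ ∞) :
    ∃ R : E →L[ℂ] E, MemSchatten 1 R ∧ IsNuclearSum u v R := by
  have hs : Summable fun l => InnerProductSpace.rankOne ℂ (v l) (u l) := by
    refine Summable.of_enorm ?_
    refine ne_top_of_le_ne_top (ENNReal.add_ne_top.2 ⟨hv, hu⟩) ?_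
    rw [← ENNReal.tsum_add]
    refine ENNReal.tsum_le_tsum fun l => ?_
    refine le_trans (le_of_eq ?_) (mul_le_add_sq _ _)
    rw [← ofReal_norm, InnerProductSpace.norm_rankOne, ENNReal.ofReal_mul (norm_nonneg _),
      ofReal_norm, ofReal_norm]
  have h : IsNuclearSum u v (∑' l, InnerProductSpace.rankOne ℂ (v l) (u l)) := by
    refine ⟨hu, hv, fun x => ?_⟩
    have := hs.hasSum.mapL (ContinuousLinearMap.apply ℂ E x)
    simpa using this
  exact ⟨_, h.memSchatten_one (isCompactOperator_of_tendsto hs.hasSum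
    (.of_forall fun F => isCompactOperator_sum_rankOne F _ _)), h⟩

/-- The singular value decomposition, with `√s_i` given to each of the two singular vectors so that
both families are square summable. -/
theorem MemSchatten.exists_isNuclearSum {R : E →L[ℂ] E} (hR : MemSchatten 1 R) :
    ∃ (ι : Type u) (u v : ι → E), IsNuclearSum u v R := by
  obtain ⟨ι, b, s, hb⟩ := hR.exists_isSingularBasis one_pos
  have hs : ∑' i, ENNReal.ofReal (s i) ≠ ∞ := by
    have := hR.ne
    rw [hb.posTrace_abs_rpow one_pos] at this
    simpa using this
  have hsq : ∀ i, ‖((√(s i) : ℝ) : ℂ)‖ₑ ^ 2 = ENNReal.ofReal (s i) := fun i => by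
    rw [← ofReal_norm, Complex.norm_real, Real.norm_of_nonneg (Real.sqrt_nonneg _),
      ← ENNReal.ofReal_pow (Real.sqrt_nonneg _), Real.sq_sqrt (hb.nonneg i)]
  refine ⟨ι, fun i => ((√(s i) : ℝ) : ℂ) • b i, fun i => ((√(s i) : ℝ) : ℂ) • leftVector R b s i,
    ?_, ?_, fun x => ?_⟩
  · have hbn : ∀ i, ‖b i‖ₑ = 1 := fun i => by rw [← ofReal_norm, b.orthonormal.1, ENNReal.ofReal_one]
    simpa only [enorm_smul, mul_pow, hsq, hbn, one_pow, mul_one] using hs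
  · refine ne_top_of_le_ne_top hs (ENNReal.tsum_le_tsum fun i => ?_)
    rw [enorm_smul, mul_pow, hsq]
    exact mul_le_of_le_one_right' (hb.enorm_leftVector_sq_le i)
  · convert! (b.hasSum_repr x).mapL R using 2 with i
    rw [map_smul, hb.apply_eq, b.repr_apply_apply, inner_smul_left, smul_smul, smul_smul,
      Complex.conj_ofReal, mul_right_comm, ← Complex.ofReal_mul, Real.mul_self_sqrt (hb.nonneg i),
      mul_comm]

end Nuclear

/-! ## Maps given by a family of Kraus operators -/

section Kraus

universe u v
variable {E : Type u} [NormedAddCommGroup E] [InnerProductSpace ℂ E] [CompleteSpace E]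
  {G : Type v} [NormedAddCommGroup G] [InnerProductSpace ℂ G] [CompleteSpace G]
  {κ : Type*}

/-- `T A = ∑ V n A (V n)*` in the weak sense, and `∑ V n (V n)* = 1`. -/
structure IsKrausFamily (V : κ → E →L[ℂ] G) (T : (E →L[ℂ] E) →L[ℂ] (G →L[ℂ] G)) : Prop where
  hasSum : ∀ A x y, HasSum (fun n => ⟪(V n).adjoint y, A ((V n).adjoint x)⟫_ℂ) ⟪y, T A x⟫_ℂ
  tsum_adjoint : ∀ x, ∑' n, ‖(V n).adjoint x‖ₑ ^ 2 = ‖x‖ₑ ^ 2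

namespace IsKrausFamily

variable {V : κ → E →L[ℂ] G} {T : (E →L[ℂ] E) →L[ℂ] (G →L[ℂ] G)}

/-- A Kadison–Schwarz inequality: for `y = T A x`, expand `⟪y, T A x⟫`, apply Cauchy–Schwarz, and
cancel the factor `‖y‖² = ∑ ‖V_n* y‖²`. -/
theorem enorm_apply_sq_le (h : IsKrausFamily V T) (A : E →L[ℂ] E) (x : G) :
    ‖T A x‖ₑ ^ 2 ≤ ∑' n, ‖A ((V n).adjoint x)‖ₑ ^ 2 := by
  set y := T A x with hy
  have h1 : ‖y‖ₑ ^ 2 ≤ ∑' n, ‖(V n).adjoint y‖ₑ * ‖A ((V n).adjoint x)‖ₑ := by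
    have h2 : ‖y‖ₑ ^ 2 = ‖⟪y, y⟫_ℂ‖ₑ := by
      rw [← ofReal_norm, ← ofReal_norm, ← ENNReal.ofReal_pow (norm_nonneg _),
        inner_self_eq_norm_sq_to_K]
      simp
    rw [h2]
    conv_lhs => rw [hy, ← (h.hasSum A x y).tsum_eq]
    refine enorm_tsum_le_tsum_enorm.trans (ENNReal.tsum_le_tsum fun n => ?_)
    rw [← ofReal_norm, ← ofReal_norm, ← ofReal_norm, ← ENNReal.ofReal_mul (norm_nonneg _)]
    exact ENNReal.ofReal_le_ofReal (norm_inner_le_norm _ _)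
  have h3 := (pow_le_pow_left₀ zero_le h1 2).trans (tsum_mul_sq_le _ _)
  rw [h.tsum_adjoint, sq (‖y‖ₑ ^ 2)] at h3
  by_cases h0 : ‖y‖ₑ ^ 2 = 0
  · simp [h0]
  · exact (ENNReal.mul_le_mul_iff_right h0 (ENNReal.pow_ne_top enorm_ne_top)).1 h3

theorem norm_apply_le (h : IsKrausFamily V T) (A : E →L[ℂ] E) : ‖T A‖ ≤ ‖A‖ := by
  refine ContinuousLinearMap.opNorm_le_bound _ (norm_nonneg _) fun x => ?_
  have h1 : ‖T A x‖ₑ ^ 2 ≤ (‖A‖ₑ * ‖x‖ₑ) ^ 2 := by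
    refine (h.enorm_apply_sq_le A x).trans ?_
    rw [mul_pow, ← h.tsum_adjoint, ← ENNReal.tsum_mul_left]
    refine ENNReal.tsum_le_tsum fun n => ?_
    rw [← mul_pow]
    gcongr
    exact A.le_opENorm _
  have h2 := (ENNReal.pow_le_pow_left_iff two_ne_zero).1 h1
  rw [← ofReal_norm, ← ofReal_norm, ← ofReal_norm, ← ENNReal.ofReal_mul (norm_nonneg _)] at h2
  exact (ENNReal.ofReal_le_ofReal_iff (by positivity)).1 h2

/-- The quadratic forms of `T 1` and `1` agree, which over `ℂ` determines the operator. -/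
theorem apply_one (h : IsKrausFamily V T) : T 1 = 1 := by
  have h1 : ∀ x, ⟪x, T 1 x⟫_ℂ = ⟪x, x⟫_ℂ := by
    intro x
    have h2 := h.hasSum 1 x x
    refine h2.unique ?_
    have h3 : Summable fun n => ‖(V n).adjoint x‖ ^ 2 := by
      have := ENNReal.summable_toReal (f := fun n => ‖(V n).adjoint x‖ₑ ^ 2)
        (by rw [h.tsum_adjoint]; exact ENNReal.pow_ne_top enorm_ne_top)
      simpa using this
    have h4 : ∑' n, ‖(V n).adjoint x‖ ^ 2 = ‖x‖ ^ 2 := by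
      have h5 := ENNReal.ofReal_tsum_of_nonneg (fun n => by positivity) h3
      simp only [ENNReal.ofReal_pow (norm_nonneg _), ofReal_norm, h.tsum_adjoint] at h5
      rw [← ofReal_norm, ← ENNReal.ofReal_pow (norm_nonneg _)] at h5
      exact (ENNReal.ofReal_eq_ofReal_iff (tsum_nonneg fun n => by positivity) (by positivity)).1 h5
    have h6 := (Complex.hasSum_ofReal).2 (h4 ▸ h3.hasSum)
    rw [inner_self_eq_norm_sq_to_K]
    convert! h6 using 1
    · ext n
      rw [one_apply_eq_self, inner_self_eq_norm_sq_to_K]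
      push_cast
      rfl
    · push_cast
      rfl
  have h7 := (ext_inner_map (T 1 : G →ₗ[ℂ] G) LinearMap.id).1 fun x => by
    rw [← inner_conj_symm]
    exact (congrArg _ (h1 x)).trans (inner_conj_symm _ _)
  ext x
  exact LinearMap.congr_fun h7 x

theorem norm_eq_one [Nontrivial E] [Nontrivial G] (h : IsKrausFamily V T) : ‖T‖ = 1 := by
  refine le_antisymm (T.opNorm_le_bound zero_le_one fun A => ?_) ?_
  · rw [one_mul]
    exact h.norm_apply_le A
  · have h1 := T.le_opNorm 1
    rwa [h.apply_one, norm_one, norm_one, mul_one] at h1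

/-- The map is weak-* continuous. -/
theorem continuous_weakStar (h : IsKrausFamily V T) :
    Continuous[weakStarTopology E, weakStarTopology G] T := by
  refine continuous_iInf_rng.2 fun R => continuous_induced_rng.2 ?_
  obtain ⟨ι, u, v, hR⟩ := R.2.exists_isNuclearSum
  have hsum : ∀ w : ι → G, ∑' l : ι × κ, ‖(V l.2).adjoint (w l.1)‖ₑ ^ 2 = ∑' l, ‖w l‖ₑ ^ 2 := by
    intro w
    rw [ENNReal.tsum_prod (f := fun i n => ‖(V n).adjoint (w i)‖ₑ ^ 2)]
    simp_rw [h.tsum_adjoint]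
  -- `S` is the predual image `∑ V_n* R V_n`, built from a decomposition of `R` into rank one
  -- operators. It remains to see that `Tr (T(A) R) = Tr (A S)`.
  obtain ⟨S, hS, hS'⟩ := exists_isNuclearSum
    (u := fun l : ι × κ => (V l.2).adjoint (u l.1)) (v := fun l => (V l.2).adjoint (v l.1))
    (by rw [hsum]; exact hR.left_ne_top) (by rw [hsum]; exact hR.right_ne_top)
  have htr : ((fun B : G →L[ℂ] G => trace (B ∘L R.1)) ∘ T) = fun A => trace (A ∘L S) := by
    ext A
    rw [Function.comp_apply, hR.trace_comp, hS'.trace_comp]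
    have hs : Summable fun l : ι × κ =>
        ⟪(V l.2).adjoint (u l.1), A ((V l.2).adjoint (v l.1))⟫_ℂ := by
      refine Summable.of_enorm ?_
      refine ne_top_of_le_ne_top (b := ∑' l : ι × κ, (‖(V l.2).adjoint (u l.1)‖ₑ ^ 2 +
        ‖A‖ₑ ^ 2 * ‖(V l.2).adjoint (v l.1)‖ₑ ^ 2)) ?_ (ENNReal.tsum_le_tsum fun l => ?_)
      · rw [ENNReal.tsum_add, ENNReal.tsum_mul_left, hsum, hsum]
        exact ENNReal.add_ne_top.2 ⟨hR.left_ne_top,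
          ENNReal.mul_ne_top (ENNReal.pow_ne_top enorm_ne_top) hR.right_ne_top⟩
      · rw [← mul_pow]
        refine le_trans ?_ (mul_le_add_sq _ _)
        refine le_trans ?_ (mul_le_mul_right (A.le_opENorm _) _)
        rw [← ofReal_norm, ← ofReal_norm, ← ofReal_norm, ← ENNReal.ofReal_mul (norm_nonneg _)]
        exact ENNReal.ofReal_le_ofReal (norm_inner_le_norm _ _)
    rw [hs.tsum_prod]
    exact tsum_congr fun l => (h.hasSum A (v l) (u l)).tsum_eq.symm
  rw [htr]
  exact continuous_iInf_dom (i := ⟨S, hS⟩) continuous_induced_dom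

variable {c : ℝ≥0∞}

/-- Moving `V_n` to the other side and applying Bessel for `g` leaves `∑ ‖V_n x‖²`. In this form the
bound on `∑ V_n* V_n` enters the compactness and Schatten estimates. -/
theorem tsum_tsum_enorm_inner_sq_le (hV : ∀ x, ∑' n, ‖V n x‖ₑ ^ 2 ≤ c * ‖x‖ₑ ^ 2)
    {ι : Type*} {g : ι → G} (hg : ∀ y, ∑' i, ‖⟪g i, y⟫_ℂ‖ₑ ^ 2 ≤ ‖y‖ₑ ^ 2) (x : E) :
    ∑' (i) (n), ‖⟪(V n).adjoint (g i), x⟫_ℂ‖ₑ ^ 2 ≤ c * ‖x‖ₑ ^ 2 := by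
  rw [ENNReal.tsum_comm]
  simp_rw [ContinuousLinearMap.adjoint_inner_left]
  exact (ENNReal.tsum_le_tsum fun n => hg _).trans (hV x)

/-- The squared Hilbert–Schmidt norm grows at most by the factor `c`, as expanding `K` through its
adjoint shows. Compact operators follow, being norm limits of Hilbert–Schmidt operators. -/
theorem isCompactOperator (h : IsKrausFamily V T) (hc : c ≠ ∞)
    (hV : ∀ x, ∑' n, ‖V n x‖ₑ ^ 2 ≤ c * ‖x‖ₑ ^ 2) {A : E →L[ℂ] E} (hA : IsCompactOperator A) :
    IsCompactOperator (T A) := by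
  have hHS : ∀ K : E →L[ℂ] E, ∑' i, ‖K (basis E i)‖ₑ ^ 2 ≠ ∞ → IsCompactOperator (T K) := by
    intro K hK
    refine isCompactOperator_of_tsum_enorm_sq_ne_top (basis G) _ ?_
    rw [tsum_enorm_apply_sq (basis E) (basis E)] at hK
    refine ne_top_of_le_ne_top (ENNReal.mul_ne_top hc hK) ?_
    calc ∑' j, ‖T K (basis G j)‖ₑ ^ 2
        ≤ ∑' (j) (n), ‖K ((V n).adjoint (basis G j))‖ₑ ^ 2 :=
          ENNReal.tsum_le_tsum fun j => h.enorm_apply_sq_le K _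
      _ = ∑' (j) (i) (n), ‖⟪(V n).adjoint (basis G j), K.adjoint (basis E i)⟫_ℂ‖ₑ ^ 2 := by
          refine tsum_congr fun j => ?_
          rw [ENNReal.tsum_comm]
          refine tsum_congr fun n => ?_
          simp_rw [ContinuousLinearMap.adjoint_inner_right, enorm_inner_comm _ (basis E _)]
          rw [tsum_enorm_inner_sq]
      _ = ∑' (i) (j) (n), ‖⟪(V n).adjoint (basis G j), K.adjoint (basis E i)⟫_ℂ‖ₑ ^ 2 :=
          ENNReal.tsum_comm
      _ ≤ ∑' i, c * ‖K.adjoint (basis E i)‖ₑ ^ 2 := ENNReal.tsum_le_tsum fun i =>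
          tsum_tsum_enorm_inner_sq_le hV (fun y => (tsum_enorm_inner_sq _ y).le) _
      _ = _ := ENNReal.tsum_mul_left
  have hK : ∀ n : ℕ, ∃ K : E →L[ℂ] E, ∑' i, ‖K (basis E i)‖ₑ ^ 2 ≠ ∞ ∧
      ‖A - K‖ ≤ 1 / ((n : ℝ) + 1) := fun n =>
    exists_enorm_sub_le_of_isCompactOperator (basis E) hA (by positivity)
  choose K hK hKA using hK
  have hlim : Filter.Tendsto K Filter.atTop (𝓝 A) := by
    rw [tendsto_iff_norm_sub_tendsto_zero]
    refine squeeze_zero (fun _ => norm_nonneg _) (fun n => ?_) tendsto_one_div_add_atTop_nhds_zero_nat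
    rw [norm_sub_rev]
    exact hKA n
  exact isCompactOperator_of_tendsto ((T.continuous.tendsto A).comp hlim)
    (.of_forall fun n => hHS _ (hK n))

/-- The trace of `|T A|^p` is at most `c` times that of `|A|^p`. -/
theorem posTrace_abs_rpow_le (h : IsKrausFamily V T) (hc : c ≠ ∞)
    (hV : ∀ x, ∑' n, ‖V n x‖ₑ ^ 2 ≤ c * ‖x‖ₑ ^ 2) {p : ℝ} (hp : 1 ≤ p) {A : E →L[ℂ] E}
    (hA : MemSchatten p A) :
    posTrace (CFC.abs (T A) ^ p) ≤ c * posTrace (CFC.abs A ^ p) := by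
  have hp0 : 0 < p := by linarith
  obtain ⟨ι, b, s, hb⟩ := hA.exists_isSingularBasis hp0
  have hAc : IsCompactOperator A := hb.isCompactOperator hp0 (by
    rw [← hb.posTrace_abs_rpow hp0]
    exact hA.ne)
  obtain ⟨ι', b', s', hb'⟩ :=
    exists_isSingularBasis_of_isCompactOperator (h.isCompactOperator hc hV hAc)
  set g := leftVector A b s
  set g' := leftVector (T A) b' s'
  rw [hb.posTrace_abs_rpow hp0, hb'.posTrace_abs_rpow hp0, ← ENNReal.tsum_mul_left]
  -- Expanding `s'_j = ⟪g'_j, T A b'_j⟫` gives products of two inner products as coefficients of the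
  -- `s_i`. Bounding each product by half the sum of squares yields these weights, with row sums at
  -- most 1 (from `∑ V_n V_n* = 1`) and column sums at most `c`.
  let w : ι' → ι → ℝ≥0∞ := fun j i => ∑' n, 2⁻¹ *
    (‖⟪(V n).adjoint (g' j), g i⟫_ℂ‖ₑ ^ 2 + ‖⟪(V n).adjoint (b' j), b i⟫_ℂ‖ₑ ^ 2)
  have hw : ∀ j, ∑' i, w j i ≤ 1 := by
    intro j
    simp only [w]
    rw [ENNReal.tsum_comm]
    simp_rw [ENNReal.tsum_mul_left, ENNReal.tsum_add]
    have h1 : ∑' (n) (i), ‖⟪(V n).adjoint (g' j), g i⟫_ℂ‖ₑ ^ 2 ≤ 1 := by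
      calc _ ≤ ∑' n, ‖(V n).adjoint (g' j)‖ₑ ^ 2 := ENNReal.tsum_le_tsum fun n => by
            simp_rw [enorm_inner_comm _ (g _)]
            exact hb.tsum_enorm_inner_leftVector_sq_le _
        _ ≤ 1 := by
            rw [h.tsum_adjoint]
            exact hb'.enorm_leftVector_sq_le j
    have h2 : ∑' (n) (i), ‖⟪(V n).adjoint (b' j), b i⟫_ℂ‖ₑ ^ 2 ≤ 1 := by
      simp_rw [enorm_inner_comm _ (b _), tsum_enorm_inner_sq]
      rw [h.tsum_adjoint, ← ofReal_norm, b'.orthonormal.1]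
      simp
    calc _ ≤ (2⁻¹ : ℝ≥0∞) * (1 + 1) := by gcongr
      _ = 1 := by rw [one_add_one_eq_two, ENNReal.inv_mul_cancel two_ne_zero ENNReal.ofNat_ne_top]
  have hw' : ∀ i, ∑' j, w j i ≤ c := by
    intro i
    simp only [w]
    simp_rw [ENNReal.tsum_mul_left, ENNReal.tsum_add]
    have h1 := tsum_tsum_enorm_inner_sq_le hV hb'.tsum_enorm_inner_leftVector_sq_le (g i)
    have h2 := tsum_tsum_enorm_inner_sq_le hV (fun y => (tsum_enorm_inner_sq b' y).le) (b i)
    have h3 : c * ‖g i‖ₑ ^ 2 ≤ c := mul_le_of_le_one_right' (hb.enorm_leftVector_sq_le i)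
    have h4 : c * ‖b i‖ₑ ^ 2 = c := by
      rw [← ofReal_norm, b.orthonormal.1]
      simp
    calc _ ≤ (2⁻¹ : ℝ≥0∞) * (c + c) := by
          gcongr
          · exact h1.trans h3
          · exact h2.trans_eq h4
      _ = c := by
          rw [← two_mul, ← mul_assoc, ENNReal.inv_mul_cancel two_ne_zero ENNReal.ofNat_ne_top,
            one_mul]
  have hs' : ∀ j, ENNReal.ofReal (s' j) ≤ ∑' i, w j i * ENNReal.ofReal (s i) := by
    intro j
    by_cases hj : s' j = 0
    · simp [hj]
    have h1 : (s' j : ℂ) = ⟪g' j, T A (b' j)⟫_ℂ := by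
      have := hb'.orthonormal_leftVector.1 ⟨j, hj⟩
      rw [hb'.apply_eq, inner_smul_right, inner_self_eq_norm_sq_to_K, this]
      simp
    have h2 : ENNReal.ofReal (s' j) = ‖(s' j : ℂ)‖ₑ := by
      rw [← ofReal_norm, Complex.norm_real, Real.norm_of_nonneg (hb'.nonneg j)]
    rw [h2, h1, ← (h.hasSum A (b' j) (g' j)).tsum_eq]
    simp only [w]
    simp_rw [← ENNReal.tsum_mul_right]
    rw [ENNReal.tsum_comm]
    refine enorm_tsum_le_tsum_enorm.trans (ENNReal.tsum_le_tsum fun n => ?_)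
    have h3 := (b.hasSum_repr ((V n).adjoint (b' j))).mapL (innerSL ℂ ((V n).adjoint (g' j)) ∘L A)
    simp only [ContinuousLinearMap.comp_apply, innerSL_apply_apply, map_smul,
      b.repr_apply_apply, smul_eq_mul] at h3
    rw [← h3.tsum_eq]
    refine enorm_tsum_le_tsum_enorm.trans (ENNReal.tsum_le_tsum fun i => ?_)
    have h4 : ‖((s i : ℝ) : ℂ)‖ₑ = ENNReal.ofReal (s i) := by
      rw [← ofReal_norm, Complex.norm_real, Real.norm_of_nonneg (hb.nonneg i)]
    rw [hb.apply_eq, inner_smul_right, enorm_mul, enorm_mul, h4, enorm_inner_comm (b i)]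
    calc _ = ‖⟪(V n).adjoint (g' j), g i⟫_ℂ‖ₑ * ‖⟪(V n).adjoint (b' j), b i⟫_ℂ‖ₑ *
          ENNReal.ofReal (s i) := by ring
      _ ≤ _ := mul_le_mul_left (mul_le_half_add_sq _ _) _
  calc ∑' j, ENNReal.ofReal (s' j) ^ p
      ≤ ∑' j, (∑' i, w j i * ENNReal.ofReal (s i)) ^ p := by
        gcongr with j
        exact hs' j
    _ ≤ ∑' (j) (i), w j i * ENNReal.ofReal (s i) ^ p :=
        ENNReal.tsum_le_tsum fun j => tsum_mul_rpow_le hp _ _ (hw j)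
    _ = ∑' i, (∑' j, w j i) * ENNReal.ofReal (s i) ^ p := by
        rw [ENNReal.tsum_comm]
        simp_rw [ENNReal.tsum_mul_right]
    _ ≤ _ := by
        gcongr with i
        exact hw' i

theorem memSchatten_and_schattenNorm_le (h : IsKrausFamily V T) {C : ℝ} (hC : 0 ≤ C)
    (hV : ∀ x, ∑' n, ‖V n x‖ₑ ^ 2 ≤ ENNReal.ofReal C * ‖x‖ₑ ^ 2) {p : ℝ} (hp : 1 ≤ p)
    {A : E →L[ℂ] E} (hA : MemSchatten p A) :
    MemSchatten p (T A) ∧ schattenNorm p (T A) ≤ C ^ (1 / p) * schattenNorm p A := by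
  have h1 := h.posTrace_abs_rpow_le ENNReal.ofReal_ne_top hV hp hA
  have h2 := ENNReal.mul_lt_top ENNReal.ofReal_lt_top hA (a := ENNReal.ofReal C)
  refine ⟨h1.trans_lt h2, ?_⟩
  rw [schattenNorm, schattenNorm, ← Real.mul_rpow hC ENNReal.toReal_nonneg]
  refine Real.rpow_le_rpow ENNReal.toReal_nonneg ?_ (by positivity)
  have h3 := ENNReal.toReal_mono h2.ne h1
  rwa [ENNReal.toReal_mul, ENNReal.toReal_ofReal hC] at h3

end IsKrausFamily

end Kraus

/-! ## Bases of Hilbert tensor products and the Kraus operators of `A ↦ P (A ⊗ I) P*` -/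

section TensorBasis

variable {ι κ E F G : Type*} [NormedAddCommGroup E] [InnerProductSpace ℂ E]
  [NormedAddCommGroup F] [InnerProductSpace ℂ F]
  [NormedAddCommGroup G] [InnerProductSpace ℂ G]

theorem tmul_add_right (x : E) (y y' : F) : tmul x (y + y') = tmul x y + tmul x y' := by
  simp [tmul, TensorProduct.tmul_add]

theorem tmul_smul_right (c : ℂ) (x : E) (y : F) : tmul x (c • y) = c • tmul x y := by
  rw [tmul, TensorProduct.tmul_smul, map_smul, tmul]

theorem norm_tmul (x : E) (y : F) : ‖tmul x y‖ = ‖x‖ * ‖y‖ := by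
  rw [tmul, LinearIsometry.norm_map, TensorProduct.norm_tmul]

variable (E) in
/-- The operator `x ↦ x ⊗ y`. -/
def tmulRight (y : F) : E →L[ℂ] HilbertTensor E F :=
  LinearMap.mkContinuous
    { toFun := fun x => tmul x y
      map_add' := fun x x' => tmul_add_left x x' y
      map_smul' := fun c x => tmul_smul_left c x y } ‖y‖
    fun x => (norm_tmul x y).le.trans_eq (mul_comm _ _)

variable (F) in
/-- The operator `y ↦ x ⊗ y`. -/
def tmulLeft (x : E) : F →L[ℂ] HilbertTensor E F :=
  LinearMap.mkContinuous
    { toFun := fun y => tmul x y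
      map_add' := fun y y' => tmul_add_right x y y'
      map_smul' := fun c y => tmul_smul_right c x y } ‖x‖
    fun y => (norm_tmul x y).le

@[simp]
theorem tmulRight_apply (x : E) (y : F) : tmulRight E y x = tmul x y := rfl

@[simp]
theorem tmulLeft_apply (x : E) (y : F) : tmulLeft F x y = tmul x y := rfl

theorem HilbertBasis.clm_ext {K : Type*} [NormedAddCommGroup K] [NormedSpace ℂ K]
    (b : HilbertBasis ι ℂ E) {S T : E →L[ℂ] K} (h : ∀ i, S (b i) = T (b i)) : S = T := by
  ext x
  refine ((b.hasSum_repr x).mapL S).unique ?_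
  simpa [h] using (b.hasSum_repr x).mapL T

/-- Bounded operators that agree on the tensors of basis vectors are equal. -/
theorem HilbertTensor.clm_ext_basis {K : Type*} [NormedAddCommGroup K] [NormedSpace ℂ K]
    (b : HilbertBasis ι ℂ E) (d : HilbertBasis κ ℂ F) {S T : HilbertTensor E F →L[ℂ] K}
    (h : ∀ i j, S (tmul (b i) (d j)) = T (tmul (b i) (d j))) : S = T := by
  refine HilbertTensor.clm_ext fun x y => ?_
  have h1 : ∀ j, S ∘L tmulRight E (d j) = T ∘L tmulRight E (d j) := fun j =>
    HilbertBasis.clm_ext b fun i => h i j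
  have h2 : S ∘L tmulLeft F x = T ∘L tmulLeft F x :=
    HilbertBasis.clm_ext d fun j => DFunLike.congr_fun (h1 j) x
  exact DFunLike.congr_fun h2 y

theorem orthonormal_tmul {v : ι → E} {w : κ → F} (hv : Orthonormal ℂ v) (hw : Orthonormal ℂ w) :
    Orthonormal ℂ fun p : ι × κ => tmul (v p.1) (w p.2) := by
  classical
  rw [orthonormal_iff_ite]
  intro p q
  rw [inner_tmul_tmul, orthonormal_iff_ite.1 hv, orthonormal_iff_ite.1 hw]
  by_cases h1 : p.1 = q.1 <;> by_cases h2 : p.2 = q.2 <;> simp [Prod.ext_iff, h1, h2]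

/-- The orthonormal basis of the tensors of basis vectors. -/
def tensorBasis (b : HilbertBasis ι ℂ E) (d : HilbertBasis κ ℂ F) :
    HilbertBasis (ι × κ) ℂ (HilbertTensor E F) :=
  HilbertBasis.mkOfOrthogonalEqBot (orthonormal_tmul b.orthonormal d.orthonormal) (by
    rw [eq_bot_iff]
    intro y hy
    have h : innerSL ℂ y = 0 := HilbertTensor.clm_ext_basis b d fun i j =>
      Submodule.inner_left_of_mem_orthogonal (Submodule.subset_span (Set.mem_range_self
        (f := fun p : ι × κ => tmul (b p.1) (d p.2)) (i, j))) hy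
    have h2 := DFunLike.congr_fun h y
    simpa using h2)

@[simp]
theorem tensorBasis_apply (b : HilbertBasis ι ℂ E) (d : HilbertBasis κ ℂ F) (p : ι × κ) :
    tensorBasis b d p = tmul (b p.1) (d p.2) := by
  simp [tensorBasis]

variable [CompleteSpace E] [CompleteSpace G]

/-- The adjoint of `x ↦ x ⊗ y` contracts the second factor against `y`, and `A ⊗ I` does not touch
that factor. -/
theorem adjoint_tmulRight_tensorId (y : F) (A : E →L[ℂ] E) (z : HilbertTensor E F) :
    (tmulRight E y).adjoint (tensorId F A z) = A ((tmulRight E y).adjoint z) := by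
  have h : ∀ x x' y', ⟪x, (tmulRight E y).adjoint (tmul x' y')⟫_ℂ = ⟪x, x'⟫_ℂ * ⟪y, y'⟫_ℂ := by
    intro x x' y'
    rw [ContinuousLinearMap.adjoint_inner_right, tmulRight_apply, inner_tmul_tmul]
  have : (tmulRight E y).adjoint ∘L tensorId F A = A ∘L (tmulRight E y).adjoint := by
    refine HilbertTensor.clm_ext fun x' y' => ext_inner_left ℂ fun x => ?_
    rw [ContinuousLinearMap.comp_apply, ContinuousLinearMap.comp_apply, tensorId_tmul, h,
      ← ContinuousLinearMap.adjoint_inner_left A ((tmulRight E y).adjoint _), h,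
      ContinuousLinearMap.adjoint_inner_left]
  exact DFunLike.congr_fun this z

theorem tsum_enorm_adjoint_tmulRight_sq (d : HilbertBasis κ ℂ F) (z : HilbertTensor E F) :
    ∑' n, ‖(tmulRight E (d n)).adjoint z‖ₑ ^ 2 = ‖z‖ₑ ^ 2 := by
  rw [← tsum_enorm_inner_sq (tensorBasis (basis E) d) z]
  simp only [tensorBasis_apply]
  rw [ENNReal.tsum_prod (f := fun i n => ‖⟪tmul (basis E i) (d n), z⟫_ℂ‖ₑ ^ 2), ENNReal.tsum_comm]
  refine tsum_congr fun n => ?_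
  rw [← tsum_enorm_inner_sq (basis E)]
  simp_rw [ContinuousLinearMap.adjoint_inner_right, tmulRight_apply]

theorem hasSum_inner_tensorId (d : HilbertBasis κ ℂ F) (A : E →L[ℂ] E) (z z' : HilbertTensor E F) :
    HasSum (fun n => ⟪(tmulRight E (d n)).adjoint z', A ((tmulRight E (d n)).adjoint z)⟫_ℂ)
      ⟪z', tensorId F A z⟫_ℂ := by
  have h := (tensorBasis (basis E) d).hasSum_inner_mul_inner z' (tensorId F A z)
  rw [← (Equiv.prodComm _ _).hasSum_iff] at h
  refine HasSum.prod_fiberwise h fun n => ?_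
  have h2 := (basis E).hasSum_inner_mul_inner ((tmulRight E (d n)).adjoint z')
    (A ((tmulRight E (d n)).adjoint z))
  convert! h2 using 2 with i
  rw [← adjoint_tmulRight_tensorId, ContinuousLinearMap.adjoint_inner_right,
    ContinuousLinearMap.adjoint_inner_left]
  simp

/-- Parseval in the second factor, applied to `P* x` and `P* y`. The normalization holds because `P
P* = 1` makes `P*` isometric. -/
theorem isKrausFamily_conjMap (d : HilbertBasis κ ℂ F) {P : HilbertTensor E F →L[ℂ] G}
    (hP : P ∘L P.adjoint = 1) :
    IsKrausFamily (fun n => P ∘L tmulRight E (d n)) (conjMap P ∘L ampliation E F) := by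
  refine ⟨fun A x y => ?_, fun x => ?_⟩
  · have h := hasSum_inner_tensorId d A (P.adjoint x) (P.adjoint y)
    rw [ContinuousLinearMap.adjoint_inner_left] at h
    simp only [ContinuousLinearMap.adjoint_comp]
    exact h
  · simp only [ContinuousLinearMap.adjoint_comp, ContinuousLinearMap.comp_apply]
    rw [tsum_enorm_adjoint_tmulRight_sq]
    have h : ‖P.adjoint x‖ = ‖x‖ := by
      have h1 : ⟪P.adjoint x, P.adjoint x⟫_ℂ = ⟪x, x⟫_ℂ := by
        rw [ContinuousLinearMap.adjoint_inner_left, ← ContinuousLinearMap.comp_apply, hP]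
        rfl
      rw [inner_self_eq_norm_sq_to_K, inner_self_eq_norm_sq_to_K] at h1
      have h2 : ‖P.adjoint x‖ ^ 2 = ‖x‖ ^ 2 := by exact_mod_cast h1
      exact (sq_eq_sq₀ (norm_nonneg _) (norm_nonneg _)).1 h2
    rw [← ofReal_norm, h, ofReal_norm]

end TensorBasis

/-! ## Integrals over the disc in polar coordinates -/

section Polar

/-- Besides the change of variables, Fubini needs integrability on the polar rectangle; this is
transferred by the same change of variables for the lower integral of the norm. -/
theorem integral_ball_eq_integral_polar {h : ℂ → ℂ} (hc : ContinuousOn h (ball 0 1))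
    (hi : IntegrableOn h (ball 0 1)) :
    ∫ z in ball (0 : ℂ) 1, h z = ∫ r in Set.Ioo (0 : ℝ) 1,
      ∫ θ in Set.Ioo (-Real.pi) Real.pi, r • h (circleMap 0 r θ) := by
  have hmap : ∀ p : ℝ × ℝ, Complex.polarCoord.symm p = circleMap 0 p.1 p.2 := fun p => by
    simp [circleMap, Complex.exp_mul_I]
  have hnorm : ∀ p : ℝ × ℝ, 0 < p.1 → ‖circleMap 0 p.1 p.2‖ = p.1 := fun p hp => by
    simp [abs_of_pos hp]
  set S := Set.Ioo (0 : ℝ) 1 ×ˢ Set.Ioo (-Real.pi) Real.pi with hS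
  have hSm : MeasurableSet S := measurableSet_Ioo.prod measurableSet_Ioo
  have hST : S ⊆ polarCoord.target := Set.prod_mono (fun r hr => hr.1) subset_rfl
  have hTm : MeasurableSet polarCoord.target := polarCoord.open_target.measurableSet
  have hind : ∀ p ∈ polarCoord.target, (ball (0 : ℂ) 1).indicator h (circleMap 0 p.1 p.2) =
      S.indicator (fun p => h (circleMap 0 p.1 p.2)) p := by
    intro p hp
    have hp1 : 0 < p.1 := hp.1
    by_cases h1 : p.1 < 1
    · rw [Set.indicator_of_mem, Set.indicator_of_mem]
      · exact ⟨⟨hp1, h1⟩, hp.2⟩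
      · rwa [mem_ball_zero_iff, hnorm p hp1]
    · rw [Set.indicator_of_notMem, Set.indicator_of_notMem]
      · exact fun h2 => h1 h2.1.2
      · rwa [mem_ball_zero_iff, hnorm p hp1]
  have hcont : ContinuousOn (fun p : ℝ × ℝ => p.1 • h (circleMap 0 p.1 p.2)) S := by
    refine continuousOn_fst.smul (hc.comp ?_ fun p hp => ?_)
    · simp only [circleMap]
      fun_prop
    · rw [mem_ball_zero_iff, hnorm p hp.1.1]
      exact hp.1.2
  have hint : IntegrableOn (fun p : ℝ × ℝ => p.1 • h (circleMap 0 p.1 p.2)) S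
      (volume.prod volume) := by
    rw [← Measure.volume_eq_prod]
    refine ⟨hcont.aestronglyMeasurable hSm, ?_⟩
    have h1 := Complex.lintegral_comp_polarCoord_symm fun z => ‖(ball (0 : ℂ) 1).indicator h z‖ₑ
    have h2 : ∫⁻ p in S, ‖p.1 • h (circleMap 0 p.1 p.2)‖ₑ ≤ ∫⁻ z in ball (0 : ℂ) 1, ‖h z‖ₑ := by
      rw [← lintegral_indicator measurableSet_ball]
      simp only [enorm_indicator_eq_indicator_enorm] at h1
      rw [← h1]
      refine (setLIntegral_mono_ae' hSm ?_).trans (lintegral_mono_set hST)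
      refine .of_forall fun p hp => ?_
      have := hind p (hST hp)
      rw [hmap, enorm_smul, Real.enorm_eq_ofReal hp.1.1.le, smul_eq_mul,
        ← enorm_indicator_eq_indicator_enorm, this, Set.indicator_of_mem hp]
    exact h2.trans_lt hi.2
  rw [← integral_indicator measurableSet_ball, ← Complex.integral_comp_polarCoord_symm,
    setIntegral_congr_fun hTm (g := S.indicator fun p => p.1 • h (circleMap 0 p.1 p.2)) ?_,
    setIntegral_indicator hSm, Set.inter_eq_right.2 hST, Measure.volume_eq_prod,
    setIntegral_prod _ hint]
  intro p hp
  simp only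
  rw [hmap, hind p hp]
  by_cases h1 : p ∈ S <;> simp [h1]

/-- On the circle `conj z = r² / z`, so this is Cauchy's formula for the `n`-th derivative at 0. -/
theorem integral_conj_pow_mul {F : ℂ → ℂ} (hF : DifferentiableOn ℂ F (ball 0 1)) (n : ℕ) {r : ℝ}
    (hr : r ∈ Set.Ioo (0 : ℝ) 1) :
    ∫ θ in Set.Ioo (-Real.pi) Real.pi,
      (starRingEnd ℂ) (circleMap 0 r θ) ^ n * F (circleMap 0 r θ) =
      2 * Real.pi * r ^ (2 * n) * (iteratedDeriv n F 0 / n.factorial) := by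
  have hd : DiffContOnCl ℂ F (ball 0 r) := by
    refine DifferentiableOn.diffContOnCl (hF.mono ?_)
    exact closure_ball_subset_closedBall.trans (closedBall_subset_ball hr.2)
  have h1 := hd.circleIntegral_one_div_sub_center_pow_smul hr.1 n
  rw [circleIntegral] at h1
  have hr0 : (r : ℂ) ≠ 0 := by exact_mod_cast hr.1.ne'
  have h2 : ∀ θ : ℝ, deriv (circleMap 0 r) θ • (1 / (circleMap 0 r θ - 0) ^ (n + 1)) •
      F (circleMap 0 r θ) = Complex.I * ((r : ℂ) ^ (2 * n))⁻¹ *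
        ((starRingEnd ℂ) (circleMap 0 r θ) ^ n * F (circleMap 0 r θ)) := by
    intro θ
    have hz : circleMap 0 r θ ≠ 0 := circleMap_ne_center hr.1.ne'
    have hn : (starRingEnd ℂ) (circleMap 0 r θ) * circleMap 0 r θ = (r : ℂ) ^ 2 := by
      rw [Complex.conj_mul', norm_circleMap_zero, abs_of_pos hr.1]
    have h3 : (starRingEnd ℂ) (circleMap 0 r θ) = (r : ℂ) ^ 2 / circleMap 0 r θ := by
      rw [eq_div_iff hz, hn]
    rw [h3, deriv_circleMap, div_pow, ← pow_mul]
    simp only [smul_eq_mul, sub_zero]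
    field_simp
    ring
  simp only [h2] at h1
  rw [intervalIntegral.integral_const_mul] at h1
  have h4 := ((periodic_circleMap 0 r).comp
    fun z => (starRingEnd ℂ) z ^ n * F z).intervalIntegral_add_eq (-Real.pi) 0
  simp only [Function.comp_def, zero_add] at h4
  rw [show -Real.pi + 2 * Real.pi = Real.pi by ring] at h4
  rw [← integral_Ioc_eq_integral_Ioo, ← intervalIntegral.integral_of_le (by linarith [Real.pi_pos]),
    h4]
  have h5 : Complex.I * ((r : ℂ) ^ (2 * n))⁻¹ ≠ 0 := by simp [hr0]
  refine mul_left_cancel₀ h5 (h1.trans ?_)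
  have := Nat.factorial_ne_zero n
  simp only [smul_eq_mul]
  field_simp

/-- A Beta integral. The induction step is integration by parts: the derivative of `r^(2n+2)
(1-r²)^(m+1)` integrates to 0. -/
theorem integral_pow_mul_one_sub_sq_pow (m n : ℕ) :
    ∫ r in (0 : ℝ)..1, (2 * r ^ (2 * n + 1) * (1 - r ^ 2) ^ m : ℝ) =
      (n.factorial * m.factorial / (n + m + 1).factorial : ℝ) := by
  induction m generalizing n with
  | zero =>
    simp only [pow_zero, mul_one, Nat.factorial_zero, Nat.cast_one, add_zero]
    rw [intervalIntegral.integral_const_mul, integral_pow, Nat.factorial_succ]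
    have := Nat.factorial_ne_zero n
    push_cast
    field_simp
    simp
    ring
  | succ m ih =>
    have h1 : ∫ r in (0 : ℝ)..1, ((n + 1) * (2 * r ^ (2 * n + 1) * (1 - r ^ 2) ^ (m + 1)) -
        (m + 1) * (2 * r ^ (2 * (n + 1) + 1) * (1 - r ^ 2) ^ m)) = 0 := by
      have h2 : ∀ r : ℝ, HasDerivAt (fun r : ℝ => r ^ (2 * n + 2) * (1 - r ^ 2) ^ (m + 1))
          ((n + 1) * (2 * r ^ (2 * n + 1) * (1 - r ^ 2) ^ (m + 1)) -
          (m + 1) * (2 * r ^ (2 * (n + 1) + 1) * (1 - r ^ 2) ^ m)) r := by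
        intro r
        have h3 := (hasDerivAt_pow (2 * n + 2) r).mul
          (((hasDerivAt_pow 2 r).const_sub 1).pow (m + 1))
        convert! h3 using 1
        push_cast
        simp only [Pi.pow_apply]
        ring
      rw [intervalIntegral.integral_eq_sub_of_hasDerivAt (fun r _ => h2 r)]
      · simp
      · exact Continuous.intervalIntegrable (by fun_prop) _ _
    rw [intervalIntegral.integral_sub, intervalIntegral.integral_const_mul,
      intervalIntegral.integral_const_mul, ih, sub_eq_zero] at h1
    · have h0 : (n : ℝ) + 1 ≠ 0 := by positivity
      refine mul_left_cancel₀ h0 (h1.trans ?_)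
      rw [show n + 1 + m + 1 = n + (m + 1) + 1 by ring, Nat.factorial_succ n, Nat.factorial_succ m]
      push_cast
      ring
    · exact Continuous.intervalIntegrable (by fun_prop) _ _
    · exact Continuous.intervalIntegrable (by fun_prop) _ _

end Polar

/-! ## The orthonormal basis of monomials -/

section Basis

/-- Writing `ν = m + 2` cancels the denominator `(1 - |z|²)²`, so that the density is a polynomial
in `‖z‖`. -/
theorem diskMeasure_add_two (m : ℕ) :
    diskMeasure (m + 2) = (volume.restrict (ball (0 : ℂ) 1)).withDensity fun z =>
      ENNReal.ofReal ((m + 1) / Real.pi * (1 - ‖z‖ ^ 2) ^ m) := by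
  refine withDensity_congr_ae ?_
  filter_upwards [ae_restrict_mem measurableSet_ball] with z hz
  rw [mem_ball_zero_iff] at hz
  have h : 1 - ‖z‖ ^ 2 ≠ 0 := by
    have := norm_nonneg z
    nlinarith
  congr 1
  have := Real.pi_pos.ne'
  field_simp
  push_cast
  ring

theorem ae_mem_ball (ν : ℕ) : ∀ᵐ z ∂diskMeasure ν, z ∈ ball (0 : ℂ) 1 :=
  (withDensity_absolutelyContinuous _ _).ae_le (ae_restrict_mem measurableSet_ball)

theorem toReal_density {m : ℕ} {z : ℂ} (hz : z ∈ ball (0 : ℂ) 1) :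
    (ENNReal.ofReal ((m + 1) / Real.pi * (1 - ‖z‖ ^ 2) ^ m)).toReal =
      (m + 1) / Real.pi * (1 - ‖z‖ ^ 2) ^ m := by
  rw [mem_ball_zero_iff] at hz
  have h : 0 ≤ 1 - ‖z‖ ^ 2 := by
    have := norm_nonneg z
    nlinarith
  have := Real.pi_pos
  exact ENNReal.toReal_ofReal (by positivity)

theorem integral_diskMeasure (m : ℕ) (g : ℂ → ℂ) :
    ∫ z, g z ∂diskMeasure (m + 2) =
      ∫ z in ball (0 : ℂ) 1, ((m + 1) / Real.pi * (1 - ‖z‖ ^ 2) ^ m : ℝ) • g z := by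
  rw [diskMeasure_add_two, integral_withDensity_eq_integral_toReal_smul (by fun_prop)
    (.of_forall fun _ => ENNReal.ofReal_lt_top)]
  refine setIntegral_congr_fun measurableSet_ball fun z hz => ?_
  simp only [toReal_density hz]

theorem integrable_diskMeasure {m : ℕ} {g : ℂ → ℂ} (hg : Integrable g (diskMeasure (m + 2))) :
    IntegrableOn (fun z => ((m + 1) / Real.pi * (1 - ‖z‖ ^ 2) ^ m : ℝ) • g z) (ball (0 : ℂ) 1) := by
  rw [diskMeasure_add_two, integrable_withDensity_iff_integrable_smul' (by fun_prop)
    (.of_forall fun _ => ENNReal.ofReal_lt_top)] at hg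
  refine IntegrableOn.congr_fun hg (fun z hz => ?_) measurableSet_ball
  simp only [toReal_density hz]

instance (ν : ℕ) : IsFiniteMeasure (diskMeasure ν) := by
  rcases le_or_gt ν 1 with h | h
  · rw [diskMeasure_eq_zero h]
    infer_instance
  obtain ⟨m, rfl⟩ := Nat.exists_eq_add_of_le' (Nat.succ_le_of_lt h)
  rw [diskMeasure_add_two]
  refine isFiniteMeasure_withDensity (ne_top_of_le_ne_top (b := ∫⁻ _ in ball (0 : ℂ) 1,
    ENNReal.ofReal ((m + 1) / Real.pi)) ?_ (setLIntegral_mono' measurableSet_ball fun z hz => ?_))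
  · rw [setLIntegral_const]
    exact ENNReal.mul_ne_top ENNReal.ofReal_ne_top measure_ball_lt_top.ne
  · refine ENNReal.ofReal_le_ofReal ?_
    rw [mem_ball_zero_iff] at hz
    have h0 := norm_nonneg z
    have := Real.pi_pos
    exact mul_le_of_le_one_right (by positivity) (pow_le_one₀ (by nlinarith) (by nlinarith))

/-- The square of the norm of `z ^ n` in `H_ν`. -/
def normSqPow (ν n : ℕ) : ℝ := n.factorial / ν.ascFactorial n

theorem ascFactorial_cast_pos {ν : ℕ} (hν : 1 < ν) (n : ℕ) : (0 : ℝ) < ν.ascFactorial n := by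
  obtain ⟨m, rfl⟩ := Nat.exists_eq_add_of_le' hν.le
  exact_mod_cast Nat.ascFactorial_pos m n

theorem normSqPow_pos {ν : ℕ} (hν : 1 < ν) (n : ℕ) : 0 < normSqPow ν n :=
  div_pos (by exact_mod_cast Nat.factorial_pos n) (ascFactorial_cast_pos hν n)

theorem integral_conj_pow_mul_diskMeasure {ν : ℕ} (hν : 1 < ν) {F : ℂ → ℂ}
    (hF : DifferentiableOn ℂ F (ball 0 1)) (n : ℕ)
    (hi : Integrable (fun z => (starRingEnd ℂ) z ^ n * F z) (diskMeasure ν)) :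
    ∫ z, (starRingEnd ℂ) z ^ n * F z ∂diskMeasure ν =
      iteratedDeriv n F 0 / ν.ascFactorial n := by
  obtain ⟨m, rfl⟩ := Nat.exists_eq_add_of_le' (Nat.succ_le_of_lt hν)
  rw [integral_diskMeasure, integral_ball_eq_integral_polar _ (integrable_diskMeasure hi)]
  · have h1 : ∀ r ∈ Set.Ioo (0 : ℝ) 1, ∫ θ in Set.Ioo (-Real.pi) Real.pi,
        r • ((m + 1) / Real.pi * (1 - ‖circleMap 0 r θ‖ ^ 2) ^ m : ℝ) •
          ((starRingEnd ℂ) (circleMap 0 r θ) ^ n * F (circleMap 0 r θ)) =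
        ((2 * r ^ (2 * n + 1) * (1 - r ^ 2) ^ m : ℝ) : ℂ) *
          ((m + 1) * (iteratedDeriv n F 0 / n.factorial)) := by
      intro r hr
      simp only [norm_circleMap_zero, sq_abs]
      rw [integral_smul, integral_smul, integral_conj_pow_mul hF n hr]
      have : (Real.pi : ℂ) ≠ 0 := by exact_mod_cast Real.pi_pos.ne'
      simp only [Complex.real_smul]
      push_cast
      field_simp
      ring
    rw [setIntegral_congr_fun measurableSet_Ioo h1, integral_mul_const, integral_complex_ofReal,
      ← integral_Ioc_eq_integral_Ioo, ← intervalIntegral.integral_of_le zero_le_one,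
      integral_pow_mul_one_sub_sq_pow]
    have h2 := Nat.factorial_mul_ascFactorial (m + 1) n
    rw [show n + m + 1 = m + 1 + n by ring, ← h2, Nat.factorial_succ]
    have h3 : ((m + 1 + 1).ascFactorial n : ℂ) ≠ 0 := by
      exact_mod_cast (Nat.ascFactorial_pos _ _).ne'
    have h4 : (m.factorial : ℂ) ≠ 0 := by exact_mod_cast m.factorial_ne_zero
    have h5 : (n.factorial : ℂ) ≠ 0 := by exact_mod_cast n.factorial_ne_zero
    have h6 : (m : ℂ) + 1 ≠ 0 := by exact_mod_cast m.succ_ne_zero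
    push_cast
    field_simp
  · have := hF.continuousOn
    fun_prop

/-- The bound for point evaluations, applied to the difference as a representative of the class 0.
It makes the chosen function `holo` usable for computations. -/
theorem eqOn_of_ae_eq {ν : ℕ} (hν : 1 < ν) {F H : ℂ → ℂ} (hF : DifferentiableOn ℂ F (ball 0 1))
    (hH : DifferentiableOn ℂ H (ball 0 1)) (h : F =ᵐ[diskMeasure ν] H) : Set.EqOn F H (ball 0 1) := by
  intro z hz
  obtain ⟨δ, hδ, -, C, -, hC⟩ := exists_norm_le hν hz
  have h1 := hC 0 (F - H) (hF.sub hH) (by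
    filter_upwards [Lp.coeFn_zero ℂ 2 (diskMeasure ν), h] with w h1 h2
    rw [h1]
    simp [h2]) z (mem_ball_self hδ)
  rw [norm_zero, mul_zero, norm_le_zero_iff] at h1
  exact sub_eq_zero.1 h1

theorem exists_holo_eqOn {ν : ℕ} (hν : 1 < ν) {F : ℂ → ℂ} (hF : DifferentiableOn ℂ F (ball 0 1))
    (hF' : MemLp F 2 (diskMeasure ν)) : ∃ f : Bergman ν, Set.EqOn (holo f) F (ball 0 1) := by
  let f : Bergman ν := (⟨hF'.toLp F, F, hF, hF'.coeFn_toLp⟩ : bergmanSubmodule ν)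
  refine ⟨f, eqOn_of_ae_eq hν (differentiableOn_holo f) hF ?_⟩
  exact (coeFn_ae_eq_holo f).symm.trans hF'.coeFn_toLp

theorem holo_add {ν : ℕ} (hν : 1 < ν) (f g : Bergman ν) :
    Set.EqOn (holo (f + g)) (holo f + holo g) (ball 0 1) := by
  refine eqOn_of_ae_eq hν (differentiableOn_holo _)
    ((differentiableOn_holo f).add (differentiableOn_holo g)) ?_
  refine (coeFn_ae_eq_holo _).symm.trans ?_
  rw [map_add]
  exact (Lp.coeFn_add _ _).trans ((coeFn_ae_eq_holo f).add (coeFn_ae_eq_holo g))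

theorem holo_smul {ν : ℕ} (hν : 1 < ν) (c : ℂ) (f : Bergman ν) :
    Set.EqOn (holo (c • f)) (c • holo f) (ball 0 1) := by
  refine eqOn_of_ae_eq hν (differentiableOn_holo _) ((differentiableOn_holo f).const_smul c) ?_
  refine (coeFn_ae_eq_holo _).symm.trans ?_
  rw [map_smul]
  exact (Lp.coeFn_smul _ _).trans ((coeFn_ae_eq_holo f).const_smul c)

theorem iteratedDeriv_eq_of_eqOn_ball {F H : ℂ → ℂ} (h : Set.EqOn F H (ball 0 1)) (n : ℕ) {z : ℂ}
    (hz : z ∈ ball (0 : ℂ) 1) : iteratedDeriv n F z = iteratedDeriv n H z :=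
  (h.eventuallyEq_of_mem (isOpen_ball.mem_nhds hz)).iteratedDeriv_eq n

theorem contDiffAt_holo {ν : ℕ} (f : Bergman ν) (n : ℕ) {z : ℂ} (hz : z ∈ ball (0 : ℂ) 1) :
    ContDiffAt ℂ n (holo f) z :=
  ((differentiableOn_holo f).analyticAt (isOpen_ball.mem_nhds hz)).contDiffAt

/-- The bounded functional `f ↦ f⁽ⁿ⁾(z)` on `H_ν`. -/
def evalDeriv {ν : ℕ} (hν : 1 < ν) (n : ℕ) {z : ℂ} (hz : z ∈ ball (0 : ℂ) 1) : Bergman ν →L[ℂ] ℂ :=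
  LinearMap.mkContinuousOfExistsBound
    { toFun := fun f => iteratedDeriv n (holo f) z
      map_add' := fun f g => by
        rw [iteratedDeriv_eq_of_eqOn_ball (holo_add hν f g) n hz,
          iteratedDeriv_add (contDiffAt_holo f n hz) (contDiffAt_holo g n hz)]
      map_smul' := fun c f => by
        rw [iteratedDeriv_eq_of_eqOn_ball (holo_smul hν c f) n hz, iteratedDeriv_const_smul_field,
          RingHom.id_apply] } (by
    obtain ⟨δ, hδ, hsub, C, hC0, hC⟩ := exists_norm_le hν hz
    refine ⟨n.factorial * C / (δ / 2) ^ n, fun f => ?_⟩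
    have h1 := Complex.norm_iteratedDeriv_le_of_forall_mem_sphere_norm_le (f := holo f) (c := z)
      (R := δ / 2) (C := C * ‖f‖) n (by positivity)
      (DifferentiableOn.diffContOnCl ((differentiableOn_holo f).mono
        ((closure_ball_subset_closedBall.trans (closedBall_subset_ball (half_lt_self hδ))).trans
          hsub)))
      (fun w hw => by
        rw [← Bergman.toLp.norm_map f]
        exact hC _ _ (differentiableOn_holo f) (coeFn_ae_eq_holo f) w
          (sphere_subset_closedBall.trans (closedBall_subset_ball (half_lt_self hδ)) hw))
    refine h1.trans_eq ?_
    ring)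

theorem evalDeriv_apply {ν : ℕ} (hν : 1 < ν) (n : ℕ) {z : ℂ} (hz : z ∈ ball (0 : ℂ) 1)
    (f : Bergman ν) : evalDeriv hν n hz f = iteratedDeriv n (holo f) z := rfl

theorem memLp_of_norm_le_one (ν : ℕ) {F : ℂ → ℂ} (hF : Continuous F)
    (h : ∀ z ∈ ball (0 : ℂ) 1, ‖F z‖ ≤ 1) : MemLp F 2 (diskMeasure ν) := by
  refine MemLp.of_bound hF.aestronglyMeasurable 1 ?_
  filter_upwards [ae_mem_ball ν] with z hz using h z hz

theorem exists_monomial {ν : ℕ} (hν : 1 < ν) (n : ℕ) :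
    ∃ f : Bergman ν, Set.EqOn (holo f) (· ^ n) (ball 0 1) :=
  exists_holo_eqOn hν (by fun_prop) (memLp_of_norm_le_one ν (by fun_prop) fun z hz => by
    rw [norm_pow]
    exact pow_le_one₀ (norm_nonneg z) (mem_ball_zero_iff.1 hz).le)

/-- The function `z ^ n` as an element of `H_ν`. -/
def monomial {ν : ℕ} (hν : 1 < ν) (n : ℕ) : Bergman ν := (exists_monomial hν n).choose

theorem holo_monomial {ν : ℕ} (hν : 1 < ν) (n : ℕ) :
    Set.EqOn (holo (monomial hν n)) (· ^ n) (ball 0 1) := (exists_monomial hν n).choose_spec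

/-- Pairing with a monomial reads off a Taylor coefficient at 0. Both orthogonality and totality of
the monomials come from this. -/
theorem inner_monomial {ν : ℕ} (hν : 1 < ν) (n : ℕ) (f : Bergman ν) :
    ⟪monomial hν n, f⟫_ℂ = iteratedDeriv n (holo f) 0 / ν.ascFactorial n := by
  have h1 : (fun z => ⟪Bergman.toLp (monomial hν n) z, Bergman.toLp f z⟫_ℂ) =ᵐ[diskMeasure ν]
      fun z => (starRingEnd ℂ) z ^ n * holo f z := by
    filter_upwards [ae_mem_ball ν, coeFn_ae_eq_holo (monomial hν n), coeFn_ae_eq_holo f] with z hz h1 h2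
    rw [h1, h2, holo_monomial hν n hz]
    simp [mul_comm]
  rw [← Bergman.toLp.inner_map_map, L2.inner_def, integral_congr_ae h1]
  exact integral_conj_pow_mul_diskMeasure hν (differentiableOn_holo f) n
    ((L2.integrable_inner _ _).congr h1)

theorem zero_mem_ball : (0 : ℂ) ∈ ball (0 : ℂ) 1 := mem_ball_self one_pos

theorem inner_monomial_monomial {ν : ℕ} (hν : 1 < ν) (m n : ℕ) :
    ⟪monomial hν m, monomial hν n⟫_ℂ = if m = n then (normSqPow ν n : ℂ) else 0 := by
  rw [inner_monomial, iteratedDeriv_eq_of_eqOn_ball (holo_monomial hν n) m zero_mem_ball,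
    iteratedDeriv_fun_pow_zero]
  split_ifs with h
  · subst h
    simp [normSqPow]
  · simp

/-- The norm of `z ^ n` in `H_ν`. -/
def normPow (ν n : ℕ) : ℝ := √(normSqPow ν n)

theorem normPow_pos {ν : ℕ} (hν : 1 < ν) (n : ℕ) : 0 < normPow ν n :=
  Real.sqrt_pos.2 (normSqPow_pos hν n)

theorem normPow_sq {ν : ℕ} (hν : 1 < ν) (n : ℕ) : normPow ν n ^ 2 = normSqPow ν n :=
  Real.sq_sqrt (normSqPow_pos hν n).le

theorem orthonormal_monomial {ν : ℕ} (hν : 1 < ν) :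
    Orthonormal ℂ fun n => ((normPow ν n)⁻¹ : ℂ) • monomial hν n := by
  rw [orthonormal_iff_ite]
  intro m n
  rw [inner_smul_left, inner_smul_right, inner_monomial_monomial]
  split_ifs with h
  · subst h
    have h1 : (normPow ν m : ℂ) ≠ 0 := by exact_mod_cast (normPow_pos hν m).ne'
    rw [← normPow_sq hν]
    simp
    field_simp
  · simp

/-- The orthonormal basis of the normalized monomials. -/
def monomialBasis {ν : ℕ} (hν : 1 < ν) : HilbertBasis ℕ ℂ (Bergman ν) :=
  HilbertBasis.mkOfOrthogonalEqBot (orthonormal_monomial hν) (by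
    rw [eq_bot_iff]
    intro f hf
    have h1 : ∀ n, iteratedDeriv n (holo f) 0 = 0 := by
      intro n
      have h2 := Submodule.inner_right_of_mem_orthogonal (Submodule.subset_span
        (Set.mem_range_self (f := fun n => ((normPow ν n)⁻¹ : ℂ) • monomial hν n) n)) hf
      have h3 : (normPow ν n : ℂ) ≠ 0 := by exact_mod_cast (normPow_pos hν n).ne'
      have h4 : (ν.ascFactorial n : ℂ) ≠ 0 := by exact_mod_cast (ascFactorial_cast_pos hν n).ne'
      rw [inner_smul_left, inner_monomial] at h2
      simpa [h3, h4] using h2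
    refine eq_of_holo_eqOn fun z hz => ?_
    have h5 := Complex.hasSum_taylorSeries_on_ball (differentiableOn_holo f) hz
    simp only [h1, smul_zero] at h5
    -- `holo 0` is itself a chosen representative; that it vanishes on the disc is obtained from
    -- homogeneity with scalar 0.
    have h6 := holo_smul hν 0 (0 : Bergman ν) hz
    rw [zero_smul] at h6
    rw [h5.unique hasSum_zero, h6]
    simp)

theorem monomialBasis_apply {ν : ℕ} (hν : 1 < ν) (n : ℕ) :
    monomialBasis hν n = ((normPow ν n)⁻¹ : ℂ) • monomial hν n := by
  simp [monomialBasis]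

theorem holo_monomialBasis {ν : ℕ} (hν : 1 < ν) (n : ℕ) :
    Set.EqOn (holo (monomialBasis hν n)) (fun z => ((normPow ν n)⁻¹ : ℂ) * z ^ n) (ball 0 1) := by
  intro z hz
  rw [monomialBasis_apply, holo_smul hν _ _ hz, Pi.smul_apply, holo_monomial hν n hz, smul_eq_mul]

theorem iteratedDeriv_holo_monomialBasis {ν : ℕ} (hν : 1 < ν) (n j : ℕ) {z : ℂ}
    (hz : z ∈ ball (0 : ℂ) 1) : iteratedDeriv j (holo (monomialBasis hν n)) z =
      ((normPow ν n)⁻¹ : ℂ) * (n.descFactorial j * z ^ (n - j)) := by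
  rw [iteratedDeriv_eq_of_eqOn_ball (holo_monomialBasis hν n) j hz, iteratedDeriv_const_mul_field,
    iteratedDeriv_pow]

theorem nontrivial_bergman {ν : ℕ} (hν : 1 < ν) : Nontrivial (Bergman ν) :=
  ⟨monomialBasis hν 0, 0, (monomialBasis hν).orthonormal.ne_zero 0⟩

end Basis

/-! ## The coefficients of the projection on monomials -/

section Coefficients

theorem cast_descFactorial_succ (a j : ℕ) :
    (a.descFactorial (j + 1) : ℝ) = ((a : ℝ) - j) * a.descFactorial j := by
  rcases le_or_gt j a with h | h
  · rw [Nat.descFactorial_succ]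
    push_cast [h]
    ring
  · rw [Nat.descFactorial_of_lt h, Nat.descFactorial_of_lt (h.trans j.lt_succ_self)]
    simp

theorem cast_mul_descFactorial_pred (a j : ℕ) :
    (a : ℝ) * (a - 1).descFactorial j = a.descFactorial j * ((a : ℝ) - j) := by
  cases a with
  | zero => cases j <;> simp
  | succ a =>
    rw [mul_comm (((a + 1).descFactorial j : ℕ) : ℝ), ← cast_descFactorial_succ,
      Nat.succ_descFactorial_succ]
    push_cast
    simp

theorem cast_succ_descFactorial (a j : ℕ) :
    ((a + 1).descFactorial j : ℝ) = a.descFactorial j + j * a.descFactorial (j - 1) := by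
  cases j with
  | zero => simp
  | succ j =>
    rw [Nat.succ_descFactorial_succ, cast_descFactorial_succ, Nat.add_sub_cancel]
    push_cast
    ring

theorem cast_mul_descFactorial_pred_index (a j : ℕ) :
    (j : ℝ) * ((a : ℝ) * a.descFactorial (j - 1)) =
      j * (a.descFactorial j + ((j : ℝ) - 1) * a.descFactorial (j - 1)) := by
  cases j with
  | zero => simp
  | succ j =>
    rw [cast_descFactorial_succ, Nat.add_sub_cancel]
    push_cast
    ring

theorem normSqPow_succ {ν : ℕ} (hν : 1 < ν) (n : ℕ) :
    normSqPow ν (n + 1) * ((ν : ℝ) + n) = normSqPow ν n * ((n : ℝ) + 1) := by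
  rw [normSqPow, normSqPow, Nat.ascFactorial_succ, Nat.factorial_succ]
  have h1 := (ascFactorial_cast_pos hν n).ne'
  have h2 : (ν : ℝ) + n ≠ 0 := by positivity
  push_cast
  field_simp

theorem normSqPow_zero (ν : ℕ) : normSqPow ν 0 = 1 := by simp [normSqPow]

variable (μ ν k : ℕ)

/-- The coefficients of the bidifferential operator. -/
def diffCoeff (j : ℕ) : ℝ :=
  (-1) ^ j * k.choose j / (μ.ascFactorial j * ν.ascFactorial (k - j))

/-- The bidifferential operator maps `z ^ a w ^ n` to `diffValue a n` times `ζ ^ (a + n - k)`. -/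
def diffValue (a n : ℕ) : ℝ :=
  ∑ j ∈ Finset.range (k + 1), diffCoeff μ ν k j * (a.descFactorial j * n.descFactorial (k - j))

theorem diffValue_eq_zero {a n : ℕ} (h : a + n < k) : diffValue μ ν k a n = 0 := by
  refine Finset.sum_eq_zero fun j hj => ?_
  rw [Finset.mem_range] at hj
  rcases lt_or_ge a j with h1 | h1
  · simp [Nat.descFactorial_of_lt h1]
  · simp [Nat.descFactorial_of_lt (show n < k - j by omega)]

/-- The operator intertwines `∂_z + ∂_w` and `∂_ζ`. -/
theorem diffValue_lowering (a n : ℕ) :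
    ((a : ℝ) + n - k) * diffValue μ ν k a n =
      a * diffValue μ ν k (a - 1) n + n * diffValue μ ν k a (n - 1) := by
  simp only [diffValue, Finset.mul_sum]
  rw [← Finset.sum_add_distrib]
  refine Finset.sum_congr rfl fun j hj => ?_
  have hjk : j ≤ k := Nat.lt_succ_iff.1 (Finset.mem_range.1 hj)
  have h1 := cast_mul_descFactorial_pred a j
  have h2 := cast_mul_descFactorial_pred n (k - j)
  push_cast [hjk] at h2
  linear_combination (-(diffCoeff μ ν k j * n.descFactorial (k - j))) * h1 -
    (diffCoeff μ ν k j * a.descFactorial j) * h2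

/-- For `j < a` the `w`-derivative kills the monomial and for `j > a` the `z`-derivative does, so
only `j = a` is left. -/
theorem diffValue_of_add_eq {a n : ℕ} (h : a + n = k) : diffValue μ ν k a n = (-1) ^ a * k.factorial / (μ.ascFactorial a * ν.ascFactorial n) := by
  subst h
  rw [diffValue, Finset.sum_eq_single a]
  · have := Nat.add_choose_mul_factorial_mul_factorial a n
    rw [← Nat.choose_symm_add] at this
    rw [diffCoeff, Nat.add_sub_cancel_left, Nat.descFactorial_self, Nat.descFactorial_self, ← this]
    push_cast
    ring
  · intro j hj hja
    rw [Finset.mem_range] at hj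
    rcases lt_or_gt_of_ne hja with h1 | h1
    · simp [Nat.descFactorial_of_lt (show n < a + n - j by omega)]
    · simp [Nat.descFactorial_of_lt h1]
  · intro h
    simp at h

variable {μ ν} (hμ : 1 < μ) (hν : 1 < ν)
include hμ hν

/-- This recursion between neighbouring coefficients is what makes the bidifferential operator
covariant; it drives the raising identity. -/
theorem diffCoeff_succ {j : ℕ} (hj : j < k) :
    diffCoeff μ ν k (j + 1) * (((j : ℝ) + 1) * (μ + j)) =
      -(diffCoeff μ ν k j * (((k : ℝ) - j) * (ν + k - j - 1))) := by
  obtain ⟨i, rfl⟩ := Nat.exists_eq_add_of_lt hj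
  have h1 : ((j + i + 1).choose (j + 1) : ℝ) * (j + 1) = (j + i + 1).choose j * (i + 1) := by
    have := Nat.choose_succ_right_eq (j + i + 1) j
    rw [show j + i + 1 - j = i + 1 by omega] at this
    exact_mod_cast this
  have h2 := (ascFactorial_cast_pos hμ j).ne'
  have h3 := (ascFactorial_cast_pos hν i).ne'
  have h4 : (μ : ℝ) + j ≠ 0 := by positivity
  have h5 : (ν : ℝ) + i ≠ 0 := by positivity
  rw [diffCoeff, diffCoeff, show j + i + 1 - (j + 1) = i by omega,
    show j + i + 1 - j = i + 1 by omega, Nat.ascFactorial_succ, Nat.ascFactorial_succ]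
  push_cast
  rw [show (j : ℝ) + i + 1 - j = i + 1 by ring, show (ν : ℝ) + (j + i + 1) - j - 1 = ν + i by ring]
  field_simp
  rw [pow_succ]
  linear_combination (-1 : ℝ) ^ j * (-1) * h1

/-- The operator intertwines the raising operators `z² ∂_z + μ z + w² ∂_w + ν w` and
`ζ² ∂_ζ + (μ + ν + 2k) ζ`. -/
theorem diffValue_raising (a n : ℕ) :
    ((a : ℝ) + n + k + μ + ν) * diffValue μ ν k a n =
      (a + μ) * diffValue μ ν k (a + 1) n + (n + ν) * diffValue μ ν k a (n + 1) := by
  -- The raising identity fails term by term, with defect `g j - g (j + 1)`. This telescopes to 0: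
  -- `g 0` has the factor `j = 0`, and `g (k + 1)` contains the vanishing binomial `k.choose (k +
  -- 1)`.
  let g : ℕ → ℝ := fun j => diffCoeff μ ν k j * (j * (μ + j - 1)) *
    (a.descFactorial (j - 1) * n.descFactorial (k - j))
  have h0 : ∑ j ∈ Finset.range (k + 1), (g j - g (j + 1)) = 0 := by
    rw [Finset.sum_range_sub']
    simp [g, diffCoeff]
  rw [eq_comm, ← sub_eq_zero, ← h0]
  simp only [diffValue, Finset.mul_sum]
  rw [← Finset.sum_add_distrib, ← Finset.sum_sub_distrib]
  refine Finset.sum_congr rfl fun j hj => ?_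
  have hjk : j ≤ k := Nat.lt_succ_iff.1 (Finset.mem_range.1 hj)
  have h1 := cast_mul_descFactorial_pred_index a j
  have h2 := cast_mul_descFactorial_pred_index n (k - j)
  have hg : -g (j + 1) = diffCoeff μ ν k j * (((k : ℝ) - j) * (ν + k - j - 1)) *
      (a.descFactorial j * n.descFactorial (k - j - 1)) := by
    rcases hjk.lt_or_eq with h | rfl
    · have h3 := diffCoeff_succ k hμ hν h
      simp only [g, Nat.add_sub_cancel, Nat.sub_sub]
      push_cast
      linear_combination (-(a.descFactorial j * n.descFactorial (k - (j + 1)) : ℝ)) * h3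
    · simp [g, diffCoeff]
  rw [sub_eq_add_neg (g j), hg, cast_succ_descFactorial, cast_succ_descFactorial]
  push_cast [hjk] at h2 ⊢
  simp only [g]
  linear_combination (diffCoeff μ ν k j * n.descFactorial (k - j)) * h1 +
    (diffCoeff μ ν k j * a.descFactorial j) * h2

theorem normSqDiffPow_pos : 0 < normSqDiffPow μ ν k := by
  refine mul_pos (by exact_mod_cast k.factorial_pos) (Finset.sum_pos (fun j hj => ?_) (by simp))
  have hjk : j ≤ k := Nat.lt_succ_iff.1 (Finset.mem_range.1 hj)
  exact div_pos (by exact_mod_cast Nat.choose_pos hjk)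
    (mul_pos (ascFactorial_cast_pos hμ j) (ascFactorial_cast_pos hν (k - j)))

/-- The sum does not depend on `m`. Lowering rewrites one factor of `D²` on the next antidiagonal
through the current one; after a shift of indices, the ratios of the norms `‖z^n‖²` turn the sum
into the right side of the raising identity. For `m = 0` it is the definition of `‖(z-w)^k‖²`. -/
theorem sum_antidiagonal_diffValue_sq (m : ℕ) :
    (∑ p ∈ Finset.HasAntidiagonal.antidiagonal (m + k), diffValue μ ν k p.1 p.2 ^ 2 /
      (normSqPow μ p.1 * normSqPow ν p.2)) * normSqPow (μ + ν + 2 * k) m =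
      normSqDiffPow μ ν k := by
  induction m with
  | zero =>
    rw [normSqPow_zero, mul_one, zero_add, normSqDiffPow, Finset.mul_sum,
      Finset.Nat.sum_antidiagonal_eq_sum_range_succ_mk]
    refine Finset.sum_congr rfl fun j hj => ?_
    have hjk : j ≤ k := Nat.lt_succ_iff.1 (Finset.mem_range.1 hj)
    simp only
    rw [diffValue_of_add_eq μ ν k (Nat.add_sub_cancel' hjk), Nat.cast_choose ℝ hjk, normSqPow,
      normSqPow]
    have h1 := (ascFactorial_cast_pos hμ j).ne'
    have h2 := (ascFactorial_cast_pos hν (k - j)).ne'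
    have h3 : (j.factorial : ℝ) ≠ 0 := by exact_mod_cast j.factorial_ne_zero
    have h4 : ((k - j).factorial : ℝ) ≠ 0 := by exact_mod_cast (k - j).factorial_ne_zero
    rw [div_pow, mul_pow, ← pow_mul, mul_comm j 2, pow_mul]
    norm_num
    field_simp
  | succ m ih =>
    have hl : 1 < μ + ν + 2 * k := by omega
    have h1 := normSqPow_succ hl m
    have hm : ((μ + ν + 2 * k : ℕ) : ℝ) + m ≠ 0 := by positivity
    have key : ((m : ℝ) + 1) * (∑ p ∈ Finset.HasAntidiagonal.antidiagonal (m + 1 + k), diffValue μ ν k p.1 p.2 ^ 2 /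
          (normSqPow μ p.1 * normSqPow ν p.2)) = (((μ + ν + 2 * k : ℕ) : ℝ) + m) *
        (∑ p ∈ Finset.HasAntidiagonal.antidiagonal (m + k), diffValue μ ν k p.1 p.2 ^ 2 /
          (normSqPow μ p.1 * normSqPow ν p.2)) := by
      let f : ℕ × ℕ → ℝ := fun p => p.1 * diffValue μ ν k (p.1 - 1) p.2 * diffValue μ ν k p.1 p.2 /
        (normSqPow μ p.1 * normSqPow ν p.2)
      let f' : ℕ × ℕ → ℝ := fun p => p.2 * diffValue μ ν k p.1 (p.2 - 1) * diffValue μ ν k p.1 p.2 /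
        (normSqPow μ p.1 * normSqPow ν p.2)
      have e1 : ((m : ℝ) + 1) * (∑ p ∈ Finset.HasAntidiagonal.antidiagonal (m + 1 + k), diffValue μ ν k p.1 p.2 ^ 2 /
          (normSqPow μ p.1 * normSqPow ν p.2)) =
          ∑ p ∈ Finset.HasAntidiagonal.antidiagonal (m + k + 1), f p + ∑ p ∈ Finset.HasAntidiagonal.antidiagonal (m + k + 1), f' p := by
        rw [← Finset.sum_add_distrib, Finset.mul_sum, show m + k + 1 = m + 1 + k by ring]
        refine Finset.sum_congr rfl fun p hp => ?_
        have hp' : (p.1 : ℝ) + p.2 = m + 1 + k := by exact_mod_cast Finset.HasAntidiagonal.mem_antidiagonal.1 hp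
        have h2 := diffValue_lowering μ ν k p.1 p.2
        rw [hp', add_sub_cancel_right] at h2
        simp only [f, f']
        rw [← add_div, ← add_mul, ← h2]
        ring
      rw [e1, Finset.Nat.sum_antidiagonal_succ, Finset.Nat.sum_antidiagonal_succ']
      have e2 : f (0, m + k + 1) = 0 := by simp [f]
      have e3 : f' (m + k + 1, 0) = 0 := by simp [f']
      rw [e2, e3, zero_add, zero_add, ← Finset.sum_add_distrib, Finset.mul_sum]
      refine Finset.sum_congr rfl fun p hp => ?_
      have hp' : (p.1 : ℝ) + p.2 = m + k := by exact_mod_cast Finset.HasAntidiagonal.mem_antidiagonal.1 hp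
      have h2 := diffValue_raising k hμ hν p.1 p.2
      have h3 := normSqPow_succ hμ p.1
      have h4 := normSqPow_succ hν p.2
      have h5 := (normSqPow_pos hμ p.1).ne'
      have h6 := (normSqPow_pos hν p.2).ne'
      have h7 := (normSqPow_pos hμ (p.1 + 1)).ne'
      have h8 := (normSqPow_pos hν (p.2 + 1)).ne'
      have h9 : ((p.1 : ℝ) + 1) / normSqPow μ (p.1 + 1) = (p.1 + μ) / normSqPow μ p.1 := by
        rw [div_eq_div_iff h7 h5]
        linear_combination -h3
      have h10 : ((p.2 : ℝ) + 1) / normSqPow ν (p.2 + 1) = (p.2 + ν) / normSqPow ν p.2 := by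
        rw [div_eq_div_iff h8 h6]
        linear_combination -h4
      have h11 : (((μ + ν + 2 * k : ℕ) : ℝ) + m) * diffValue μ ν k p.1 p.2 =
          (p.1 + μ) * diffValue μ ν k (p.1 + 1) p.2 + (p.2 + ν) * diffValue μ ν k p.1 (p.2 + 1) := by
        rw [← h2]
        push_cast
        linear_combination (-diffValue μ ν k p.1 p.2) * hp'
      simp only [f, f', Nat.add_sub_cancel]
      push_cast at h11 ⊢
      calc _ = ((p.1 : ℝ) + 1) / normSqPow μ (p.1 + 1) * (diffValue μ ν k p.1 p.2 *
            diffValue μ ν k (p.1 + 1) p.2 / normSqPow ν p.2) +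
            ((p.2 : ℝ) + 1) / normSqPow ν (p.2 + 1) * (diffValue μ ν k p.1 p.2 *
            diffValue μ ν k p.1 (p.2 + 1) / normSqPow μ p.1) := by ring
        _ = ((p.1 + μ) * diffValue μ ν k (p.1 + 1) p.2 + (p.2 + ν) * diffValue μ ν k p.1 (p.2 + 1)) *
            diffValue μ ν k p.1 p.2 / (normSqPow μ p.1 * normSqPow ν p.2) := by
          rw [h9, h10]
          ring
        _ = _ := by
          rw [← h11]
          ring
    refine mul_left_cancel₀ hm ?_
    rw [← ih]
    linear_combination (∑ p ∈ Finset.HasAntidiagonal.antidiagonal (m + 1 + k), diffValue μ ν k p.1 p.2 ^ 2 /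
          (normSqPow μ p.1 * normSqPow ν p.2)) * h1 + normSqPow (μ + ν + 2 * k) m * key

end Coefficients

/-! ## Bounds for the columns of the projection -/

section Columns

/-- The right side is the value at 1, by Gauss, of a `₂F₁` series with parameters `k+1`, `b`;
`b+k+q+2`, times `k!`, and the left side is a partial sum. The induction on `k` is a contiguous
relation up to a telescoping term; that term, like the one in the base case, is dropped by sign. -/
theorem sum_factorial_ascFactorial_le (b q k N : ℕ) :
    ∑ m ∈ Finset.range N, ((k + m).factorial : ℝ) / m.factorial *
      (b.ascFactorial m / (b + k + q + 2).ascFactorial m) ≤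
    k.factorial * ((b + q + 1).ascFactorial (k + 1) / (q + 1).ascFactorial (k + 1)) := by
  induction k with
  | zero =>
    let V : ℕ → ℝ := fun m => (b + q + 1 + m) *
      (b.ascFactorial m / (b + q + 2).ascFactorial m)
    have h : ∀ m, ((0 + m).factorial : ℝ) / m.factorial *
        (b.ascFactorial m / (b + 0 + q + 2).ascFactorial m) = (V m - V (m + 1)) / (q + 1) := by
      intro m
      have h1 : (m.factorial : ℝ) ≠ 0 := by exact_mod_cast m.factorial_ne_zero
      have h2 : ((b + q + 2).ascFactorial m : ℝ) ≠ 0 := by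
        exact_mod_cast (Nat.ascFactorial_pos _ _).ne'
      have h3 : (b : ℝ) + q + 2 + m ≠ 0 := by positivity
      have h4 : (q : ℝ) + 1 ≠ 0 := by positivity
      simp only [V, zero_add, add_zero, Nat.ascFactorial_succ]
      push_cast
      field_simp
      ring
    have hV : 0 ≤ V N := by positivity
    have hV0 : V 0 = b + q + 1 := by simp [V]
    simp only [h]
    rw [← Finset.sum_div, Finset.sum_range_sub', hV0]
    simp only [zero_add, Nat.ascFactorial_succ, Nat.ascFactorial_zero, Nat.factorial_zero]
    push_cast
    rw [add_zero, add_zero, mul_one, mul_one, one_mul]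
    gcongr
    linarith
  | succ k ih =>
    let U : ℕ → ℝ := fun m => m * ((k + m).factorial / m.factorial) * ((b + k + q + 2 + m) *
      (b.ascFactorial m / (b + (k + 1) + q + 2).ascFactorial m))
    have h : ∀ m, ((k : ℝ) + q + 2) * (((k + 1 + m).factorial : ℝ) / m.factorial *
        (b.ascFactorial m / (b + (k + 1) + q + 2).ascFactorial m)) =
        (k + 1) * (b + k + q + 2) * (((k + m).factorial : ℝ) / m.factorial *
          (b.ascFactorial m / (b + k + q + 2).ascFactorial m)) + (U m - U (m + 1)) := by
      intro m
      have h1 : (m.factorial : ℝ) ≠ 0 := by exact_mod_cast m.factorial_ne_zero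
      have h2 : ((b + k + q + 3).ascFactorial m : ℝ) ≠ 0 := by
        exact_mod_cast (Nat.ascFactorial_pos _ _).ne'
      have h2' : ((b + k + q + 2).ascFactorial m : ℝ) ≠ 0 := by
        exact_mod_cast (Nat.ascFactorial_pos _ _).ne'
      have h3 : (b : ℝ) + k + q + 3 + m ≠ 0 := by positivity
      have h4 : (m : ℝ) + 1 ≠ 0 := by positivity
      have h5 : ((b : ℝ) + k + q + 2) / (b + k + q + 2).ascFactorial m =
          (b + k + q + 2 + m) / (b + k + q + 3).ascFactorial m := by
        rw [div_eq_div_iff h2' h2]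
        exact_mod_cast Nat.succ_ascFactorial (b + k + q + 2) m
      rw [show b + (k + 1) + q + 2 = b + k + q + 3 by ring, show k + 1 + m = k + m + 1 by ring,
        Nat.factorial_succ]
      simp only [U, show k + (m + 1) = k + m + 1 by ring, Nat.factorial_succ,
        show b + (k + 1) + q + 2 = b + k + q + 3 by ring, Nat.ascFactorial_succ]
      rw [show ((k : ℝ) + 1) * (b + k + q + 2) * (((k + m).factorial : ℝ) / m.factorial *
          (b.ascFactorial m / (b + k + q + 2).ascFactorial m)) =
          (k + 1) * ((k + m).factorial / m.factorial) * b.ascFactorial m *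
          (((b : ℝ) + k + q + 2) / (b + k + q + 2).ascFactorial m) by ring, h5]
      push_cast
      field_simp
      ring
    have hU : 0 ≤ U N := by positivity
    have hU0 : U 0 = 0 := by simp [U]
    have hq : (0 : ℝ) < k + q + 2 := by positivity
    have h1 : ((q + 1).ascFactorial (k + 1) : ℝ) ≠ 0 := by
      exact_mod_cast (Nat.ascFactorial_pos _ _).ne'
    refine le_of_mul_le_mul_left ?_ hq
    rw [Finset.mul_sum]
    simp only [h]
    rw [Finset.sum_add_distrib, Finset.sum_range_sub', hU0, ← Finset.mul_sum]
    calc _ ≤ ((k : ℝ) + 1) * (b + k + q + 2) * (k.factorial *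
          ((b + q + 1).ascFactorial (k + 1) / (q + 1).ascFactorial (k + 1))) + 0 := by
          gcongr
          linarith
      _ = _ := by
          rw [Nat.ascFactorial_succ (n := b + q + 1) (k := k + 1),
            Nat.ascFactorial_succ (n := q + 1) (k := k + 1),
            Nat.factorial_succ]
          push_cast
          have h2 : (q : ℝ) + 1 + (k + 1) ≠ 0 := by positivity
          field_simp
          ring

/-- The Chu–Vandermonde identity; the shifts `x + 1`, `y + 1` turn rising factorials into quotients
of factorials. -/
theorem normSqDiffPow_mul (x y k : ℕ) :
    normSqDiffPow (x + 1) (y + 1) k * ((x + 1).ascFactorial k * (y + 1).ascFactorial k) =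
      k.factorial * (x + y + k + 1).ascFactorial k := by
  have h1 : ∀ (x i j : ℕ), i + j = k → ((x + 1).ascFactorial k : ℝ) =
      (x + 1).ascFactorial i * (j.factorial * (x + k).choose j) := by
    intro x i j hij
    have h2 := Nat.factorial_mul_ascFactorial x k
    have h3 := Nat.factorial_mul_ascFactorial x i
    have h4 := Nat.add_choose_mul_factorial_mul_factorial j (x + i)
    have h5 : (x.factorial : ℝ) ≠ 0 := by exact_mod_cast x.factorial_ne_zero
    rw [← Nat.choose_symm_add, show j + (x + i) = x + k by omega, ← h3, ← h2] at h4
    refine mul_left_cancel₀ h5 ?_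
    rw [← Nat.cast_mul, ← h4]
    push_cast
    ring
  rw [← Nat.add_descFactorial_eq_ascFactorial (x + y + k),
    Nat.descFactorial_eq_factorial_mul_choose, show x + y + k + k = (y + k) + (x + k) by ring,
    Nat.add_choose_eq, Finset.Nat.sum_antidiagonal_eq_sum_range_succ_mk, normSqDiffPow]
  push_cast
  rw [mul_assoc, Finset.sum_mul]
  congr 1
  rw [Finset.mul_sum]
  refine Finset.sum_congr rfl fun j hj => ?_
  have hjk : j ≤ k := Nat.lt_succ_iff.1 (Finset.mem_range.1 hj)
  rw [h1 x j (k - j) (by omega), h1 y (k - j) j (by omega), Nat.cast_choose ℝ hjk]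
  have h2 : ((x + 1).ascFactorial j : ℝ) ≠ 0 := by exact_mod_cast (Nat.ascFactorial_pos _ _).ne'
  have h3 : ((y + 1).ascFactorial (k - j) : ℝ) ≠ 0 := by
    exact_mod_cast (Nat.ascFactorial_pos _ _).ne'
  have h4 : (j.factorial : ℝ) ≠ 0 := by exact_mod_cast j.factorial_ne_zero
  have h5 : ((k - j).factorial : ℝ) ≠ 0 := by exact_mod_cast (k - j).factorial_ne_zero
  field_simp

theorem inv_normSqPow_succ {μ : ℕ} (hμ : 1 < μ) (n : ℕ) :
    (normSqPow μ (n + 1))⁻¹ = (μ + n) / ((n + 1) * normSqPow μ n) := by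
  have h1 := normSqPow_succ hμ n
  have h2 := normSqPow_pos hμ n
  have h3 := normSqPow_pos hμ (n + 1)
  have h4 : (0 : ℝ) < n + 1 := by positivity
  rw [inv_eq_one_div, div_eq_div_iff h3.ne' (by positivity)]
  linear_combination -h1

variable (μ ν k : ℕ)

/-- The square of the coefficient of the projection at `z ^ a w ^ n`, up to the factor
`‖(z - w) ^ k‖ ^ 2`. -/
def columnTerm (a n : ℕ) : ℝ :=
  diffValue μ ν k a n ^ 2 * normSqPow (μ + ν + 2 * k) (a + n - k) / (normSqPow μ a * normSqPow ν n)

theorem diffValue_zero_left (n : ℕ) :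
    diffValue μ ν k 0 n = n.descFactorial k / ν.ascFactorial k := by
  rw [diffValue, Finset.sum_eq_single 0]
  · simp [diffCoeff, div_eq_inv_mul]
  · intro j _ hj
    simp [Nat.descFactorial_of_lt (Nat.pos_of_ne_zero hj)]
  · simp

theorem descFactorial_mono_right {n i j : ℕ} (hij : i ≤ j) (hj : j ≤ n) :
    n.descFactorial i ≤ n.descFactorial j := by
  induction j, hij using Nat.le_induction with
  | base => rfl
  | succ j _ ih =>
    rw [Nat.descFactorial_succ]
    exact (ih (by omega)).trans (Nat.le_mul_of_pos_left _ (by omega))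

/-- As a polynomial in `n`, the term `j = 0` has degree `k` and positive coefficient `1/(ν)_k`,
while the other terms have degree less than `k`. -/
theorem eventually_diffValue_nonneg (hν : 1 < ν) (a : ℕ) :
    ∀ᶠ n in Filter.atTop, 0 ≤ diffValue μ ν k a n := by
  cases k with
  | zero => exact .of_forall fun n => by simp [diffValue, diffCoeff]
  | succ k =>
    let K : ℝ := ∑ j ∈ Finset.range (k + 1), |diffCoeff μ ν (k + 1) (j + 1) * a.descFactorial (j + 1)|
    have hC : 0 < diffCoeff μ ν (k + 1) 0 := by
      have := ascFactorial_cast_pos hν (k + 1)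
      simp only [diffCoeff]
      simpa using this
    have h1 : ∀ᶠ n : ℕ in Filter.atTop, K / diffCoeff μ ν (k + 1) 0 + k ≤ (n : ℝ) :=
      tendsto_natCast_atTop_atTop.eventually_ge_atTop _
    filter_upwards [h1, Filter.eventually_ge_atTop k] with n hn hnk
    rw [diffValue, Finset.sum_range_succ']
    have h2 : K ≤ diffCoeff μ ν (k + 1) 0 * ((n : ℝ) - k) := by
      rw [← div_le_iff₀' hC]
      linarith
    have h3 : |∑ j ∈ Finset.range (k + 1), diffCoeff μ ν (k + 1) (j + 1) *
        (a.descFactorial (j + 1) * n.descFactorial (k + 1 - (j + 1)))| ≤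
        K * n.descFactorial k := by
      rw [Finset.sum_mul]
      refine (Finset.abs_sum_le_sum_abs _ _).trans (Finset.sum_le_sum fun j _ => ?_)
      rw [← mul_assoc, abs_mul, Nat.abs_cast]
      gcongr
      exact descFactorial_mono_right (by omega) hnk
    have h4 := mul_le_mul_of_nonneg_right h2 (Nat.cast_nonneg (α := ℝ) (n.descFactorial k))
    have h5 := neg_le_of_abs_le h3
    simp only [Nat.add_sub_add_right] at h5 ⊢
    rw [Nat.descFactorial_zero, Nat.sub_zero, cast_descFactorial_succ]
    push_cast
    linarith

variable {μ ν}

section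

variable (hμ : 1 < μ) (hν : 1 < ν)
include hμ hν

theorem columnTerm_nonneg (a n : ℕ) : 0 ≤ columnTerm μ ν k a n := by
  have h1 := normSqPow_pos hμ a
  have h2 := normSqPow_pos hν n
  have h3 := normSqPow_pos (show 1 < μ + ν + 2 * k by omega) (a + n - k)
  rw [columnTerm]
  positivity

/-- The right side is a difference `B(n+1) - B(n)` with `B(0) = 0`. Raising expands one `D(a,n)` in
the term of column `a`, lowering one `D(a+1,n)` in that of column `a+1`, and the products `D(a,n)
D(a+1,n)` cancel. -/
theorem columnTerm_sub (a n : ℕ) :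
    columnTerm μ ν k a n - columnTerm μ ν k (a + 1) n =
      ((n + 1 : ℕ) * diffValue μ ν k a (n + 1) * diffValue μ ν k (a + 1) (n + 1 - 1) *
        normSqPow (μ + ν + 2 * k) (a + (n + 1) - k) /
        ((a + 1) * normSqPow μ a * normSqPow ν (n + 1))) -
      (n * diffValue μ ν k a n * diffValue μ ν k (a + 1) (n - 1) *
        normSqPow (μ + ν + 2 * k) (a + n - k) / ((a + 1) * normSqPow μ a * normSqPow ν n)) := by
  have h1 := diffValue_raising k hμ hν a n
  have h2 := diffValue_lowering μ ν k (a + 1) n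
  -- For `a + n < k` the subtraction `a + n - k` is truncated and the norm recursion unavailable,
  -- but there `D(a,n) = 0`.
  have h3 : ((a : ℝ) + n + k + μ + ν) * diffValue μ ν k a n *
      normSqPow (μ + ν + 2 * k) (a + n + 1 - k) =
      (a + 1 + n - k) * diffValue μ ν k a n * normSqPow (μ + ν + 2 * k) (a + n - k) := by
    rcases lt_or_ge (a + n) k with h | h
    · simp [diffValue_eq_zero μ ν k h]
    · have h4 := normSqPow_succ (show 1 < μ + ν + 2 * k by omega) (a + n - k)
      rw [Nat.sub_add_comm h]
      push_cast [h] at h4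
      linear_combination diffValue μ ν k a n * h4
  have h5 := normSqPow_pos hμ a
  have h6 := normSqPow_pos hν n
  have h7 : (a : ℝ) + 1 ≠ 0 := by positivity
  have h8 : (n : ℝ) + 1 ≠ 0 := by positivity
  rw [Nat.add_sub_cancel] at h2 ⊢
  push_cast at h2 ⊢
  rw [columnTerm, columnTerm, show a + 1 + n = a + n + 1 by ring, ← add_assoc a n 1]
  simp only [div_eq_mul_inv, mul_inv, inv_normSqPow_succ hμ, inv_normSqPow_succ hν]
  field_simp
  generalize diffValue μ ν k a n = X at *
  generalize diffValue μ ν k (a + 1) n = Y at *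
  generalize diffValue μ ν k a (n + 1) = Z at *
  generalize diffValue μ ν k (a + 1) (n - 1) = W at *
  generalize normSqPow (μ + ν + 2 * k) (a + n + 1 - k) = H1 at *
  generalize normSqPow (μ + ν + 2 * k) (a + n - k) = H0 at *
  linear_combination Y * H1 * h1 - X * H0 * h2 - Y * h3

/-- The terms with `n < k` vanish, and with `n = k + m` the others form the hypergeometric sum with
`b = ν + k` and `q = μ - 2`. Its value, divided by `‖(z-w)^k‖²`, is the constant `c`. -/
theorem sum_columnTerm_zero_le (N : ℕ) :
    ∑ n ∈ Finset.range N, columnTerm μ ν k 0 n ≤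
      normSqDiffPow μ ν k * (((μ : ℝ) + ν + 2 * k - 1) / (μ - 1)) := by
  have hl : 1 < μ + ν + 2 * k := by omega
  refine (Finset.sum_le_sum_of_subset_of_nonneg (Finset.range_mono (Nat.le_add_left N k))
    fun n _ _ => columnTerm_nonneg k hμ hν 0 n).trans ?_
  rw [Finset.sum_range_add, Finset.sum_eq_zero, zero_add]
  · obtain ⟨q, rfl⟩ : ∃ q, μ = q + 2 := Nat.exists_eq_add_of_le' hμ
    obtain ⟨y, rfl⟩ := Nat.exists_eq_add_of_le' hν.le
    have h0 : (0 : ℝ) < (y + 1).ascFactorial k := ascFactorial_cast_pos hν k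
    have h : ∀ m, columnTerm (q + 2) (y + 1) k 0 (k + m) = ((y + 1).ascFactorial k : ℝ)⁻¹ *
        (((k + m).factorial : ℝ) / m.factorial * ((y + 1 + k).ascFactorial m /
          (y + 1 + k + k + q + 2).ascFactorial m)) := by
      intro m
      have h1 := Nat.factorial_mul_descFactorial (Nat.le_add_right k m)
      rw [Nat.add_sub_cancel_left] at h1
      have h2 : ((y + 1).ascFactorial (k + m) : ℝ) =
          (y + 1).ascFactorial k * (y + 1 + k).ascFactorial m := by
        exact_mod_cast (Nat.ascFactorial_mul_ascFactorial (y + 1) k m).symm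
      have h3 : (m.factorial : ℝ) ≠ 0 := by exact_mod_cast m.factorial_ne_zero
      have h4 : ((k + m).descFactorial k : ℝ) ≠ 0 := by
        exact_mod_cast (Nat.descFactorial_pos.2 (Nat.le_add_right k m)).ne'
      have h5 := (ascFactorial_cast_pos hl m).ne'
      rw [show q + 2 + (y + 1) + 2 * k = y + 1 + k + k + q + 2 by ring] at h5
      rw [columnTerm, diffValue_zero_left, normSqPow_zero, one_mul, normSqPow, normSqPow, h2,
        show 0 + (k + m) - k = m by omega, ← h1,
        show q + 2 + (y + 1) + 2 * k = y + 1 + k + k + q + 2 by ring]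
      push_cast
      field_simp
    simp only [h]
    rw [← Finset.mul_sum]
    have h1 := normSqDiffPow_mul (q + 1) y k
    have h2 : (0 : ℝ) < (q + 2).ascFactorial k := ascFactorial_cast_pos hμ k
    have h3 : (((q + 1).ascFactorial (k + 1) : ℕ) : ℝ) = (q + 1) * (q + 2).ascFactorial k := by
      exact_mod_cast (Nat.ascFactorial_succ (n := q + 1) (k := k)).trans
        (Nat.succ_ascFactorial (q + 1) k).symm
    have h4 : (((y + 1 + k + q + 1).ascFactorial (k + 1) : ℕ) : ℝ) =
        (q + y + 2 * k + 2) * (q + 1 + y + k + 1).ascFactorial k := by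
      rw [Nat.ascFactorial_succ, show y + 1 + k + q + 1 = q + 1 + y + k + 1 by ring]
      push_cast
      ring
    refine (mul_le_mul_of_nonneg_left (sum_factorial_ascFactorial_le (y + 1 + k) q k N)
      (inv_nonneg.2 h0.le)).trans_eq ?_
    have h5 : normSqDiffPow (q + 2) (y + 1) k = k.factorial * (q + 1 + y + k + 1).ascFactorial k /
        ((q + 2).ascFactorial k * (y + 1).ascFactorial k) := by
      rw [eq_div_iff (by positivity)]
      exact h1
    have h6 : (q : ℝ) + 1 ≠ 0 := by positivity
    rw [h3, h4, h5]
    push_cast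
    rw [show (q : ℝ) + 2 - 1 = q + 1 by ring]
    field_simp
    ring
  · intro n hn
    simp [columnTerm, diffValue_eq_zero μ ν k (a := 0) (n := n)
      (by simpa using Finset.mem_range.1 hn)]

theorem sum_columnTerm_le (a N : ℕ) :
    ∑ n ∈ Finset.range N, columnTerm μ ν k a n ≤
      normSqDiffPow μ ν k * (((μ : ℝ) + ν + 2 * k - 1) / (μ - 1)) := by
  induction a generalizing N with
  | zero => exact sum_columnTerm_zero_le k hμ hν N
  | succ a ih =>
    have h1 := (eventually_diffValue_nonneg μ ν k hν a).and
      ((Filter.tendsto_sub_atTop_nat 1).eventually (eventually_diffValue_nonneg μ ν k hν (a + 1)))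
    -- The range is enlarged until both values of `D` in the boundary term are nonnegative; then
    -- column `a + 1` is at most column `a` up to `N'`, hence its sum up to `N` is bounded too.
    obtain ⟨N', ⟨h2, h3⟩, h4⟩ := (h1.and (Filter.eventually_ge_atTop N)).exists
    have h5 := Finset.sum_congr rfl fun n (_ : n ∈ Finset.range N') => columnTerm_sub k hμ hν a n
    rw [Finset.sum_range_sub (fun n : ℕ => n * diffValue μ ν k a n *
      diffValue μ ν k (a + 1) (n - 1) * normSqPow (μ + ν + 2 * k) (a + n - k) /
      ((a + 1) * normSqPow μ a * normSqPow ν n)), Finset.sum_sub_distrib, Nat.cast_zero, zero_mul,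
      zero_mul, zero_mul, zero_div, sub_zero] at h5
    have h6 : 0 ≤ N' * diffValue μ ν k a N' *
        diffValue μ ν k (a + 1) (N' - 1) * normSqPow (μ + ν + 2 * k) (a + N' - k) /
        ((a + 1) * normSqPow μ a * normSqPow ν N') := by
      have h7 := normSqPow_pos hμ a
      have h8 := normSqPow_pos hν N'
      have h9 := normSqPow_pos (show 1 < μ + ν + 2 * k by omega) (a + N' - k)
      positivity
    have h10 := Finset.sum_le_sum_of_subset_of_nonneg (Finset.range_mono h4)
      fun n _ _ => columnTerm_nonneg k hμ hν (a + 1) n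
    linarith [ih N']

end

end Columns

/-! ## The projection onto the component -/

section Projection

variable (μ ν k : ℕ)

/-- The projection maps `e_a ⊗ e_n` to `projCoeff a n` times `e_{a+n-k}`, where the `e_n` are the
normalized monomials. -/
def projCoeff (a n : ℕ) : ℝ :=
  projConst μ ν k * diffValue μ ν k a n * normPow (μ + ν + 2 * k) (a + n - k) /
    (normPow μ a * normPow ν n)

theorem projCoeff_eq_zero {a n : ℕ} (h : a + n < k) : projCoeff μ ν k a n = 0 := by
  simp [projCoeff, diffValue_eq_zero μ ν k h]

theorem diffValue_mul_pow (a n : ℕ) (z : ℂ) :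
    (diffValue μ ν k a n : ℂ) * z ^ (a + n - k) = ∑ j ∈ Finset.range (k + 1),
      (-1) ^ j * (k.choose j : ℂ) / ((μ.ascFactorial j : ℂ) * (ν.ascFactorial (k - j) : ℂ)) *
        (a.descFactorial j * z ^ (a - j) * (n.descFactorial (k - j) * z ^ (n - (k - j)))) := by
  rw [diffValue]
  push_cast
  rw [Finset.sum_mul]
  refine Finset.sum_congr rfl fun j hj => ?_
  have hjk : j ≤ k := Nat.lt_succ_iff.1 (Finset.mem_range.1 hj)
  rcases lt_or_ge a j with h1 | h1
  · simp [Nat.descFactorial_of_lt h1]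
  rcases lt_or_ge n (k - j) with h2 | h2
  · simp [Nat.descFactorial_of_lt h2]
  rw [show a + n - k = (a - j) + (n - (k - j)) by omega, pow_add, diffCoeff]
  push_cast
  ring

variable {μ ν} (hμ : 1 < μ) (hν : 1 < ν)

theorem one_lt_add_add {μ ν : ℕ} (hμ : 1 < μ) (k : ℕ) : 1 < μ + ν + 2 * k := by omega

/-- The vector `P* e_m` for the projection `P`. -/
def projVector (m : ℕ) : HilbertTensor (Bergman μ) (Bergman ν) :=
  ∑ p ∈ Finset.HasAntidiagonal.antidiagonal (m + k),
    (projCoeff μ ν k p.1 p.2 : ℂ) • tmul (monomialBasis hμ p.1) (monomialBasis hν p.2)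

include hμ hν

theorem projCoeff_sq (a n : ℕ) :
    projCoeff μ ν k a n ^ 2 = (normSqDiffPow μ ν k)⁻¹ * columnTerm μ ν k a n := by
  rw [projCoeff, columnTerm, div_pow, mul_pow, mul_pow, mul_pow, normPow_sq hμ, normPow_sq hν,
    normPow_sq (one_lt_add_add hμ k), projConst, inv_pow,
    Real.sq_sqrt (normSqDiffPow_pos k hμ hν).le]
  ring

theorem sum_antidiagonal_projCoeff_sq (m : ℕ) :
    ∑ p ∈ Finset.HasAntidiagonal.antidiagonal (m + k), projCoeff μ ν k p.1 p.2 ^ 2 = 1 := by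
  simp only [projCoeff_sq k hμ hν]
  rw [← Finset.mul_sum, inv_mul_eq_one₀ (normSqDiffPow_pos k hμ hν).ne',
    ← sum_antidiagonal_diffValue_sq k hμ hν m, Finset.sum_mul]
  refine Finset.sum_congr rfl fun p hp => ?_
  rw [columnTerm, Finset.HasAntidiagonal.mem_antidiagonal.1 hp, Nat.add_sub_cancel]
  ring

theorem sum_projCoeff_sq_le (a N : ℕ) :
    ∑ n ∈ Finset.range N, projCoeff μ ν k a n ^ 2 ≤ ((μ : ℝ) + ν + 2 * k - 1) / (μ - 1) := by
  simp only [projCoeff_sq k hμ hν]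
  rw [← Finset.mul_sum, inv_mul_le_iff₀ (normSqDiffPow_pos k hμ hν)]
  exact sum_columnTerm_le k hμ hν a N

theorem tsum_enorm_projCoeff_sq_le (a : ℕ) :
    ∑' n, ‖(projCoeff μ ν k a n : ℂ)‖ₑ ^ 2 ≤
      ENNReal.ofReal (((μ : ℝ) + ν + 2 * k - 1) / (μ - 1)) := by
  refine ENNReal.tsum_le_of_sum_range_le fun N => ?_
  have h : ∀ n, ‖(projCoeff μ ν k a n : ℂ)‖ₑ ^ 2 = ENNReal.ofReal (projCoeff μ ν k a n ^ 2) := by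
    intro n
    rw [← ofReal_norm, ← ENNReal.ofReal_pow (norm_nonneg _), Complex.norm_real, Real.norm_eq_abs,
      sq_abs]
  simp only [h]
  rw [← ENNReal.ofReal_sum_of_nonneg fun n _ => sq_nonneg _]
  exact ENNReal.ofReal_le_ofReal (sum_projCoeff_sq_le k hμ hν a N)

theorem inner_projVector_tmul (m : ℕ) (x : Bergman μ) (y : Bergman ν) :
    ⟪projVector k hμ hν m, tmul x y⟫_ℂ =
      ∑ p ∈ Finset.HasAntidiagonal.antidiagonal (m + k), (projCoeff μ ν k p.1 p.2 : ℂ) *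
        (⟪monomialBasis hμ p.1, x⟫_ℂ * ⟪monomialBasis hν p.2, y⟫_ℂ) := by
  simp only [projVector, sum_inner, inner_smul_left, inner_tmul_tmul, Complex.conj_ofReal]

theorem inner_projVector_tmul_basis (m : ℕ) (x : Bergman μ) (n : ℕ) :
    ⟪projVector k hμ hν m, tmul x (monomialBasis hν n)⟫_ℂ =
      if n ≤ m + k then (projCoeff μ ν k (m + k - n) n : ℂ) *
        ⟪monomialBasis hμ (m + k - n), x⟫_ℂ else 0 := by
  rw [inner_projVector_tmul]
  have h1 := orthonormal_iff_ite.1 (monomialBasis hν).orthonormal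
  simp only [h1]
  split_ifs with h
  · rw [Finset.sum_eq_single (m + k - n, n)]
    · simp
    · intro p hp hpn
      have hp' := Finset.HasAntidiagonal.mem_antidiagonal.1 hp
      have : p.2 ≠ n := fun h2 => hpn (Prod.ext (by simp only; omega) h2)
      simp [this]
    · intro hp
      exact absurd (Finset.HasAntidiagonal.mem_antidiagonal.2 (Nat.sub_add_cancel h)) hp
  · refine Finset.sum_eq_zero fun p hp => ?_
    have hp' := Finset.HasAntidiagonal.mem_antidiagonal.1 hp
    have : p.2 ≠ n := by omega
    simp [this]

theorem inner_projVector_tmul_basis_basis (m a n : ℕ) :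
    ⟪projVector k hμ hν m, tmul (monomialBasis hμ a) (monomialBasis hν n)⟫_ℂ =
      if a + n = m + k then (projCoeff μ ν k a n : ℂ) else 0 := by
  rw [inner_projVector_tmul_basis, orthonormal_iff_ite.1 (monomialBasis hμ).orthonormal]
  split_ifs with h1 h2 h3 h3 h3
  · rw [h2, mul_one]
  · omega
  · omega
  · simp
  · omega
  · rfl

theorem orthonormal_projVector : Orthonormal ℂ (projVector k hμ hν) := by
  rw [orthonormal_iff_ite]
  intro m n
  have h : ⟪projVector k hμ hν m, projVector k hμ hν n⟫_ℂ =
      ∑ p ∈ Finset.HasAntidiagonal.antidiagonal (n + k),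
        if n = m then (projCoeff μ ν k p.1 p.2 : ℂ) ^ 2 else 0 := by
    conv_lhs => rhs; rw [projVector]
    rw [inner_sum]
    refine Finset.sum_congr rfl fun p hp => ?_
    rw [inner_smul_right, inner_projVector_tmul_basis_basis,
      Finset.HasAntidiagonal.mem_antidiagonal.1 hp]
    simp only [Nat.add_right_cancel_iff]
    split_ifs <;> ring
  rw [h]
  split_ifs with h1 h2 h2
  · exact_mod_cast sum_antidiagonal_projCoeff_sq k hμ hν n
  · exact absurd h1.symm h2
  · exact absurd h2.symm h1
  · simp

/-- The adjoint of the projection. -/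
def embedding : Bergman (μ + ν + 2 * k) →ₗᵢ[ℂ] HilbertTensor (Bergman μ) (Bergman ν) :=
  (orthonormal_projVector k hμ hν).orthogonalFamily.linearIsometry.comp
    (monomialBasis (one_lt_add_add hμ k)).repr.toLinearIsometry

theorem embedding_monomialBasis (m : ℕ) :
    embedding k hμ hν (monomialBasis (one_lt_add_add hμ k) m) = projVector k hμ hν m := by
  rw [embedding, LinearIsometry.coe_comp, Function.comp_apply,
    LinearIsometryEquiv.coe_toLinearIsometry, HilbertBasis.repr_self, OrthogonalFamily.linearIsometry_apply_single]
  simp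

/-- The projection, as the adjoint of an isometry. -/
def proj : HilbertTensor (Bergman μ) (Bergman ν) →L[ℂ] Bergman (μ + ν + 2 * k) :=
  (embedding k hμ hν).toContinuousLinearMap.adjoint

theorem proj_comp_adjoint : proj k hμ hν ∘L (proj k hμ hν).adjoint = 1 := by
  rw [proj, ContinuousLinearMap.adjoint_adjoint]
  exact (ContinuousLinearMap.norm_map_iff_adjoint_comp_self _).1 (embedding k hμ hν).norm_map

theorem inner_monomialBasis_proj (m : ℕ) (t : HilbertTensor (Bergman μ) (Bergman ν)) :
    ⟪monomialBasis (one_lt_add_add hμ k) m, proj k hμ hν t⟫_ℂ = ⟪projVector k hμ hν m, t⟫_ℂ := by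
  rw [proj, ContinuousLinearMap.adjoint_inner_right, ← embedding_monomialBasis]
  rfl

theorem proj_tmul_monomialBasis (a n : ℕ) :
    proj k hμ hν (tmul (monomialBasis hμ a) (monomialBasis hν n)) =
      (projCoeff μ ν k a n : ℂ) • monomialBasis (one_lt_add_add hμ k) (a + n - k) := by
  refine (monomialBasis (one_lt_add_add hμ k)).repr.injective (lp.ext (funext fun m => ?_))
  rw [HilbertBasis.repr_apply_apply, HilbertBasis.repr_apply_apply, inner_monomialBasis_proj,
    inner_projVector_tmul_basis_basis, inner_smul_right,
    orthonormal_iff_ite.1 (monomialBasis (one_lt_add_add hμ k)).orthonormal]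
  split_ifs with h1 h2 h2
  · rw [mul_one]
  · omega
  · rw [projCoeff_eq_zero μ ν k (by omega)]
    simp
  · rw [mul_zero]

/-- The formula holds on pairs of monomials. Both sides are bounded linear in each factor
separately, derivatives at `ζ` being bounded functionals, so it extends first in `f` and then in
`g`. -/
theorem isComponentProj_proj : IsComponentProj μ ν k (proj k hμ hν) := by
  intro f g ζ hζ
  have hl := one_lt_add_add (ν := ν) hμ k
  let w : ℕ → ℂ := fun j => (projConst μ ν k : ℂ) *
    ((-1) ^ j * (k.choose j : ℂ) / ((μ.ascFactorial j : ℂ) * (ν.ascFactorial (k - j) : ℂ)))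
  have h1 : ∀ a n, evalDeriv hl 0 hζ (proj k hμ hν (tmul (monomialBasis hμ a) (monomialBasis hν n))) =
      ∑ j ∈ Finset.range (k + 1), w j * (evalDeriv hμ j hζ (monomialBasis hμ a) *
        evalDeriv hν (k - j) hζ (monomialBasis hν n)) := by
    intro a n
    rw [proj_tmul_monomialBasis, map_smul]
    simp only [evalDeriv_apply, iteratedDeriv_holo_monomialBasis _ _ _ hζ]
    have h2 := diffValue_mul_pow μ ν k a n ζ
    have h3 : (normPow (μ + ν + 2 * k) (a + n - k) : ℂ) ≠ 0 := by
      exact_mod_cast (normPow_pos hl (a + n - k)).ne'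
    calc _ = (projConst μ ν k : ℂ) * ((normPow μ a : ℂ)⁻¹ * (normPow ν n : ℂ)⁻¹) *
          (diffValue μ ν k a n * ζ ^ (a + n - k)) := by
          rw [projCoeff]
          push_cast
          simp only [smul_eq_mul, Nat.descFactorial_zero, Nat.cast_one, one_mul, Nat.sub_zero]
          field_simp
      _ = _ := by
          rw [h2, Finset.mul_sum]
          refine Finset.sum_congr rfl fun j _ => ?_
          simp only [w]
          ring
  have h2 : ∀ n, evalDeriv hl 0 hζ ∘L proj k hμ hν ∘L tmulRight (Bergman μ) (monomialBasis hν n) =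
      ∑ j ∈ Finset.range (k + 1),
        (w j * evalDeriv hν (k - j) hζ (monomialBasis hν n)) • evalDeriv hμ j hζ := by
    intro n
    refine HilbertBasis.clm_ext (monomialBasis hμ) fun a => ?_
    simp only [ContinuousLinearMap.comp_apply, tmulRight_apply, h1, sum_apply,
      smul_apply, smul_eq_mul]
    exact Finset.sum_congr rfl fun j _ => by ring
  have h3 : evalDeriv hl 0 hζ ∘L proj k hμ hν ∘L tmulLeft (Bergman ν) f =
      ∑ j ∈ Finset.range (k + 1), (w j * evalDeriv hμ j hζ f) • evalDeriv hν (k - j) hζ := by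
    refine HilbertBasis.clm_ext (monomialBasis hν) fun n => ?_
    have h4 := DFunLike.congr_fun (h2 n) f
    simp only [ContinuousLinearMap.comp_apply, tmulRight_apply, tmulLeft_apply,
      sum_apply, smul_apply, smul_eq_mul] at h4 ⊢
    rw [h4]
    exact Finset.sum_congr rfl fun j _ => by ring
  have h4 := DFunLike.congr_fun h3 g
  simp only [ContinuousLinearMap.comp_apply, tmulLeft_apply, sum_apply,
    smul_apply, smul_eq_mul, evalDeriv_apply, iteratedDeriv_zero] at h4
  rw [h4, Finset.mul_sum]
  refine Finset.sum_congr rfl fun j _ => ?_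
  simp only [w]
  ring

/-- Existence and uniqueness together exclude the default value 0 of `componentProj`. -/
theorem componentProj_eq_proj : componentProj μ ν k = proj k hμ hν := by
  have h : ∃ P, IsComponentProj μ ν k P := ⟨_, isComponentProj_proj k hμ hν⟩
  rw [componentProj, dif_pos h]
  exact h.choose_spec.unique (isComponentProj_proj k hμ hν)

/-- For fixed `n` the images of the `e_a ⊗ e_n` are multiples of distinct basis vectors or zero, so
`∑ V_n* V_n` is diagonal in the `e_a`, with the column sums as entries. -/
theorem tsum_enorm_proj_tmul_sq_le (x : Bergman μ) :
    ∑' n, ‖proj k hμ hν (tmul x (monomialBasis hν n))‖ₑ ^ 2 ≤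
      ENNReal.ofReal (((μ : ℝ) + ν + 2 * k - 1) / (μ - 1)) * ‖x‖ₑ ^ 2 := by
  let f : ℕ → ℕ → ℝ≥0∞ := fun a n =>
    ‖⟪monomialBasis hμ a, x⟫_ℂ‖ₑ ^ 2 * ‖(projCoeff μ ν k a n : ℂ)‖ₑ ^ 2
  have h1 : ∀ n, ‖proj k hμ hν (tmul x (monomialBasis hν n))‖ₑ ^ 2 ≤ ∑' a, f a n := by
    intro n
    rw [← tsum_enorm_inner_sq (monomialBasis (one_lt_add_add hμ k))]
    calc _ ≤ ∑' m, ∑' a, if a + n = m + k then f a n else 0 := by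
          refine ENNReal.tsum_le_tsum fun m => ?_
          rw [inner_monomialBasis_proj, inner_projVector_tmul_basis]
          split_ifs with h
          · refine le_trans ?_ (ENNReal.le_tsum (m + k - n))
            rw [if_pos (Nat.sub_add_cancel h), enorm_mul, mul_pow, mul_comm]
          · simp
      _ = ∑' a, ∑' m, if a + n = m + k then f a n else 0 := ENNReal.tsum_comm
      _ ≤ _ := by
          refine ENNReal.tsum_le_tsum fun a => ?_
          rw [tsum_eq_single (a + n - k)]
          · split_ifs <;> simp
          · intro m hm
            rw [if_neg (by omega)]
  calc _ ≤ ∑' n, ∑' a, f a n := ENNReal.tsum_le_tsum h1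
    _ = ∑' a, ∑' n, f a n := ENNReal.tsum_comm
    _ ≤ ∑' a, ‖⟪monomialBasis hμ a, x⟫_ℂ‖ₑ ^ 2 *
        ENNReal.ofReal (((μ : ℝ) + ν + 2 * k - 1) / (μ - 1)) := by
      refine ENNReal.tsum_le_tsum fun a => ?_
      rw [ENNReal.tsum_mul_left]
      gcongr
      exact tsum_enorm_projCoeff_sq_le k hμ hν a
    _ = _ := by rw [ENNReal.tsum_mul_right, tsum_enorm_inner_sq, mul_comm]

theorem isKrausFamily_channel :
    IsKrausFamily (fun n => proj k hμ hν ∘L tmulRight (Bergman μ) (monomialBasis hν n))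
      (channel μ ν k) := by
  have h := isKrausFamily_conjMap (E := Bergman μ) (monomialBasis hν) (proj_comp_adjoint k hμ hν)
  rwa [← componentProj_eq_proj k hμ hν] at h ⊢

end Projection

end BergmanChannel

end

open BergmanChannel in
theorem mainTheorem12 (μ ν k : ℕ) (hμ : 1 < μ) (hν : 1 < ν) :
    channel μ ν k 1 = 1 ∧
    Continuous[weakStarTopology (Bergman μ), weakStarTopology (Bergman (μ + ν + 2 * k))]
      (channel μ ν k) ∧
    (∀ A : Bergman μ →L[ℂ] Bergman μ, IsCompactOperator A → IsCompactOperator (channel μ ν k A)) ∧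
    ‖channel μ ν k‖ = 1 ∧
    ∀ p : ℝ, 1 ≤ p → ∀ A : Bergman μ →L[ℂ] Bergman μ, MemSchatten p A →
      MemSchatten p (channel μ ν k A) ∧
      schattenNorm p (channel μ ν k A) ≤
        (2 * (((μ : ℝ) + ν + 2 * k - 1) / ((μ : ℝ) - 1))) ^ (1 / p) * schattenNorm p A := by
  have := nontrivial_bergman hμ
  have := nontrivial_bergman (one_lt_add_add (ν := ν) hμ k)
  have h := isKrausFamily_channel k hμ hν
  have hV := tsum_enorm_proj_tmul_sq_le k hμ hν
  have hC : 0 ≤ ((μ : ℝ) + ν + 2 * k - 1) / ((μ : ℝ) - 1) := by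
    have h1 : (1 : ℝ) < μ := by exact_mod_cast hμ
    exact div_nonneg (by linarith [Nat.cast_nonneg (α := ℝ) ν, Nat.cast_nonneg (α := ℝ) k])
      (by linarith)
  refine ⟨h.apply_one, h.continuous_weakStar,
    fun A hA => h.isCompactOperator ENNReal.ofReal_ne_top hV hA, h.norm_eq_one, fun p hp A hA => ?_⟩
  obtain ⟨h1, h2⟩ := h.memSchatten_and_schattenNorm_le hC hV hp hA
  refine ⟨h1, h2.trans (mul_le_mul_of_nonneg_right ?_ (by unfold schattenNorm; positivity))⟩
  -- The factor 2 is given away here: the bound already holds with `c` in place of `2c`.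
  exact Real.rpow_le_rpow hC (by linarith) (by positivity)
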